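/- **Setting.** Let $M$ be a finite-dimensional smooth (Hausdorff, boundaryless) manifold with a smooth torsion-free affine connection $\nabla$ such that for every $x\in M$ the exponential map $\exp_x$ is defined on all of $T_xM$ and maps $T_xM$ onto $M$. A set $C\subseteq M$ is convex if every geodesic segment with both endpoints in $C$ lies in $C$. For a smooth function $f$, let $Hf(X,Y)=X(Df(Y))-Df(\nabla_XY)$ be its Hessian and $\nabla_v Hf$ the covariant derivative of the Hessian. For an open convex $C$, a smooth function $F:C\to\mathbb R$ is *$1$-self-concordant* if it is convex along geodesics, has closed epigraph in $M\times\mathbb R$, has positive definite Hessian $HF_x$ at every $x\in C$, and satisfies $|(\nabla_vHF)(u,u)|\le 2\,HF(v,v)^{1/2}HF(u,u)$ for all $x\in C$, $u,v\in T_xM$. It is a *$\nu$-self-concordant barrier* ($\nu>0$) if moreover $2DF_x(u)-HF_x(u,u)\le\nu$ for all $x\in C$, $u\in T_xM$. For a covector $p\in T_x^*M$ write $\|p\|^*_{F,x}=\sqrt{HF_x^{-1}(p,p)}$. Let $Q\subseteq M$ be compact and convex with nonempty interior $Q^\circ$, let $\ell:Q\to\mathbb R$ be a nonconstant affine function (continuous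 on $Q$, smooth on $Q^\circ$, and affine along every geodesic segment in $Q$), let $\ell^*=\min_Q\ell$, and let $F:Q^\circ\to\mathbb R$ be a $\nu$-self-concordant barrier. Put $f_t=t\ell+F$ for $t\ge 0$. Fix $\beta$ with $0<\beta<\frac{\sqrt\beta}{1+\sqrt\beta}$ (for example $\beta=1/9$), and put $\alpha=\frac{\sqrt\beta}{1+\sqrt\beta}-\beta>0$. One step of the path-following method sends $(x,t)$ to $(x^+,t^+)$, where $$t^+=t+\frac{\alpha}{\|D\ell_x\|^*_{F,x}},\qquad x^+=\exp_x\bar u,\qquad \bar u=-\bigl(H(f_{t^+})_x\bigr)^{-1}(Df_{t^+})_x .$$ The method starts from $(x_0,0)$, where $x_0\in Q^\circ$ satisfies $\|DF_{x_0}\|^*_{F,x_0}\le\beta$, and iterates this step, producing $(x_k,t_k)$, $k=0,1,2,\dots$ **Theorem.** Let $x\in Q^\circ$ and $t\ge0$ satisfy $\|(Df_t)_x\|^*_{F,x}\le\beta$. Then: 1. $x^+\in Q^\circ$ and $\|(Df_{t^+})_{x^+}\|^*_{F,x^+}\le\beta$. If in addition $t>0$, then: 2. $\|D\ell_x\|^*_{F,x}\le\frac1t(\beta+\sqrt\nu)$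 and $t^+\ge\Bigl(1+\frac{\alpha}{\beta+\sqrt\nu}\Bigr)t$; 3. $\ell(x)-\ell^*\le\frac1t\Bigl(\nu+\frac{(\beta+\sqrt\nu)\beta}{1-\beta}\Bigr)$. Consequently the path-following method finds an $\epsilon$-optimal point in $O\bigl(\sqrt\nu\,\log(\nu\|D\ell_{x_0}\|^*_{F,x_0}/\epsilon)\bigr)$ iterations, in the following sense: there is a constant $K>0$ depending only on $\beta$ such that for all data as above and every $\epsilon>0$ there is an integer $$0\le N\le K\sqrt\nu\,\max\Bigl\{1,\ \log\frac{\nu\,\|D\ell_{x_0}\|^*_{F,x_0}}{\epsilon}\Bigr\}$$ such that $x_k\in Q^\circ$ and $\ell(x_k)-\ell^*\le\epsilon$ for all $k\ge N$. -/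

import Mathlib

open scoped Manifold ContDiff Topology

noncomputable section

namespace PathFollowing

section Algebra

variable {V : Type*} [AddCommGroup V] [Module ℝ V]

/-- For a nondegenerate bilinear form `G` on a finite-dimensional space `V`, viewed as the map
`w ↦ G(w, ·)` from `V` to its dual, and a covector `p`: the vector `G⁻¹ p`, i.e. the vector `w`
with `G(w, ·) = p`. (Value `0` if there is no such `w`.) -/
def formInv (G : V → V → ℝ) (p : V → ℝ) : V :=
  open Classical in if h : ∃ w : V, ∀ v : V, G w v = p v then h.choose else 0

/-- The dual norm of a covector `p`, the square root of `G⁻¹(p, p) := G(G⁻¹ p, G⁻¹ p)`. -/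
def dualNorm (G : V → V → ℝ) (p : V → ℝ) : ℝ :=
  Real.sqrt (G (formInv G p) (formInv G p))

end Algebra

variable {E : Type*} [NormedAddCommGroup E] [NormedSpace ℝ E]
  {M : Type*} [TopologicalSpace M] [ChartedSpace E M] [IsManifold 𝓘(ℝ, E) ∞ M]

/-- The differential `Df_x : T_x M → ℝ` of a real function. -/
def diff (f : M → ℝ) (x : M) : TangentSpace 𝓘(ℝ, E) x →L[ℝ] ℝ :=
  mvfderiv 𝓘(ℝ, E) f x

/-- The velocity `γ'(t) ∈ T_{γ(t)} M` of a curve. -/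
def velocity (γ : ℝ → M) (t : ℝ) : TangentSpace 𝓘(ℝ, E) (γ t) :=
  mfderiv 𝓘(ℝ, ℝ) 𝓘(ℝ, E) γ t (1 : ℝ)

/-- A local extension of a tangent vector `v ∈ T_x M` to a vector field that is smooth near `x`
(with constant coefficients in the coordinate frame of the preferred chart at `x`). -/
def extendVec {x : M} (v : TangentSpace 𝓘(ℝ, E) x) (y : M) : TangentSpace 𝓘(ℝ, E) y :=
  FiberBundle.extend E v y

/-- An affine connection on `M`: `cov Y x u` is the covariant derivative `∇_u Y` at `x`, where
`u ∈ T_x M`. -/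
abbrev Connection (E M : Type*) [NormedAddCommGroup E] [NormedSpace ℝ E]
    [TopologicalSpace M] [ChartedSpace E M] [IsManifold 𝓘(ℝ, E) ∞ M] :=
  CovariantDerivative 𝓘(ℝ, E) E (TangentSpace 𝓘(ℝ, E) : M → Type _)

variable (cov : Connection E M)

/-- Covariant derivative of a vector field `V` along a curve `γ`. With `e_i` the coordinate frame
near `γ(t)` and `V(s) = ∑ a_i(s) e_i(γ(s))`, it is
`∑ a_i'(t) e_i(γ(t)) + ∑ a_i(t) ∇_{γ'(t)} e_i`. -/
def covDerivAlong (γ : ℝ → M) (V : ∀ t : ℝ, TangentSpace 𝓘(ℝ, E) (γ t)) (t : ℝ) :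
    TangentSpace 𝓘(ℝ, E) (γ t) :=
  (trivializationAt E (TangentSpace 𝓘(ℝ, E) : M → Type _) (γ t)).symm (γ t)
      (deriv (fun s : ℝ ↦
        ((trivializationAt E (TangentSpace 𝓘(ℝ, E) : M → Type _) (γ t))
          (⟨γ s, V s⟩ : TangentBundle 𝓘(ℝ, E) M)).2) t)
    + cov (extendVec (V t)) (γ t) (velocity γ t)

/-- (Complete) geodesics: smooth curves with `∇_{γ'} γ' = 0`. For the connections considered
below, where all geodesics can be continued to the whole line, a geodesic segment on `[a, b]` is
the restriction of such a curve to `[a, b]`. -/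
def IsGeodesic (γ : ℝ → M) : Prop :=
  ContMDiff 𝓘(ℝ, ℝ) 𝓘(ℝ, E) ∞ γ ∧ ∀ t : ℝ, covDerivAlong cov γ (velocity γ) t = 0

/-- `γ` is a geodesic with `γ(0) = x` and `γ'(0) = u`. -/
def IsGeodesicFrom (x : M) (u : TangentSpace 𝓘(ℝ, E) x) (γ : ℝ → M) : Prop :=
  IsGeodesic cov γ ∧ (⟨γ 0, velocity γ 0⟩ : TangentBundle 𝓘(ℝ, E) M) = ⟨x, u⟩

/-- The exponential map `exp_x u = γ(1)`, `γ` the geodesic with `γ(0) = x`, `γ'(0) = u`. -/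
def expMap (x : M) (u : TangentSpace 𝓘(ℝ, E) x) : M :=
  open Classical in if h : ∃ γ : ℝ → M, IsGeodesicFrom cov x u γ then h.choose 1 else x

/-- The standing assumptions on the connection: smooth, torsion-free, and every
`exp_x` is defined on all of `T_x M` and maps `T_x M` onto `M`. -/
structure IsAdmissible [FiniteDimensional ℝ E] [CompleteSpace E] : Prop where
  smooth : cov.ContMDiffCovariantDerivative ∞
  torsionFree : cov.torsion = 0
  complete : ∀ (x : M) (u : TangentSpace 𝓘(ℝ, E) x), ∃ γ : ℝ → M, IsGeodesicFrom cov x u γ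
  exp_surjective : ∀ x : M, Function.Surjective (expMap cov x)

/-- The Hessian `Hf_x(u, v) = (∇_u Df)(v) = u(Df(V)) - Df(∇_u V)`, where `V` extends `v`. -/
def hess (f : M → ℝ) (x : M) (u v : TangentSpace 𝓘(ℝ, E) x) : ℝ :=
  diff (fun y : M ↦ diff f y (extendVec v y)) x u - diff f x (cov (extendVec v) x u)

/-- The covariant derivative of the Hessian,
`(∇_v Hf)(u, w) = v(Hf(U, W)) - Hf(∇_v U, w) - Hf(u, ∇_v W)`, where `U, W` extend `u, w`. -/
def covHess (f : M → ℝ) (x : M) (v u w : TangentSpace 𝓘(ℝ, E) x) : ℝ :=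
  diff (fun y : M ↦ hess cov f y (extendVec u y) (extendVec w y)) x v
    - hess cov f x (cov (extendVec u) x v) w - hess cov f x u (cov (extendVec w) x v)

/-- Geodesic convexity of a set. -/
def GeodConvex (C : Set M) : Prop :=
  ∀ γ : ℝ → M, IsGeodesic cov γ → ∀ a b : ℝ, γ a ∈ C → γ b ∈ C → ∀ t ∈ Set.Icc a b, γ t ∈ C

/-- Geodesic convexity of a function on `C`. -/
def GeodConvexOn (C : Set M) (f : M → ℝ) : Prop :=
  ∀ γ : ℝ → M, IsGeodesic cov γ → ∀ a b : ℝ, Set.MapsTo γ (Set.Icc a b) C →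
    ConvexOn ℝ (Set.Icc a b) (fun t ↦ f (γ t))

/-- `ℓ : Q → ℝ` is affine: continuous on `Q`, smooth in the interior, and an affine function of
the parameter on every geodesic segment in `Q`. -/
structure IsAffineOn (Q : Set M) (ℓ : M → ℝ) : Prop where
  continuousOn : ContinuousOn ℓ Q
  smooth : ContMDiffOn 𝓘(ℝ, E) 𝓘(ℝ, ℝ) ∞ ℓ (interior Q)
  affine : ∀ γ : ℝ → M, IsGeodesic cov γ → ∀ a b : ℝ, Set.MapsTo γ (Set.Icc a b) Q →
    ∃ c d : ℝ, ∀ t ∈ Set.Icc a b, ℓ (γ t) = c + d * t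

/-- `f : C → ℝ` is `σ`-self-concordant: `C` is open and convex, and `f` is a smooth, closed,
nondegenerate convex function on `C` with `|(∇_v Hf)(u,u)| ≤ 2 σ Hf(v,v)^{1/2} Hf(u,u)`. Only the
values of `f` on `C` matter. -/
structure IsSelfConcordant (σ : ℝ) (C : Set M) (f : M → ℝ) : Prop where
  isOpen : IsOpen C
  convex : GeodConvex cov C
  smooth : ContMDiffOn 𝓘(ℝ, E) 𝓘(ℝ, ℝ) ∞ f C
  convexOn : GeodConvexOn cov C f
  closed : IsClosed {p : M × ℝ | p.1 ∈ C ∧ f p.1 ≤ p.2}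
  nondegenerate : ∀ x ∈ C, ∀ u : TangentSpace 𝓘(ℝ, E) x, u ≠ 0 → 0 < hess cov f x u u
  bound : ∀ x ∈ C, ∀ u v : TangentSpace 𝓘(ℝ, E) x,
    |covHess cov f x v u u| ≤ 2 * σ * Real.sqrt (hess cov f x v v) * hess cov f x u u

/-- `F` is a `ν`-self-concordant barrier on `C`. -/
structure IsSelfConcordantBarrier (ν : ℝ) (C : Set M) (F : M → ℝ) : Prop where
  pos : 0 < ν
  selfConcordant : IsSelfConcordant cov 1 C F
  barrier : ∀ x ∈ C, ∀ u : TangentSpace 𝓘(ℝ, E) x, 2 * diff F x u - hess cov F x u u ≤ ν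

/-- The local dual norm `‖(Dg)_x‖*_{F,x}` of the differential of `g`, with respect to the inner
product `HF_x`. -/
def diffNorm (F g : M → ℝ) (x : M) : ℝ :=
  dualNorm (hess cov F x) (diff g x)

/-- The Newton direction `-(Hf_x)⁻¹(Df_x)` of `f` at `x`. -/
def newtonDir (f : M → ℝ) (x : M) : TangentSpace 𝓘(ℝ, E) x :=
  -formInv (hess cov f x) (diff f x)

/-- The objective `f_t = t ℓ + F`. -/
def pathObj (ℓ F : M → ℝ) (t : ℝ) : M → ℝ := fun x ↦ t * ℓ x + F x

/-- `α = √β / (1 + √β) - β`. -/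
def stepConst (β : ℝ) : ℝ := Real.sqrt β / (1 + Real.sqrt β) - β

/-- The parameter update `t⁺ = t + α / ‖Dℓ_x‖*_{F,x}`. -/
def nextT (β : ℝ) (ℓ F : M → ℝ) (x : M) (t : ℝ) : ℝ :=
  t + stepConst β / diffNorm cov F ℓ x

/-- The point update `x⁺ = exp_x ū`, `ū` the Newton direction of `f_{t⁺}` at `x`. -/
def nextX (β : ℝ) (ℓ F : M → ℝ) (x : M) (t : ℝ) : M :=
  expMap cov x (newtonDir cov (pathObj ℓ F (nextT cov β ℓ F x t)) x)

/-- The iterates `(x_k, t_k)` of the path-following method, starting from `(x₀, 0)`. -/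
def iterates (β : ℝ) (ℓ F : M → ℝ) (x₀ : M) : ℕ → M × ℝ
  | 0 => (x₀, 0)
  | k + 1 =>
    (nextX cov β ℓ F (iterates β ℓ F x₀ k).1 (iterates β ℓ F x₀ k).2,
      nextT cov β ℓ F (iterates β ℓ F x₀ k).1 (iterates β ℓ F x₀ k).2)

end PathFollowing

end

set_option synthInstance.maxHeartbeats 200000
set_option maxSynthPendingDepth 3

noncomputable section

/-! Every estimate is one-dimensional. Along a geodesic `γ` the derivatives of `F ∘ γ` are `DF(γ')`,
`HF(γ', γ')` and `∇HF(γ', γ', γ')`, because `∇_{γ'} γ' = 0`. Self-concordance thus becomes `|P'| ≤ 2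
P^{3/2}` for `P = HF(γ', γ')`, which integrates to bounds on `P` from both sides. With the closed
epigraph, the upper bound keeps a geodesic of initial local length below one inside `Q°`
(`IsSelfConcordant.mem_of_sqrt_hess_lt_one`).

An affine `ℓ` has zero Hessian, so `f_t` and `F` share their Hessian. Along a Newton step `γ` of
local length at most `δ < 1`, the covector `Df_t + (1 - s) HF(γ', ·)` starts at `0`, ends at `Df_t`,
and has covariant derivative `(1 - s) ∇HF(γ', γ', ·)`. Integrating its dual norm gives `‖Df_t‖* ≤ (δ
/ (1 - δ))²` at the end (`IsSelfConcordant.diffNorm_newton_le`). The update of `t` adds at most `α`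
to the dual norm, and `δ = β + α = √β / (1 + √β)` is the value with `(δ / (1 - δ))² = β`; so the
invariant survives.

The barrier inequality gives `‖DF‖* ≤ √ν`, hence `ψ² ≤ ν ψ'` for `ψ = (F ∘ γ)'` wherever `ψ > 0`.
Such a `ψ` blows up in finite time; combined with the lower bound on `P` this bounds the gap between
interior points (`le_of_barrier_deriv`). Boundary points follow by continuity, once `Q` is known to
lie in the closure of its interior (`GeodConvex.subset_closure_interior`).

After the first step `t` grows by the factor `1 + α / (β + √ν)` each time. Since `ν ≥ 1`
(`IsSelfConcordantBarrier.one_le`), its logarithm is at least a constant depending on `β` over `√ν`,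
which yields the iteration count. -/

namespace PathFollowing

open Bundle

/-! ### Coordinate formulas for the connection and the Hessian. -/

section Coordinates


variable {E : Type*} [NormedAddCommGroup E] [NormedSpace ℝ E]
  {M : Type*} [TopologicalSpace M] [ChartedSpace E M] [IsManifold 𝓘(ℝ, E) ∞ M]

/-- The coordinate frame at `z` of the preferred chart at `x₀`. -/
def frame (x₀ z : M) : E →L[ℝ] TangentSpace 𝓘(ℝ, E) z :=
  (trivializationAt E (TangentSpace 𝓘(ℝ, E) : M → Type _) x₀).symmL ℝ z

/-- The coordinates at `z` of tangent vectors in the preferred chart at `x₀`. -/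
def coframe (x₀ z : M) : TangentSpace 𝓘(ℝ, E) z →L[ℝ] E :=
  (trivializationAt E (TangentSpace 𝓘(ℝ, E) : M → Type _) x₀).continuousLinearMapAt ℝ z

theorem coframe_frame {x₀ z : M} (hz : z ∈ (chartAt E x₀).source) (v : E) :
    coframe x₀ z (frame x₀ z v) = v :=
  Trivialization.continuousLinearMapAt_symmL _ (by simpa using hz) v

theorem frame_coframe {x₀ z : M} (hz : z ∈ (chartAt E x₀).source)
    (v : TangentSpace 𝓘(ℝ, E) z) : frame x₀ z (coframe x₀ z v) = v :=
  Trivialization.symmL_continuousLinearMapAt _ (by simpa using hz) v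

theorem coframe_eq_mfderiv {x₀ z : M} (hz : z ∈ (chartAt E x₀).source) :
    coframe x₀ z = mfderiv 𝓘(ℝ, E) 𝓘(ℝ, E) (extChartAt 𝓘(ℝ, E) x₀) z :=
  TangentBundle.continuousLinearMapAt_trivializationAt hz

theorem trivializationAt_snd {x₀ z : M} (hz : z ∈ (chartAt E x₀).source)
    (v : TangentSpace 𝓘(ℝ, E) z) :
    ((trivializationAt E (TangentSpace 𝓘(ℝ, E) : M → Type _) x₀)
      (⟨z, v⟩ : TangentBundle 𝓘(ℝ, E) M)).2 = coframe x₀ z v := by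
  rw [coframe, Trivialization.continuousLinearMapAt_apply_of_mem]
  simpa using hz

theorem extendVec_eq {x z : M} (hz : z ∈ (chartAt E x).source) (v : TangentSpace 𝓘(ℝ, E) x) :
    extendVec v z = frame x z (coframe x x v) := by
  rw [← trivializationAt_snd (mem_chart_source E x)]
  exact (Trivialization.symmL_apply (R := ℝ)
    (trivializationAt E (TangentSpace 𝓘(ℝ, E) : M → Type _) x) (by simpa using hz) _).symm

theorem extendVec_eventuallyEq {x z : M} (hz : z ∈ (chartAt E x).source)
    (v : TangentSpace 𝓘(ℝ, E) x) :
    ∀ᶠ y in 𝓝 z, extendVec v y = frame x y (coframe x x v) :=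
  Filter.mem_of_superset ((chartAt E x).open_source.mem_nhds hz) fun _ hy ↦ extendVec_eq hy v

theorem frame_coframe_self (x : M) (v : TangentSpace 𝓘(ℝ, E) x) :
    frame x x (coframe x x v) = v :=
  frame_coframe (mem_chart_source E x) v

theorem contMDiffAt_frame {x₀ z : M} (hz : z ∈ (chartAt E x₀).source) {g : M → E} {n : ℕ∞ω}
    (hn : n ≤ ∞)
    (hg : ContMDiffAt 𝓘(ℝ, E) 𝓘(ℝ, E) n g z) :
    ContMDiffAt 𝓘(ℝ, E) (𝓘(ℝ, E).prod 𝓘(ℝ, E)) n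
      (fun y ↦ (⟨y, frame x₀ y (g y)⟩ : TangentBundle 𝓘(ℝ, E) M)) z := by
  have : ContMDiffVectorBundle n E (TangentSpace 𝓘(ℝ, E) : M → Type _) 𝓘(ℝ, E) :=
    ContMDiffVectorBundle.of_le (n := ∞) hn
  rw [Trivialization.contMDiffAt_section_iff (n := n)
    (trivializationAt E (TangentSpace 𝓘(ℝ, E) : M → Type _) x₀) (by simpa using hz)]
  refine hg.congr_of_eventuallyEq ?_
  filter_upwards [(chartAt E x₀).open_source.mem_nhds hz] with y hy
  rw [trivializationAt_snd hy, coframe_frame hy]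

theorem mdifferentiableAt_frame {x₀ z : M} (hz : z ∈ (chartAt E x₀).source) {g : M → E}
    (hg : MDifferentiableAt 𝓘(ℝ, E) 𝓘(ℝ, E) g z) :
    MDifferentiableAt 𝓘(ℝ, E) (𝓘(ℝ, E).prod 𝓘(ℝ, E))
      (fun y ↦ (⟨y, frame x₀ y (g y)⟩ : TangentBundle 𝓘(ℝ, E) M)) z := by
  rw [Trivialization.mdifferentiableAt_section_iff 𝓘(ℝ, E)
    (trivializationAt E (TangentSpace 𝓘(ℝ, E) : M → Type _) x₀) _ (by simpa using hz)]
  refine hg.congr_of_eventuallyEq ?_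
  filter_upwards [(chartAt E x₀).open_source.mem_nhds hz] with y hy
  rw [trivializationAt_snd hy, coframe_frame hy]

theorem cov_sum (cov : Connection E M) {ι : Type*} (s : Finset ι)
    (σ : ι → ∀ y : M, TangentSpace 𝓘(ℝ, E) y) (g : ι → M → ℝ) {z : M}
    (hσ : ∀ i, MDifferentiableAt 𝓘(ℝ, E) (𝓘(ℝ, E).prod 𝓘(ℝ, E))
      (fun y ↦ (⟨y, σ i y⟩ : TangentBundle 𝓘(ℝ, E) M)) z)
    (hg : ∀ i, MDifferentiableAt 𝓘(ℝ, E) 𝓘(ℝ, ℝ) (g i) z) (u : TangentSpace 𝓘(ℝ, E) z) :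
    cov (∑ i ∈ s, g i • σ i) z u =
      ∑ i ∈ s, (g i z • cov (σ i) z u + diff (g i) z u • σ i z) := by
  classical
  induction s using Finset.induction_on with
  | empty => simp
  | insert i s hi ih =>
    rw [Finset.sum_insert hi, Finset.sum_insert hi,
      cov.isCovariantDerivativeOnUniv.add, _root_.add_apply, ih,
      cov.isCovariantDerivativeOnUniv.leibniz (hσ i) (hg i)]
    · rfl
    · exact (hg i).smul_section (hσ i)
    · have := MDifferentiableAt.sum_section (I := 𝓘(ℝ, E)) (s := s) (t := fun i ↦ g i • σ i)
        (x₀ := z) (fun j _ ↦ (hg j).smul_section (hσ j))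
      convert! this using 3
      simp

theorem mvfderiv_comp_extChartAt {F : Type*} [NormedAddCommGroup F] [NormedSpace ℝ F] {x₀ z : M}
    (hz : z ∈ (chartAt E x₀).source) {h : E → F} {h' : E →L[ℝ] F}
    (hh : HasFDerivAt h h' (extChartAt 𝓘(ℝ, E) x₀ z)) :
    HasMFDerivAt 𝓘(ℝ, E) 𝓘(ℝ, F) (fun y ↦ h (extChartAt 𝓘(ℝ, E) x₀ y)) z
      (h' ∘L coframe x₀ z) := by
  rw [coframe_eq_mfderiv hz]
  exact hh.hasMFDerivAt.comp z (mdifferentiableAt_extChartAt hz).hasMFDerivAt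

omit [IsManifold 𝓘(ℝ, E) ∞ M] in
theorem diff_eq_of_hasMFDerivAt {f : M → ℝ} {z : M} {L : TangentSpace 𝓘(ℝ, E) z →L[ℝ] ℝ}
    (h : HasMFDerivAt 𝓘(ℝ, E) 𝓘(ℝ, ℝ) f z L) (u : TangentSpace 𝓘(ℝ, E) z) :
    diff f z u = L u := by
  unfold diff mvfderiv
  rw [h.mfderiv]
  rfl

theorem diff_comp_extChartAt {x₀ z : M} (hz : z ∈ (chartAt E x₀).source) {h : E → ℝ}
    {h' : E →L[ℝ] ℝ} (hh : HasFDerivAt h h' (extChartAt 𝓘(ℝ, E) x₀ z))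
    (u : TangentSpace 𝓘(ℝ, E) z) :
    diff (fun y ↦ h (extChartAt 𝓘(ℝ, E) x₀ y)) z u = h' (coframe x₀ z u) :=
  diff_eq_of_hasMFDerivAt (mvfderiv_comp_extChartAt hz hh) u

omit [IsManifold 𝓘(ℝ, E) ∞ M] in
theorem diff_congr {f g : M → ℝ} {z : M} (h : f =ᶠ[𝓝 z] g) : diff (E := E) f z = diff g z := by
  unfold diff mvfderiv
  rw [h.mfderiv_eq]
  rfl

theorem cov_congr (cov : Connection E M) {σ τ : ∀ y : M, TangentSpace 𝓘(ℝ, E) y} {z : M}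
    (hσ : MDifferentiableAt 𝓘(ℝ, E) (𝓘(ℝ, E).prod 𝓘(ℝ, E))
      (fun y ↦ (⟨y, σ y⟩ : TangentBundle 𝓘(ℝ, E) M)) z) (h : ∀ᶠ y in 𝓝 z, τ y = σ y) :
    cov τ z = cov σ z := by
  refine cov.isCovariantDerivativeOnUniv.congr_of_eventuallyEq ?_ hσ Filter.univ_mem h
  refine hσ.congr_of_eventuallyEq ?_
  filter_upwards [h] with y hy
  rw [hy]

theorem cov_extendVec (cov : Connection E M) (x : M) (v : TangentSpace 𝓘(ℝ, E) x) :
    cov (extendVec v) x = cov (fun y ↦ frame x y (coframe x x v)) x :=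
  cov_congr cov (mdifferentiableAt_frame (mem_chart_source E x) mdifferentiableAt_const)
    (extendVec_eventuallyEq (mem_chart_source E x) v)

/-- A function in the coordinates of the preferred chart at `x₀`. -/
def rep {F : Type*} (f : M → F) (x₀ : M) (p : E) : F := f ((extChartAt 𝓘(ℝ, E) x₀).symm p)

omit [IsManifold 𝓘(ℝ, E) ∞ M] in
theorem eventually_rep {F : Type*} (f : M → F) {x₀ z : M} (hz : z ∈ (chartAt E x₀).source) :
    f =ᶠ[𝓝 z] fun y ↦ rep f x₀ (extChartAt 𝓘(ℝ, E) x₀ y) := by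
  filter_upwards [(chartAt E x₀).open_source.mem_nhds hz] with y hy
  rw [rep, (extChartAt 𝓘(ℝ, E) x₀).left_inv (by simpa using hy)]

theorem contDiffAt_rep {F : Type*} [NormedAddCommGroup F] [NormedSpace ℝ F] {f : M → F} {x₀ z : M}
    (hz : z ∈ (chartAt E x₀).source) {n : ℕ∞ω} (hn : n ≤ ∞)
    (hf : ContMDiffAt 𝓘(ℝ, E) 𝓘(ℝ, F) n f z) :
    ContDiffAt ℝ n (rep f x₀) (extChartAt 𝓘(ℝ, E) x₀ z) := by
  have hz' : z ∈ (extChartAt 𝓘(ℝ, E) x₀).source := by simpa using hz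
  have h1 : ContMDiffAt 𝓘(ℝ, E) 𝓘(ℝ, E) n (extChartAt 𝓘(ℝ, E) x₀).symm
      (extChartAt 𝓘(ℝ, E) x₀ z) := by
    have := (contMDiffOn_extChartAt_symm (I := 𝓘(ℝ, E)) (n := ∞) x₀).of_le hn
    exact this.contMDiffAt ((isOpen_extChartAt_target x₀).mem_nhds
      ((extChartAt 𝓘(ℝ, E) x₀).map_source hz'))
  rw [← contMDiffAt_iff_contDiffAt]
  refine ContMDiffAt.comp _ ?_ h1
  rwa [(extChartAt 𝓘(ℝ, E) x₀).left_inv hz']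

theorem diff_eq_fderiv_rep {f : M → ℝ} {x₀ z : M} (hz : z ∈ (chartAt E x₀).source)
    (hf : DifferentiableAt ℝ (rep f x₀) (extChartAt 𝓘(ℝ, E) x₀ z)) (u : TangentSpace 𝓘(ℝ, E) z) :
    diff f z u = fderiv ℝ (rep f x₀) (extChartAt 𝓘(ℝ, E) x₀ z) (coframe x₀ z u) := by
  rw [diff_congr (eventually_rep f hz), diff_comp_extChartAt hz hf.hasFDerivAt]

variable [FiniteDimensional ℝ E]

/-- Covariant derivative of a field given by its coordinates in a frame. -/
theorem cov_frame (cov : Connection E M) {x₀ z : M} (hz : z ∈ (chartAt E x₀).source) {g : E → E}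
    {g' : E →L[ℝ] E} (hg : HasFDerivAt g g' (extChartAt 𝓘(ℝ, E) x₀ z))
    (u : TangentSpace 𝓘(ℝ, E) z) :
    cov (fun y ↦ frame x₀ y (g (extChartAt 𝓘(ℝ, E) x₀ y))) z u =
      frame x₀ z (g' (coframe x₀ z u)) +
        cov (fun y ↦ frame x₀ y (g (extChartAt 𝓘(ℝ, E) x₀ z))) z u := by
  set b := Module.finBasis ℝ E
  -- The last sum depends only on the value of `g` at the point, so it is the same for `g` and for
  -- the constant field with that value.
  have key : ∀ (g : E → E) (g' : E →L[ℝ] E),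
      HasFDerivAt g g' (extChartAt 𝓘(ℝ, E) x₀ z) →
      cov (fun y ↦ frame x₀ y (g (extChartAt 𝓘(ℝ, E) x₀ y))) z u =
      frame x₀ z (g' (coframe x₀ z u)) + ∑ i, b.coord i (g (extChartAt 𝓘(ℝ, E) x₀ z)) •
        cov (fun y ↦ frame x₀ y (b i)) z u := by
    intro g g' hg
    have h1 : (fun y ↦ frame x₀ y (g (extChartAt 𝓘(ℝ, E) x₀ y))) =
        ∑ i, (fun y ↦ b.coord i (g (extChartAt 𝓘(ℝ, E) x₀ y))) • fun y ↦ frame x₀ y (b i) := by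
      funext y
      rw [Finset.sum_apply]
      conv_lhs => rw [← b.sum_repr (g (extChartAt 𝓘(ℝ, E) x₀ y)), map_sum]
      simp
    have h2 : ∀ i, HasFDerivAt (fun p ↦ b.coord i (g p))
        ((b.coord i).toContinuousLinearMap ∘L g') (extChartAt 𝓘(ℝ, E) x₀ z) := fun i ↦
      (b.coord i).toContinuousLinearMap.hasFDerivAt.comp _ hg
    rw [h1, cov_sum]
    · simp_rw [diff_comp_extChartAt hz (h2 _)]
      rw [Finset.sum_add_distrib, add_comm]
      congr 1
      conv_rhs => rw [← b.sum_repr (g' (coframe x₀ z u)), map_sum]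
      simp
    · exact fun i ↦ mdifferentiableAt_frame hz mdifferentiableAt_const
    · exact fun i ↦ (mvfderiv_comp_extChartAt hz (h2 i)).mdifferentiableAt
  rw [key g g' hg, key (fun _ ↦ g (extChartAt 𝓘(ℝ, E) x₀ z)) 0 (hasFDerivAt_const _ _)]
  simp

/-- The Christoffel symbols in the preferred chart at `x₀`: at the point with coordinates `p`,
`christoffel cov x₀ p v u` are the coordinates of the derivative in the direction `u` of
the field with constant coordinates `v`. -/
def christoffel (cov : Connection E M) (x₀ : M) (p : E) : E →L[ℝ] E →L[ℝ] E :=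
  ∑ i, ((Module.finBasis ℝ E).coord i).toContinuousLinearMap.smulRight
    (coframe x₀ ((extChartAt 𝓘(ℝ, E) x₀).symm p) ∘L
      cov (fun y ↦ frame x₀ y (Module.finBasis ℝ E i)) ((extChartAt 𝓘(ℝ, E) x₀).symm p) ∘L
        frame x₀ ((extChartAt 𝓘(ℝ, E) x₀).symm p))

theorem cov_frame_const (cov : Connection E M) {x₀ z : M} (hz : z ∈ (chartAt E x₀).source)
    (v : E) (u : TangentSpace 𝓘(ℝ, E) z) :
    cov (fun y ↦ frame x₀ y v) z u =
      frame x₀ z (christoffel cov x₀ (extChartAt 𝓘(ℝ, E) x₀ z) v (coframe x₀ z u)) := by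
  set b := Module.finBasis ℝ E
  have h1 : (fun y ↦ frame x₀ y v) =
      ∑ i, (fun _ : M ↦ b.coord i v) • fun y : M ↦ frame x₀ y (b i) := by
    funext y
    rw [Finset.sum_apply]
    conv_lhs => rw [← b.sum_repr v, map_sum]
    simp
  rw [h1, cov_sum]
  · have h2 : ∀ i, diff (fun _ : M ↦ b.coord i v) z u = 0 := fun i ↦
      diff_eq_of_hasMFDerivAt (hasMFDerivAt_const _ _) u
    have hz' : z ∈ (extChartAt 𝓘(ℝ, E) x₀).source := by simpa using hz
    simp only [h2, zero_smul, add_zero, christoffel]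
    simp only [_root_.sum_apply, map_sum, ContinuousLinearMap.smulRight_apply]
    refine Finset.sum_congr rfl fun i _ ↦ ?_
    rw [(extChartAt 𝓘(ℝ, E) x₀).left_inv hz']
    simp [frame_coframe hz, b]
  · exact fun i ↦ mdifferentiableAt_frame hz mdifferentiableAt_const
  · exact fun i ↦ mdifferentiableAt_const

/-- The extension of `v` used by `hess` is constant in the chart at `z`, so it has variable
coordinates `V` in the chart at `x₀`. The derivative of `V` enters both terms of the definition and
cancels, which makes the usual formula valid in any chart around `z`. -/
theorem hess_eq_rep (cov : Connection E M) {f : M → ℝ} {x₀ z : M} (hz : z ∈ (chartAt E x₀).source)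
    (hf : ContDiffAt ℝ 2 (rep f x₀) (extChartAt 𝓘(ℝ, E) x₀ z)) (u v : TangentSpace 𝓘(ℝ, E) z) :
    hess cov f z u v =
      fderiv ℝ (fderiv ℝ (rep f x₀)) (extChartAt 𝓘(ℝ, E) x₀ z) (coframe x₀ z u) (coframe x₀ z v)
      - fderiv ℝ (rep f x₀) (extChartAt 𝓘(ℝ, E) x₀ z)
        (christoffel cov x₀ (extChartAt 𝓘(ℝ, E) x₀ z) (coframe x₀ z v) (coframe x₀ z u)) := by
  have hz' : z ∈ (extChartAt 𝓘(ℝ, E) x₀).source := by simpa using hz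
  have hzz := mem_chart_source E z
  set φ := extChartAt 𝓘(ℝ, E) x₀ with hφ
  -- the coordinates of the extension of `v` in the chart at `x₀`
  set V : M → E := fun y ↦ coframe x₀ y (frame z y (coframe z z v)) with hV
  have hVz : V z = coframe x₀ z v := by rw [hV]; simp only [frame_coframe_self]
  have hVs : ContMDiffAt 𝓘(ℝ, E) 𝓘(ℝ, E) 1 V z := by
    have h1 := contMDiffAt_frame (n := 1) hzz (by simp)
      (contMDiffAt_const (c := coframe z z v) (I := 𝓘(ℝ, E)) (I' := 𝓘(ℝ, E)))
    rw [Trivialization.contMDiffAt_section_iff (n := 1)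
      (trivializationAt E (TangentSpace 𝓘(ℝ, E) : M → Type _) x₀) (by simpa using hz)] at h1
    refine h1.congr_of_eventuallyEq ?_
    filter_upwards [(chartAt E x₀).open_source.mem_nhds hz] with y hy
    rw [trivializationAt_snd hy]
  have hVr : HasFDerivAt (rep V x₀) (fderiv ℝ (rep V x₀) (φ z)) (φ z) :=
    ((contDiffAt_rep hz (by simp) hVs).differentiableAt one_ne_zero).hasFDerivAt
  have hext : ∀ᶠ y in 𝓝 z, extendVec v y = frame x₀ y (rep V x₀ (φ y)) := by
    filter_upwards [extendVec_eventuallyEq hzz v, eventually_rep V hz,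
      (chartAt E x₀).open_source.mem_nhds hz] with y h1 h2 h3
    rw [h1, ← h2, hV]
    simp only [frame_coframe h3]
  have hVz' : rep V x₀ (φ z) = coframe x₀ z v := by
    rw [← hVz]; exact (eventually_rep V hz).eq_of_nhds.symm
  have hcov : cov (extendVec v) z u = frame x₀ z (fderiv ℝ (rep V x₀) (φ z) (coframe x₀ z u)) +
      frame x₀ z (christoffel cov x₀ (φ z) (coframe x₀ z v) (coframe x₀ z u)) := by
    rw [cov_congr cov _ hext, cov_frame cov hz hVr, cov_frame_const cov hz, hVz']
    exact mdifferentiableAt_frame hz (mvfderiv_comp_extChartAt hz hVr).mdifferentiableAt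
  have hd : (fun y ↦ diff f y (extendVec v y)) =ᶠ[𝓝 z]
      fun y ↦ fderiv ℝ (rep f x₀) (φ y) (rep V x₀ (φ y)) := by
    have hev : ∀ᶠ y in 𝓝 z, DifferentiableAt ℝ (rep f x₀) (φ y) := by
      have h1 := hf.eventually (by simp)
      have h2 := (continuousAt_extChartAt' (I := 𝓘(ℝ, E)) hz').eventually h1
      exact h2.mono fun y hy ↦ hy.differentiableAt (by simp)
    filter_upwards [hext, hev, (chartAt E x₀).open_source.mem_nhds hz] with y h1 h2 h3
    rw [h1, diff_eq_fderiv_rep h3 h2, coframe_frame h3]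
  have hfd : HasFDerivAt (fderiv ℝ (rep f x₀)) (fderiv ℝ (fderiv ℝ (rep f x₀)) (φ z)) (φ z) :=
    ((hf.fderiv_right (m := 1) (by norm_num)).differentiableAt one_ne_zero).hasFDerivAt
  have hfz : DifferentiableAt ℝ (rep f x₀) (φ z) := hf.differentiableAt (by simp)
  unfold hess
  rw [diff_congr hd, diff_comp_extChartAt hz (hfd.clm_apply hVr), hcov, map_add,
    diff_eq_fderiv_rep hz hfz, diff_eq_fderiv_rep hz hfz, coframe_frame hz, coframe_frame hz, hVz']
  simp only [_root_.add_apply, ContinuousLinearMap.comp_apply, ContinuousLinearMap.flip_apply]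
  ring

end Coordinates

/-! ### Regularity and symmetry of the Christoffel symbols; the third-order form. -/

section HessianCoordinates


variable {E : Type*} [NormedAddCommGroup E] [NormedSpace ℝ E]
  {M : Type*} [TopologicalSpace M] [ChartedSpace E M] [IsManifold 𝓘(ℝ, E) ∞ M]
  [FiniteDimensional ℝ E]

/-- The Hessian in the coordinates of the preferred chart at `x₀`. -/
def hessRep (cov : Connection E M) (f : M → ℝ) (x₀ : M) (p : E) : E →L[ℝ] E →L[ℝ] ℝ :=
  fderiv ℝ (fderiv ℝ (rep f x₀)) p -
    ((ContinuousLinearMap.compL ℝ E E ℝ (fderiv ℝ (rep f x₀) p)) ∘L christoffel cov x₀ p).flip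

theorem hessRep_apply (cov : Connection E M) (f : M → ℝ) (x₀ : M) (p u v : E) :
    hessRep cov f x₀ p u v = fderiv ℝ (fderiv ℝ (rep f x₀)) p u v -
      fderiv ℝ (rep f x₀) p (christoffel cov x₀ p v u) := by
  simp [hessRep]

theorem hess_eq_hessRep (cov : Connection E M) {f : M → ℝ} {x₀ z : M}
    (hz : z ∈ (chartAt E x₀).source)
    (hf : ContDiffAt ℝ 2 (rep f x₀) (extChartAt 𝓘(ℝ, E) x₀ z)) (u v : TangentSpace 𝓘(ℝ, E) z) :
    hess cov f z u v =
      hessRep cov f x₀ (extChartAt 𝓘(ℝ, E) x₀ z) (coframe x₀ z u) (coframe x₀ z v) := by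
  rw [hess_eq_rep cov hz hf, hessRep_apply]

theorem contDiffAt_hessRep {cov : Connection E M} {f : M → ℝ} {x₀ : M} {p : E}
    (hf : ContDiffAt ℝ 3 (rep f x₀) p) (hΓ : ContDiffAt ℝ 1 (christoffel cov x₀) p) :
    ContDiffAt ℝ 1 (hessRep cov f x₀) p := by
  have h1 : ContDiffAt ℝ 2 (fderiv ℝ (rep f x₀)) p := hf.fderiv_right (by norm_num)
  have h2 : ContDiffAt ℝ 1 (fderiv ℝ (fderiv ℝ (rep f x₀))) p := h1.fderiv_right (by norm_num)
  refine h2.sub ?_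
  refine ContDiffAt.comp p (g := ContinuousLinearMap.flipₗᵢ ℝ E E ℝ)
    (LinearIsometryEquiv.contDiff _).contDiffAt ?_
  exact ((ContinuousLinearMap.compL ℝ E E ℝ).contDiff.contDiffAt.comp p
    (h1.of_le (by norm_num))).clm_comp hΓ

omit [FiniteDimensional ℝ E] in
theorem hasFDerivAt_apply_apply {H : E → E →L[ℝ] E →L[ℝ] ℝ} {H' : E →L[ℝ] E →L[ℝ] E →L[ℝ] ℝ}
    {p : E} (h : HasFDerivAt H H' p) (u w : E) :
    HasFDerivAt (fun q ↦ H q u w) ((H'.flip u).flip w) p := by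
  have h1 : HasFDerivAt (fun q ↦ H q u) (H'.flip u) p := by
    have h2 : HasFDerivAt (fun q ↦ H q u) _ p := h.clm_apply (hasFDerivAt_const u p)
    convert! h2 using 1
    ext a b
    simp
  have h2 : HasFDerivAt (fun q ↦ H q u w) _ p := h1.clm_apply (hasFDerivAt_const w p)
  convert! h2 using 1
  ext a
  simp

/-- The centre of the chart is enough for the derivatives along a curve taken below, where the chart
at `γ t` is used at time `t`. There the extended vectors have constant coordinates. -/
theorem covHess_eq_rep {cov : Connection E M} {f : M → ℝ} {x₀ : M}
    (hf : ContDiffAt ℝ 3 (rep f x₀) (extChartAt 𝓘(ℝ, E) x₀ x₀))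
    (hΓ : ContDiffAt ℝ 1 (christoffel cov x₀) (extChartAt 𝓘(ℝ, E) x₀ x₀))
    (v u w : TangentSpace 𝓘(ℝ, E) x₀) :
    covHess cov f x₀ v u w =
      fderiv ℝ (hessRep cov f x₀) (extChartAt 𝓘(ℝ, E) x₀ x₀)
        (coframe x₀ x₀ v) (coframe x₀ x₀ u) (coframe x₀ x₀ w)
      - hessRep cov f x₀ (extChartAt 𝓘(ℝ, E) x₀ x₀)
        (christoffel cov x₀ (extChartAt 𝓘(ℝ, E) x₀ x₀) (coframe x₀ x₀ u) (coframe x₀ x₀ v))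
        (coframe x₀ x₀ w)
      - hessRep cov f x₀ (extChartAt 𝓘(ℝ, E) x₀ x₀) (coframe x₀ x₀ u)
        (christoffel cov x₀ (extChartAt 𝓘(ℝ, E) x₀ x₀) (coframe x₀ x₀ w) (coframe x₀ x₀ v)) := by
  have hx := mem_chart_source E x₀
  have hx' : x₀ ∈ (extChartAt 𝓘(ℝ, E) x₀).source := mem_extChartAt_source x₀
  set φ := extChartAt 𝓘(ℝ, E) x₀ with hφ
  have hd : (fun y ↦ hess cov f y (extendVec u y) (extendVec w y)) =ᶠ[𝓝 x₀]
      fun y ↦ hessRep cov f x₀ (φ y) (coframe x₀ x₀ u) (coframe x₀ x₀ w) := by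
    have hev : ∀ᶠ y in 𝓝 x₀, ContDiffAt ℝ 2 (rep f x₀) (φ y) := by
      have h1 := hf.eventually (by simp)
      have h2 := (continuousAt_extChartAt' (I := 𝓘(ℝ, E)) hx').eventually h1
      exact h2.mono fun y hy ↦ hy.of_le (by norm_num)
    filter_upwards [extendVec_eventuallyEq hx u, extendVec_eventuallyEq hx w, hev,
      (chartAt E x₀).open_source.mem_nhds hx] with y h1 h2 h3 h4
    rw [h1, h2, hess_eq_hessRep cov h4 h3, coframe_frame h4, coframe_frame h4]
  have hH : HasFDerivAt (hessRep cov f x₀) (fderiv ℝ (hessRep cov f x₀) (φ x₀)) (φ x₀) :=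
    ((contDiffAt_hessRep hf hΓ).differentiableAt one_ne_zero).hasFDerivAt
  have hH' := hasFDerivAt_apply_apply hH (coframe x₀ x₀ u) (coframe x₀ x₀ w)
  have hf2 : ContDiffAt ℝ 2 (rep f x₀) (φ x₀) := hf.of_le (by norm_num)
  unfold covHess
  rw [diff_congr hd, diff_comp_extChartAt hx hH', hess_eq_hessRep cov hx hf2,
    hess_eq_hessRep cov hx hf2, cov_extendVec, cov_extendVec, cov_frame_const cov hx,
    cov_frame_const cov hx, coframe_frame hx, coframe_frame hx]
  simp only [ContinuousLinearMap.flip_apply, hφ]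

/-- Zero torsion makes the antisymmetric part of the symbols a Lie bracket of coordinate fields, and
these commute. -/
theorem christoffel_symm [CompleteSpace E] {cov : Connection E M} (h : cov.torsion = 0) (x₀ : M)
    (u v : E) :
    christoffel cov x₀ (extChartAt 𝓘(ℝ, E) x₀ x₀) u v =
      christoffel cov x₀ (extChartAt 𝓘(ℝ, E) x₀ x₀) v u := by
  have hx := mem_chart_source E x₀
  have key : ∀ σ : E, MDifferentiableAt 𝓘(ℝ, E) (𝓘(ℝ, E).prod 𝓘(ℝ, E))
      (fun y ↦ (⟨y, frame x₀ y σ⟩ : TangentBundle 𝓘(ℝ, E) M)) x₀ := fun σ ↦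
    mdifferentiableAt_frame hx mdifferentiableAt_const
  have h1 := cov.torsion_eq_zero_iff.1 h (key u) (key v)
  have hb : VectorField.mlieBracket 𝓘(ℝ, E) (fun y ↦ frame x₀ y u) (fun y ↦ frame x₀ y v) x₀
      = 0 := by
    rw [← VectorField.mlieBracketWithin_univ, VectorField.mlieBracketWithin_apply]
    -- In the chart the frame fields become constant, so their bracket is zero.
    have hc : ∀ w : E, VectorField.mpullbackWithin 𝓘(ℝ, E) 𝓘(ℝ, E) (extChartAt 𝓘(ℝ, E) x₀).symm
        (fun y ↦ frame x₀ y w) (Set.range 𝓘(ℝ, E)) =ᶠ[𝓝 (extChartAt 𝓘(ℝ, E) x₀ x₀)]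
        fun _ ↦ w := by
      intro w
      filter_upwards [extChartAt_target_mem_nhds (I := 𝓘(ℝ, E)) x₀] with p hp
      obtain ⟨e, he⟩ := isInvertible_mfderivWithin_extChartAt_symm (I := 𝓘(ℝ, E)) hp
      have hs := (extChartAt 𝓘(ℝ, E) x₀).map_target hp
      have h3 := TangentBundle.symmL_trivializationAt (I := 𝓘(ℝ, E)) (x₀ := x₀)
        (x := (extChartAt 𝓘(ℝ, E) x₀).symm p) (by simpa using hs)
      rw [(extChartAt 𝓘(ℝ, E) x₀).right_inv hp] at h3
      rw [VectorField.mpullbackWithin_apply, frame, h3, ← he, ContinuousLinearMap.inverse_equiv]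
      exact e.symm_apply_apply w
    have h4 := ((hc u).filter_mono nhdsWithin_le_nhds).lieBracketWithin_vectorField_eq
      (𝕜 := ℝ)
      (s := (extChartAt 𝓘(ℝ, E) x₀).symm ⁻¹' Set.univ ∩ Set.range 𝓘(ℝ, E)) (hc u).eq_of_nhds
      ((hc v).filter_mono nhdsWithin_le_nhds) (hc v).eq_of_nhds
    erw [h4]
    simp only [VectorField.lieBracketWithin, fderivWithin_const_apply, zero_apply, sub_zero]
    exact map_zero _
  rw [hb, cov_frame_const cov hx, cov_frame_const cov hx, coframe_frame hx, coframe_frame hx,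
    ← map_sub] at h1
  have h2 := congrArg (coframe x₀ x₀) h1
  rw [coframe_frame hx, map_zero, sub_eq_zero] at h2
  exact h2.symm

/-- Smoothness of `cov` is applied to global sections, whereas the frame is smooth only on the chart
domain. A bump function equal to one near the centre makes it global, and locality of `cov` removes
that factor again. -/
theorem contDiffAt_christoffel [T2Space M] {cov : Connection E M}
    (h : cov.ContMDiffCovariantDerivative ∞) (x₀ : M) :
    ContDiffAt ℝ 1 (christoffel cov x₀) (extChartAt 𝓘(ℝ, E) x₀ x₀) := by
  have hx := mem_chart_source E x₀
  obtain ⟨ψ⟩ : Nonempty (SmoothBumpFunction 𝓘(ℝ, E) x₀) := inferInstance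
  refine ContDiffAt.sum fun i _ ↦ ?_
  set b := Module.finBasis ℝ E
  suffices h1 : ContDiffAt ℝ 1 (fun p ↦ coframe x₀ ((extChartAt 𝓘(ℝ, E) x₀).symm p) ∘L
      cov (fun y ↦ frame x₀ y (b i)) ((extChartAt 𝓘(ℝ, E) x₀).symm p) ∘L
        frame x₀ ((extChartAt 𝓘(ℝ, E) x₀).symm p)) (extChartAt 𝓘(ℝ, E) x₀ x₀) from
    contDiffAt_const.smulRight h1
  have hfr : ContMDiffOn 𝓘(ℝ, E) (𝓘(ℝ, E).prod 𝓘(ℝ, E)) ∞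
      (fun y ↦ (⟨y, frame x₀ y (b i)⟩ : TangentBundle 𝓘(ℝ, E) M)) (chartAt E x₀).source :=
    fun y hy ↦ (contMDiffAt_frame hy le_rfl contMDiffAt_const).contMDiffWithinAt
  have hσ := ContMDiffOn.smul_section_of_tsupport ψ.contMDiff.contMDiffOn
    (chartAt E x₀).open_source ψ.tsupport_subset_chartAt_source hfr
  have h2 := (h.contMDiff.contMDiff (σ := (ψ : M → ℝ) • fun y ↦ frame x₀ y (b i)) hσ.contMDiffOn).contMDiffAt
    (x := x₀) Filter.univ_mem
  rw [contMDiffAt_hom_bundle] at h2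
  have h3 := contDiffAt_rep (n := 1) hx (by simp) (h2.2.of_le (by simp))
  refine h3.congr_of_eventuallyEq ?_
  have h4 := ψ.eventuallyEq_one.eventually_nhds
  have h5 := (continuousAt_extChartAt_symm (I := 𝓘(ℝ, E)) x₀)
  rw [ContinuousAt, extChartAt_to_inv] at h5
  filter_upwards [h5.eventually h4, h5.eventually ((chartAt E x₀).open_source.mem_nhds hx)]
    with p hp hp'
  have h6 : cov (fun y ↦ frame x₀ y (b i)) ((extChartAt 𝓘(ℝ, E) x₀).symm p) =
      cov ((ψ : M → ℝ) • fun y ↦ frame x₀ y (b i)) ((extChartAt 𝓘(ℝ, E) x₀).symm p) := by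
    symm
    refine cov_congr cov (mdifferentiableAt_frame hp' mdifferentiableAt_const) ?_
    filter_upwards [hp] with y hy
    simp [hy]
  rw [h6]
  rfl

end HessianCoordinates

/-! ### Derivatives of functions, differentials and Hessians along geodesics. -/

section Curves


variable {E : Type*} [NormedAddCommGroup E] [NormedSpace ℝ E]
  {M : Type*} [TopologicalSpace M] [ChartedSpace E M] [IsManifold 𝓘(ℝ, E) ∞ M]

/-- The coordinates of the velocity of a curve in the preferred chart at `x₀`. -/
def velRep (γ : ℝ → M) (x₀ : M) (s : ℝ) : E := coframe x₀ (γ s) (velocity γ s)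

theorem hasDerivAt_extChartAt_comp {γ : ℝ → M} (hγ : ContMDiff 𝓘(ℝ, ℝ) 𝓘(ℝ, E) ∞ γ) {x₀ : M}
    {s : ℝ} (hs : γ s ∈ (chartAt E x₀).source) :
    HasDerivAt (fun s ↦ extChartAt 𝓘(ℝ, E) x₀ (γ s)) (velRep γ x₀ s) s := by
  have h1 := HasMFDerivAt.comp s (mdifferentiableAt_extChartAt (I := 𝓘(ℝ, E)) hs).hasMFDerivAt
    ((hγ s).mdifferentiableAt (by simp)).hasMFDerivAt
  rw [← coframe_eq_mfderiv hs, hasMFDerivAt_iff_hasFDerivAt] at h1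
  let A : ℝ →L[ℝ] E := (coframe x₀ (γ s)).comp (mfderiv 𝓘(ℝ, ℝ) 𝓘(ℝ, E) γ s)
  have h2 : HasFDerivAt (fun s ↦ extChartAt 𝓘(ℝ, E) x₀ (γ s)) A s := h1
  exact h2.hasDerivAt

omit [IsManifold 𝓘(ℝ, E) ∞ M] in
theorem eventually_mem_source {γ : ℝ → M} (hγ : ContMDiff 𝓘(ℝ, ℝ) 𝓘(ℝ, E) ∞ γ) {x₀ : M}
    {s : ℝ} (hs : γ s ∈ (chartAt E x₀).source) : ∀ᶠ r in 𝓝 s, γ r ∈ (chartAt E x₀).source :=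
  hγ.continuous.continuousAt.eventually_mem ((chartAt E x₀).open_source.mem_nhds hs)

theorem contDiffAt_extChartAt_comp {γ : ℝ → M} (hγ : ContMDiff 𝓘(ℝ, ℝ) 𝓘(ℝ, E) ∞ γ) {x₀ : M}
    {s : ℝ} (hs : γ s ∈ (chartAt E x₀).source) :
    ContDiffAt ℝ ∞ (fun s ↦ extChartAt 𝓘(ℝ, E) x₀ (γ s)) s := by
  rw [← contMDiffAt_iff_contDiffAt]
  exact ContMDiffAt.comp (I' := 𝓘(ℝ, E)) s (contMDiffAt_extChartAt' (I := 𝓘(ℝ, E)) (n := ∞) hs) (hγ s)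

theorem contDiffAt_velRep {γ : ℝ → M} (hγ : ContMDiff 𝓘(ℝ, ℝ) 𝓘(ℝ, E) ∞ γ) {x₀ : M}
    {s : ℝ} (hs : γ s ∈ (chartAt E x₀).source) : ContDiffAt ℝ ∞ (velRep (E := E) γ x₀) s := by
  have h1 : ContDiffAt ℝ ∞ (deriv fun s ↦ extChartAt 𝓘(ℝ, E) x₀ (γ s)) s :=
    (ContDiffAt.fderiv_right (n := ∞) (contDiffAt_extChartAt_comp hγ hs) (by simp)).clm_apply
      contDiffAt_const
  refine h1.congr_of_eventuallyEq ?_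
  filter_upwards [eventually_mem_source hγ hs] with r hr
  exact (hasDerivAt_extChartAt_comp hγ hr).deriv.symm

omit [IsManifold 𝓘(ℝ, E) ∞ M] [ChartedSpace E M] [TopologicalSpace M] in
theorem hasDerivAt_bilin_apply {H : E → E →L[ℝ] E →L[ℝ] ℝ} {H' : E →L[ℝ] E →L[ℝ] E →L[ℝ] ℝ}
    {c v w : ℝ → E} {c' v' w' : E} {t : ℝ} (hH : HasFDerivAt H H' (c t)) (hc : HasDerivAt c c' t)
    (hv : HasDerivAt v v' t) (hw : HasDerivAt w w' t) :
    HasDerivAt (fun s ↦ H (c s) (v s) (w s))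
      (H' c' (v t) (w t) + H (c t) v' (w t) + H (c t) (v t) w') t := by
  have h1 : HasDerivAt (fun s ↦ H (c s)) (H' c') t := hH.comp_hasDerivAt t hc
  have h2 : HasDerivAt (fun s ↦ H (c s) (v s)) _ t := h1.clm_apply hv
  exact h2.clm_apply hw

variable [FiniteDimensional ℝ E]

theorem covDerivAlong_velocity (cov : Connection E M) {γ : ℝ → M}
    (hγ : ContMDiff 𝓘(ℝ, ℝ) 𝓘(ℝ, E) ∞ γ) (t : ℝ) :
    covDerivAlong cov γ (velocity γ) t = frame (γ t) (γ t) (deriv (velRep γ (γ t)) t +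
      christoffel cov (γ t) (extChartAt 𝓘(ℝ, E) (γ t) (γ t)) (velRep γ (γ t) t)
        (velRep γ (γ t) t)) := by
  have hx := mem_chart_source E (γ t)
  have h1 : (fun s : ℝ ↦ ((trivializationAt E (TangentSpace 𝓘(ℝ, E) : M → Type _) (γ t))
      (⟨γ s, velocity γ s⟩ : TangentBundle 𝓘(ℝ, E) M)).2) =ᶠ[𝓝 t] velRep γ (γ t) := by
    filter_upwards [eventually_mem_source hγ hx] with s hs
    exact trivializationAt_snd hs _
  unfold covDerivAlong
  rw [h1.deriv_eq, cov_extendVec, cov_frame_const cov hx, map_add]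
  congr 1
  exact (Trivialization.symmL_apply (R := ℝ)
    (trivializationAt E (TangentSpace 𝓘(ℝ, E) : M → Type _) (γ t)) (by simp) _).symm

theorem IsGeodesic.hasDerivAt_velRep_self {cov : Connection E M} {γ : ℝ → M}
    (hγ : IsGeodesic cov γ) (t : ℝ) :
    HasDerivAt (velRep γ (γ t)) (-christoffel cov (γ t) (extChartAt 𝓘(ℝ, E) (γ t) (γ t))
      (velRep γ (γ t) t) (velRep γ (γ t) t)) t := by
  have hx := mem_chart_source E (γ t)
  have h1 := congrArg (coframe (γ t) (γ t)) (hγ.2 t)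
  rw [covDerivAlong_velocity cov hγ.1, coframe_frame hx, map_zero] at h1
  rw [← eq_neg_of_add_eq_zero_left h1]
  exact ((contDiffAt_velRep hγ.1 hx).differentiableAt (by simp)).hasDerivAt

omit [FiniteDimensional ℝ E] [IsManifold 𝓘(ℝ, E) ∞ M] in
theorem hasDerivAt_comp_curve {f : M → ℝ} {γ : ℝ → M} (hγ : ContMDiff 𝓘(ℝ, ℝ) 𝓘(ℝ, E) ∞ γ)
    {t : ℝ} (hf : MDifferentiableAt 𝓘(ℝ, E) 𝓘(ℝ, ℝ) f (γ t)) :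
    HasDerivAt (fun s ↦ f (γ s)) (diff f (γ t) (velocity (E := E) γ t)) t := by
  have h1 := hf.hasMFDerivAt.comp t ((hγ t).mdifferentiableAt (by simp)).hasMFDerivAt
  rw [hasMFDerivAt_iff_hasFDerivAt] at h1
  let A : ℝ →L[ℝ] ℝ := (mfderiv 𝓘(ℝ, E) 𝓘(ℝ, ℝ) f (γ t)).comp (mfderiv 𝓘(ℝ, ℝ) 𝓘(ℝ, E) γ t)
  have h2 : HasFDerivAt (fun s ↦ f (γ s)) A t := h1
  exact h2.hasDerivAt

omit [FiniteDimensional ℝ E] in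
theorem eventually_rep_curve {γ : ℝ → M} (hγ : ContMDiff 𝓘(ℝ, ℝ) 𝓘(ℝ, E) ∞ γ) {x₀ : M}
    {s : ℝ} (hs : γ s ∈ (chartAt E x₀).source) {P : E → Prop}
    (h : ∀ᶠ p in 𝓝 (extChartAt 𝓘(ℝ, E) x₀ (γ s)), P p) :
    ∀ᶠ r in 𝓝 s, P (extChartAt 𝓘(ℝ, E) x₀ (γ r)) :=
  (hasDerivAt_extChartAt_comp hγ hs).continuousAt.eventually h

/-- The geodesic equation replaces the derivative of the velocity by minus the Christoffel term,
which is exactly the correction in the Hessian. -/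
theorem IsGeodesic.hasDerivAt_diff {cov : Connection E M} {f : M → ℝ} {γ : ℝ → M}
    (hγ : IsGeodesic cov γ) {t : ℝ} (hf : ContMDiffAt 𝓘(ℝ, E) 𝓘(ℝ, ℝ) 2 f (γ t)) :
    HasDerivAt (fun s ↦ diff f (γ s) (velocity (E := E) γ s))
      (hess cov f (γ t) (velocity γ t) (velocity γ t)) t := by
  have hx := mem_chart_source E (γ t)
  have hr := contDiffAt_rep hx (WithTop.coe_le_coe.2 le_top) hf
  have h1 : (fun s ↦ diff f (γ s) (velocity (E := E) γ s)) =ᶠ[𝓝 t]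
      fun s ↦ fderiv ℝ (rep f (γ t)) (extChartAt 𝓘(ℝ, E) (γ t) (γ s)) (velRep γ (γ t) s) := by
    filter_upwards [eventually_mem_source hγ.1 hx,
      eventually_rep_curve hγ.1 hx (hr.eventually (by simp))] with s h1 h2
    exact diff_eq_fderiv_rep h1 (h2.differentiableAt (by simp)) _
  have hfd : HasFDerivAt (fderiv ℝ (rep f (γ t)))
      (fderiv ℝ (fderiv ℝ (rep f (γ t))) (extChartAt 𝓘(ℝ, E) (γ t) (γ t))) (extChartAt 𝓘(ℝ, E) (γ t) (γ t)) :=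
    ((hr.fderiv_right (m := 1) (by norm_num)).differentiableAt one_ne_zero).hasFDerivAt
  have h3 : HasDerivAt (fun s ↦ fderiv ℝ (rep f (γ t)) (extChartAt 𝓘(ℝ, E) (γ t) (γ s))) _ t :=
    hfd.comp_hasDerivAt t (hasDerivAt_extChartAt_comp hγ.1 hx)
  have h2 := h3.clm_apply (hγ.hasDerivAt_velRep_self t)
  refine (h2.congr_of_eventuallyEq h1).congr_deriv ?_
  rw [hess_eq_rep cov hx hr, map_neg, ← sub_eq_add_neg, velRep]

theorem IsGeodesic.hasDerivAt_hess [T2Space M] {cov : Connection E M}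
    (hcov : cov.ContMDiffCovariantDerivative ∞) {f : M → ℝ} {γ : ℝ → M}
    (hγ : IsGeodesic cov γ) {t : ℝ} (hf : ContMDiffAt 𝓘(ℝ, E) 𝓘(ℝ, ℝ) 3 f (γ t)) :
    HasDerivAt (fun s ↦ hess (E := E) cov f (γ s) (velocity γ s) (velocity γ s))
      (covHess cov f (γ t) (velocity γ t) (velocity γ t) (velocity γ t)) t := by
  have hx := mem_chart_source E (γ t)
  have hr := contDiffAt_rep hx (WithTop.coe_le_coe.2 le_top) hf
  have hΓ := contDiffAt_christoffel hcov (γ t)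
  have h1 : (fun s ↦ hess (E := E) cov f (γ s) (velocity γ s) (velocity γ s)) =ᶠ[𝓝 t]
      fun s ↦ hessRep cov f (γ t) (extChartAt 𝓘(ℝ, E) (γ t) (γ s)) (velRep γ (γ t) s)
        (velRep γ (γ t) s) := by
    filter_upwards [eventually_mem_source hγ.1 hx,
      eventually_rep_curve hγ.1 hx (hr.eventually (by simp))] with s h1 h2
    exact hess_eq_hessRep cov h1 (h2.of_le (by norm_num)) _ _
  have hfd : HasFDerivAt (hessRep cov f (γ t))
      (fderiv ℝ (hessRep cov f (γ t)) (extChartAt 𝓘(ℝ, E) (γ t) (γ t))) (extChartAt 𝓘(ℝ, E) (γ t) (γ t)) :=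
    ((contDiffAt_hessRep hr hΓ).differentiableAt one_ne_zero).hasFDerivAt
  have hv := hγ.hasDerivAt_velRep_self t
  have h2 := hasDerivAt_bilin_apply hfd (hasDerivAt_extChartAt_comp hγ.1 hx) hv hv
  refine (h2.congr_of_eventuallyEq h1).congr_deriv ?_
  rw [covHess_eq_rep hr hΓ]
  simp only [map_neg, _root_.neg_apply, velRep]
  ring

end Curves

/-! ### Linear algebra of inner products and dual norms. -/

section LocalNorms

section Algebra

variable {V : Type*} [AddCommGroup V] [Module ℝ V] {G T : V → V → ℝ}

/-- Symmetric bilinear forms. -/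
structure IsSymmBilin (G : V → V → ℝ) : Prop where
  symm : ∀ u v, G u v = G v u
  add_left : ∀ u v w, G (u + v) w = G u w + G v w
  smul_left : ∀ (c : ℝ) u v, G (c • u) v = c * G u v

theorem IsSymmBilin.add_right (h : IsSymmBilin G) (u v w : V) : G u (v + w) = G u v + G u w := by
  rw [h.symm, h.add_left, h.symm v, h.symm w]

theorem IsSymmBilin.smul_right (h : IsSymmBilin G) (c : ℝ) (u v : V) :
    G u (c • v) = c * G u v := by
  rw [h.symm, h.smul_left, h.symm v]

theorem IsSymmBilin.zero_left (h : IsSymmBilin G) (v : V) : G 0 v = 0 := by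
  have := h.smul_left 0 0 v
  rwa [zero_smul, zero_mul] at this

theorem IsSymmBilin.zero_right (h : IsSymmBilin G) (v : V) : G v 0 = 0 := by
  rw [h.symm, h.zero_left]

theorem IsSymmBilin.neg_left (h : IsSymmBilin G) (u v : V) : G (-u) v = -G u v := by
  rw [← neg_one_smul ℝ, h.smul_left]; ring

theorem IsSymmBilin.neg_right (h : IsSymmBilin G) (u v : V) : G u (-v) = -G u v := by
  rw [h.symm, h.neg_left, h.symm v]

theorem IsSymmBilin.sub_left (h : IsSymmBilin G) (u v w : V) : G (u - v) w = G u w - G v w := by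
  rw [sub_eq_add_neg, h.add_left, h.neg_left]; ring

theorem IsSymmBilin.sub_right (h : IsSymmBilin G) (u v w : V) : G u (v - w) = G u v - G u w := by
  rw [h.symm, h.sub_left, h.symm v, h.symm w]

/-- Positive definite symmetric bilinear forms. -/
structure IsInner (G : V → V → ℝ) : Prop extends IsSymmBilin G where
  pos : ∀ u, u ≠ 0 → 0 < G u u

theorem IsInner.nonneg (h : IsInner G) (u : V) : 0 ≤ G u u := by
  rcases eq_or_ne u 0 with rfl | hu
  · rw [h.zero_left]
  · exact (h.pos u hu).le

theorem IsInner.sq_apply_le (h : IsInner G) (u v : V) : G u v ^ 2 ≤ G u u * G v v := by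
  rcases eq_or_ne v 0 with rfl | hv
  · simp [h.zero_right]
  have h1 := h.nonneg (G v v • u - G u v • v)
  simp only [h.sub_left, h.sub_right, h.smul_left, h.smul_right, h.symm v u] at h1
  have h2 := h.pos v hv
  have h3 : 0 ≤ G v v * (G u u * G v v - G u v ^ 2) := by linarith
  linarith [nonneg_of_mul_nonneg_right h3 h2]

theorem IsInner.apply_le (h : IsInner G) (u v : V) : G u v ≤ √(G u u) * √(G v v) := by
  rw [← Real.sqrt_mul (h.nonneg u)]
  exact Real.le_sqrt_of_sq_le (h.sq_apply_le u v)

/-- A symmetric form bounded by an inner product on the diagonal is bounded everywhere. -/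
theorem IsSymmBilin.apply_le (hT : IsSymmBilin T) (hG : IsInner G) {c : ℝ}
    (h : ∀ u, |T u u| ≤ c * G u u) (u w : V) : T u w ≤ c * √(G u u) * √(G w w) := by
  rcases eq_or_ne u 0 with rfl | hu
  · simp [hT.zero_left, hG.zero_left]
  rcases eq_or_ne w 0 with rfl | hw
  · simp [hT.zero_right, hG.zero_right]
  have ha := Real.sqrt_pos.2 (hG.pos u hu)
  have hb := Real.sqrt_pos.2 (hG.pos w hw)
  have hauu := Real.sq_sqrt (hG.nonneg u)
  have hbww := Real.sq_sqrt (hG.nonneg w)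
  set a := √(G u u)
  set b := √(G w w)
  -- Polarization with both vectors scaled to length `a * b`: the difference of the two values of
  -- `T` is `4ab T(u, w)`, and the two values of `G` add up to `4a²b²`.
  have h1 := (abs_le.1 (h (b • u + a • w))).2
  have h2 := (abs_le.1 (h (b • u - a • w))).1
  simp only [hT.add_left, hT.add_right, hT.sub_left, hT.sub_right, hT.smul_left, hT.smul_right,
    hG.add_left, hG.add_right, hG.sub_left, hG.sub_right, hG.smul_left, hG.smul_right, hT.symm w u,
    hG.symm w u, ← hauu, ← hbww] at h1 h2
  have h3 : (a * b) * T u w ≤ (a * b) * (c * a * b) := by nlinarith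
  exact le_of_mul_le_mul_left h3 (by positivity)

variable [FiniteDimensional ℝ V]

/-- Definiteness makes `w ↦ G w` injective, hence onto the dual by dimension. So `formInv` does not
fall back on its default value for inner products. -/
theorem IsInner.exists_eq (h : IsInner G) (p : V →ₗ[ℝ] ℝ) : ∃ w : V, ∀ v, G w v = p v := by
  let L : V →ₗ[ℝ] V →ₗ[ℝ] ℝ := LinearMap.mk₂ ℝ G h.add_left (fun c u v ↦ h.smul_left c u v)
    h.add_right (fun c u v ↦ h.smul_right c u v)
  have hinj : Function.Injective L := by
    rw [injective_iff_map_eq_zero]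
    intro u hu
    by_contra hne
    have h1 : L u u = 0 := by rw [hu]; rfl
    exact (h.pos u hne).ne' h1
  have hsurj := (LinearMap.injective_iff_surjective_of_finrank_eq_finrank
    (Subspace.dual_finrank_eq (K := ℝ) (V := V)).symm).1 hinj
  obtain ⟨w, hw⟩ := hsurj p
  exact ⟨w, fun v ↦ by rw [← hw]; rfl⟩

theorem IsInner.formInv_apply (h : IsInner G) (p : V →ₗ[ℝ] ℝ) (v : V) :
    G (formInv G p) v = p v := by
  have h1 := h.exists_eq p
  rw [formInv, dif_pos h1]
  exact h1.choose_spec v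

theorem IsInner.formInv_eq (h : IsInner G) {p : V →ₗ[ℝ] ℝ} {w : V} (hw : ∀ v, G w v = p v) :
    formInv G p = w := by
  by_contra hne
  have h1 := h.pos _ (sub_ne_zero.2 hne)
  rw [h.sub_left, h.formInv_apply, hw, sub_self] at h1
  exact h1.false

omit [Module ℝ V] [FiniteDimensional ℝ V] in
theorem dualNorm_nonneg (p : V → ℝ) : 0 ≤ dualNorm G p := Real.sqrt_nonneg _

theorem IsInner.dualNorm_eq (h : IsInner G) {p : V →ₗ[ℝ] ℝ} {w : V} (hw : ∀ v, G w v = p v) :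
    dualNorm G p = √(G w w) := by
  rw [dualNorm, h.formInv_eq hw]

theorem IsInner.apply_le_dualNorm (h : IsInner G) (p : V →ₗ[ℝ] ℝ) (v : V) :
    p v ≤ dualNorm G p * √(G v v) := by
  rw [← h.formInv_apply p v]
  exact h.apply_le _ _

theorem IsInner.dualNorm_le (h : IsInner G) {p : V →ₗ[ℝ] ℝ} {c : ℝ} (hc : 0 ≤ c)
    (hp : ∀ v, p v ≤ c * √(G v v)) : dualNorm G p ≤ c := by
  have h1 := hp (formInv G p)
  rw [← h.formInv_apply] at h1
  have h2 := Real.mul_self_sqrt (h.nonneg (formInv G p))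
  rw [dualNorm]
  by_contra! hlt
  nlinarith

theorem IsInner.dualNorm_add_le (h : IsInner G) (p q : V →ₗ[ℝ] ℝ) :
    dualNorm G (fun v ↦ p v + q v) ≤ dualNorm G p + dualNorm G q := by
  refine h.dualNorm_le (p := p + q) (add_nonneg (dualNorm_nonneg _) (dualNorm_nonneg _)) fun v ↦ ?_
  rw [LinearMap.add_apply, add_mul]
  exact add_le_add (h.apply_le_dualNorm p v) (h.apply_le_dualNorm q v)

theorem IsInner.dualNorm_smul (h : IsInner G) {c : ℝ} (hc : 0 ≤ c) (p : V →ₗ[ℝ] ℝ) :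
    dualNorm G (fun v ↦ c * p v) = c * dualNorm G p := by
  have h1 : dualNorm G (c • p) = _ := h.dualNorm_eq (p := c • p) (w := c • formInv G p) fun v ↦ by
    rw [h.smul_left, h.formInv_apply]; rfl
  change dualNorm G (c • p) = _
  rw [h1, h.smul_left, h.smul_right, dualNorm, ← mul_assoc, Real.sqrt_mul (by positivity),
    Real.sqrt_mul_self hc]

theorem IsInner.dualNorm_neg (h : IsInner G) (p : V →ₗ[ℝ] ℝ) :
    dualNorm G (fun v ↦ -p v) = dualNorm G p := by
  have h1 : dualNorm G (-p) = _ := h.dualNorm_eq (p := -p) (w := -formInv G p) fun v ↦ by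
    rw [h.neg_left, h.formInv_apply]; rfl
  change dualNorm G (-p) = _
  rw [h1, h.neg_left, h.neg_right, dualNorm, neg_neg]

theorem IsInner.dualNorm_pos (h : IsInner G) {p : V →ₗ[ℝ] ℝ} {v : V} (hv : p v ≠ 0) :
    0 < dualNorm G p := by
  refine Real.sqrt_pos.2 (h.pos _ fun h0 ↦ hv ?_)
  rw [← h.formInv_apply, h0, h.zero_left]

end Algebra

end LocalNorms

/-! ### The Hessian as an inner product, and the derivative of a squared dual norm. -/

section Hessian


variable {E : Type*} [NormedAddCommGroup E] [NormedSpace ℝ E]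
  {M : Type*} [TopologicalSpace M] [ChartedSpace E M] [IsManifold 𝓘(ℝ, E) ∞ M]

section Hessian

variable [FiniteDimensional ℝ E] [CompleteSpace E] {cov : Connection E M}

theorem isSymmBilin_hess (hcov : cov.torsion = 0) {f : M → ℝ} {x : M}
    (hf : ContMDiffAt 𝓘(ℝ, E) 𝓘(ℝ, ℝ) 2 f x) : IsSymmBilin (hess cov f x) := by
  have hx := mem_chart_source E x
  have hr := contDiffAt_rep hx (WithTop.coe_le_coe.2 le_top) hf
  have hs : IsSymmSndFDerivAt ℝ (rep f x) (extChartAt 𝓘(ℝ, E) x x) :=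
    hr.isSymmSndFDerivAt (by simp)
  constructor
  · intro u v
    rw [hess_eq_rep cov hx hr, hess_eq_rep cov hx hr, hs.eq, christoffel_symm hcov]
  · intro u v w
    simp only [hess_eq_hessRep cov hx hr, map_add, _root_.add_apply]
  · intro c u v
    simp only [hess_eq_hessRep cov hx hr, map_smul, _root_.smul_apply, smul_eq_mul]

theorem isSymmBilin_covHess [T2Space M] (hcov : cov.ContMDiffCovariantDerivative ∞)
    (htor : cov.torsion = 0) {f : M → ℝ} {x : M} (hf : ContMDiffAt 𝓘(ℝ, E) 𝓘(ℝ, ℝ) 3 f x)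
    (v : TangentSpace 𝓘(ℝ, E) x) : IsSymmBilin (covHess cov f x v) := by
  have hx := mem_chart_source E x
  have hr := contDiffAt_rep hx (WithTop.coe_le_coe.2 le_top) hf
  have hΓ := contDiffAt_christoffel hcov x
  have hf2 : ContMDiffAt 𝓘(ℝ, E) 𝓘(ℝ, ℝ) 2 f x := hf.of_le (by norm_num)
  have hH := isSymmBilin_hess htor hf2
  constructor
  · intro u w
    have h1 : (fun y ↦ hess cov f y (extendVec u y) (extendVec w y)) =ᶠ[𝓝 x]
        fun y ↦ hess cov f y (extendVec w y) (extendVec u y) := by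
      -- The term that is differentiated requires symmetry of the Hessian at all nearby points.
      filter_upwards [(contMDiffAt_iff_contMDiffAt_nhds (by simp)).1 hf2] with y hy
      exact (isSymmBilin_hess htor hy).symm _ _
    unfold covHess
    rw [diff_congr h1, hH.symm u, hH.symm _ w]
    ring
  · intro u u' w
    simp only [covHess_eq_rep hr hΓ, map_add, _root_.add_apply]
    ring
  · intro c u w
    simp only [covHess_eq_rep hr hΓ, map_smul, _root_.smul_apply, smul_eq_mul]
    ring

omit [FiniteDimensional ℝ E] [CompleteSpace E] in
theorem IsSelfConcordant.contMDiffAt {σ : ℝ} {C : Set M} {F : M → ℝ}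
    (hF : IsSelfConcordant cov σ C F) {x : M} (hx : x ∈ C) {n : ℕ∞ω} (hn : n ≤ ∞) :
    ContMDiffAt 𝓘(ℝ, E) 𝓘(ℝ, ℝ) n F x :=
  ((hF.smooth x hx).contMDiffAt (hF.isOpen.mem_nhds hx)).of_le hn

theorem IsSelfConcordant.isInner {σ : ℝ} {C : Set M} {F : M → ℝ}
    (hF : IsSelfConcordant cov σ C F) (htor : cov.torsion = 0) {x : M} (hx : x ∈ C) :
    IsInner (hess cov F x) where
  toIsSymmBilin := isSymmBilin_hess htor (hF.contMDiffAt hx (WithTop.coe_le_coe.2 le_top))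
  pos := hF.nondegenerate x hx

theorem IsSelfConcordant.covHess_apply_le [T2Space M]
    (hcov : cov.ContMDiffCovariantDerivative ∞) (htor : cov.torsion = 0) {C : Set M} {F : M → ℝ}
    (hF : IsSelfConcordant cov 1 C F) {x : M} (hx : x ∈ C) (v u w : TangentSpace 𝓘(ℝ, E) x) :
    covHess cov F x v u w ≤
      2 * √(hess cov F x v v) * √(hess cov F x u u) * √(hess cov F x w w) := by
  refine (isSymmBilin_covHess hcov htor (hF.contMDiffAt hx (WithTop.coe_le_coe.2 le_top))
    v).apply_le (hF.isInner htor hx) (fun u ↦ ?_) u w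
  simpa using hF.bound x hx u v

-- With `w = H⁻¹ η`, differentiating `H w = η` gives `H w' = η' - H' w`. By symmetry `η(w') = H(w,
-- w') = η'(w) - H'(w, w)`, so the derivative of `w` drops out of that of `η(w)`.
omit [CompleteSpace E] in
theorem hasDerivAt_apply_inverse {H : ℝ → E →L[ℝ] E →L[ℝ] ℝ} {H' : E →L[ℝ] E →L[ℝ] ℝ}
    {η : ℝ → E →L[ℝ] ℝ} {η' : E →L[ℝ] ℝ} {t : ℝ} (hH : HasDerivAt H H' t)
    (hη : HasDerivAt η η' t) (hsymm : ∀ u v, H t u v = H t v u)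
    (hinj : ∀ u, H t u = 0 → u = 0) {w : E} (hw : H t w = η t) :
    HasDerivAt (fun s ↦ η s (ContinuousLinearMap.inverse (H s) (η s))) (2 * η' w - H' w w) t := by
  have := FiniteDimensional.complete ℝ E
  have hrank : Module.finrank ℝ E = Module.finrank ℝ (E →L[ℝ] ℝ) := by
    rw [← (LinearMap.toContinuousLinearMap (𝕜 := ℝ) (E := E) (F' := ℝ)).finrank_eq]
    exact (Subspace.dual_finrank_eq (K := ℝ) (V := E)).symm
  have hin : Function.Injective (H t : E →ₗ[ℝ] E →L[ℝ] ℝ) :=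
    (injective_iff_map_eq_zero _).2 hinj
  let e : E ≃L[ℝ] (E →L[ℝ] ℝ) :=
    (LinearEquiv.ofInjectiveOfFinrankEq (H t : E →ₗ[ℝ] E →L[ℝ] ℝ) hin hrank).toContinuousLinearEquiv
  have he : (e : E →L[ℝ] E →L[ℝ] ℝ) = H t := by
    ext u v; rfl
  have hi : ContDiffAt ℝ 1 (ContinuousLinearMap.inverse (R := ℝ) (M := E) (M₂ := E →L[ℝ] ℝ))
      (H t) := he ▸ contDiffAt_map_inverse e
  have h1 : DifferentiableAt ℝ (fun s ↦ ContinuousLinearMap.inverse (H s)) t :=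
    (hi.differentiableAt one_ne_zero).comp t hH.differentiableAt
  have h2 : DifferentiableAt ℝ (fun s ↦ ContinuousLinearMap.inverse (H s) (η s)) t :=
    h1.clm_apply hη.differentiableAt
  obtain ⟨w', hw'⟩ : ∃ w', HasDerivAt (fun s ↦ ContinuousLinearMap.inverse (H s) (η s)) w' t :=
    ⟨_, h2.hasDerivAt⟩
  have hwt : ContinuousLinearMap.inverse (H t) (η t) = w := by
    rw [← he, ContinuousLinearMap.inverse_equiv, ← hw, ← he]
    exact e.symm_apply_apply w
  have h3 : (fun s ↦ H s (ContinuousLinearMap.inverse (H s) (η s))) =ᶠ[𝓝 t] η := by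
    have h4 : ∀ᶠ s in 𝓝 t, ∃ e' : E ≃L[ℝ] (E →L[ℝ] ℝ), (e' : E →L[ℝ] E →L[ℝ] ℝ) = H s := by
      have h6 := ContinuousLinearEquiv.nhds e
      rw [he] at h6
      exact hH.continuousAt.preimage_mem_nhds h6
    filter_upwards [h4] with s ⟨e', hs⟩
    rw [← hs, ContinuousLinearMap.inverse_equiv]
    exact e'.apply_symm_apply _
  have h5 := (hH.clm_apply hw').unique (hη.congr_of_eventuallyEq h3)
  rw [hwt] at h5
  refine (hη.clm_apply hw').congr_deriv ?_
  rw [hwt, ← hw, hsymm, ← h5]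
  simp only [_root_.add_apply]
  ring

end Hessian

end Hessian

/-! ### The covector interpolating the Newton step. -/

section NewtonDecrement


variable {E : Type*} [NormedAddCommGroup E] [NormedSpace ℝ E]
  {M : Type*} [TopologicalSpace M] [ChartedSpace E M] [IsManifold 𝓘(ℝ, E) ∞ M]

variable [FiniteDimensional ℝ E] [CompleteSpace E] {cov : Connection E M}

/-- The covector `Df + (1 - s) HF(γ', ·)` at `γ(s)`. It interpolates between `Df + HF(γ', ·)`, which
vanishes at `0` for the Newton step, and `Df`. -/
def newtonCovector (cov : Connection E M) (f F : M → ℝ) (γ : ℝ → M) (s : ℝ)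
    (v : TangentSpace 𝓘(ℝ, E) (γ s)) : ℝ :=
  diff f (γ s) v + (1 - s) * hess cov F (γ s) (velocity γ s) v

/-- The vector dual to `newtonCovector`. -/
def newtonVector (cov : Connection E M) (f F : M → ℝ) (γ : ℝ → M) (s : ℝ) :
    TangentSpace 𝓘(ℝ, E) (γ s) :=
  formInv (hess cov F (γ s)) (newtonCovector cov f F γ s)

/-- A function linear in the second slot of a symmetric bilinear form, bundled. -/
def IsSymmBilin.toLin {V : Type*} [AddCommGroup V] [Module ℝ V] {G : V → V → ℝ}
    (h : IsSymmBilin G) (u : V) : V →ₗ[ℝ] ℝ where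
  toFun := G u
  map_add' := h.add_right u
  map_smul' c v := h.smul_right c u v

omit [FiniteDimensional ℝ E] [CompleteSpace E] in
theorem hasDerivAt_comp_of_hasFDerivAt {F : Type*} [NormedAddCommGroup F] [NormedSpace ℝ F]
    {H : E → F} {H' : E →L[ℝ] F} {c : ℝ → E} {c' : E} {t : ℝ} (hH : HasFDerivAt H H' (c t))
    (hc : HasDerivAt c c' t) : HasDerivAt (fun s ↦ H (c s)) (H' c') t :=
  hH.comp_hasDerivAt t hc

omit [CompleteSpace E] in
theorem hess_newtonVector {F f : M → ℝ} {γ : ℝ → M} {s : ℝ}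
    (hF : IsInner (hess (E := E) cov F (γ s))) (v : TangentSpace 𝓘(ℝ, E) (γ s)) :
    hess cov F (γ s) (newtonVector cov f F γ s) v = newtonCovector cov f F γ s v :=
  have : FiniteDimensional ℝ (TangentSpace 𝓘(ℝ, E) (γ s)) := ‹FiniteDimensional ℝ E›
  hF.formInv_apply ((diff (E := E) f (γ s)).toLinearMap + (1 - s) • hF.toLin (velocity γ s)) v

-- The covariant derivative of `newtonCovector` along `γ` is `Hf(γ', ·) - HF(γ', ·) + (1 - s)
-- ∇HF(γ', γ', ·)`, whose first two terms cancel because the Hessians agree. The formula for the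
-- derivative of a squared dual norm then gives the claim, without any parallel transport.
set_option maxHeartbeats 400000 in
theorem hasDerivAt_hess_newtonVector [T2Space M] (hcov : cov.ContMDiffCovariantDerivative ∞)
    (htor : cov.torsion = 0) {C : Set M} {F f : M → ℝ} (hF : IsSelfConcordant cov 1 C F)
    (hf : ContMDiffOn 𝓘(ℝ, E) 𝓘(ℝ, ℝ) ∞ f C)
    (hfF : ∀ x ∈ C, ∀ u v : TangentSpace 𝓘(ℝ, E) x, hess cov f x u v = hess cov F x u v)
    {γ : ℝ → M} (hγ : IsGeodesic cov γ) {t : ℝ} (ht : γ t ∈ C) :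
    HasDerivAt
      (fun s ↦ hess cov F (γ s) (newtonVector cov f F γ s) (newtonVector cov f F γ s))
      (2 * (1 - t) * covHess cov F (γ t) (velocity γ t) (velocity γ t) (newtonVector cov f F γ t)
        - covHess cov F (γ t) (velocity γ t) (newtonVector cov f F γ t)
          (newtonVector cov f F γ t)) t := by
  have hx := mem_chart_source E (γ t)
  have hF3 : ContMDiffAt 𝓘(ℝ, E) 𝓘(ℝ, ℝ) 3 F (γ t) :=
    hF.contMDiffAt ht (WithTop.coe_le_coe.2 le_top)
  have hf3 : ContMDiffAt 𝓘(ℝ, E) 𝓘(ℝ, ℝ) 3 f (γ t) :=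
    ((hf _ ht).contMDiffAt (hF.isOpen.mem_nhds ht)).of_le (WithTop.coe_le_coe.2 le_top)
  have hFr := contDiffAt_rep hx (WithTop.coe_le_coe.2 le_top) hF3
  have hfr := contDiffAt_rep hx (WithTop.coe_le_coe.2 le_top) hf3
  have hΓ := contDiffAt_christoffel hcov (γ t)
  have hG := hF.isInner htor ht
  set φ := extChartAt 𝓘(ℝ, E) (γ t) with hφ
  set H := hessRep cov F (γ t) with hH
  have hc : HasDerivAt (fun s ↦ φ (γ s)) (velRep γ (γ t) t) t := hasDerivAt_extChartAt_comp hγ.1 hx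
  have hv := hγ.hasDerivAt_velRep_self t
  have hHd : HasFDerivAt H (fderiv ℝ H (φ (γ t))) (φ (γ t)) :=
    ((contDiffAt_hessRep hFr hΓ).differentiableAt one_ne_zero).hasFDerivAt
  have hfd : HasFDerivAt (fderiv ℝ (rep f (γ t))) (fderiv ℝ (fderiv ℝ (rep f (γ t))) (φ (γ t)))
      (φ (γ t)) :=
    (ContDiffAt.differentiableAt (n := 1) (ContDiffAt.fderiv_right hfr (by norm_num))
      one_ne_zero).hasFDerivAt
  have hHc : HasDerivAt (fun s ↦ H (φ (γ s))) (fderiv ℝ H (φ (γ t)) (velRep γ (γ t) t)) t :=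
    hasDerivAt_comp_of_hasFDerivAt hHd hc
  have hfc : HasDerivAt (fun s ↦ fderiv ℝ (rep f (γ t)) (φ (γ s)))
      (fderiv ℝ (fderiv ℝ (rep f (γ t))) (φ (γ t)) (velRep γ (γ t) t)) t :=
    hfd.comp_hasDerivAt t hc
  have hη : HasDerivAt (fun s ↦ fderiv ℝ (rep f (γ t)) (φ (γ s)) +
      (1 - s) • H (φ (γ s)) (velRep γ (γ t) s)) _ t :=
    hfc.add (((hasDerivAt_id t).const_sub 1).smul (hHc.clm_apply hv))
  have hHess : ∀ᶠ s in 𝓝 t, ∀ u v : TangentSpace 𝓘(ℝ, E) (γ s), hess cov F (γ s) u v =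
      H (φ (γ s)) (coframe (γ t) (γ s) u) (coframe (γ t) (γ s) v) := by
    filter_upwards [eventually_mem_source hγ.1 hx,
      eventually_rep_curve hγ.1 hx (hFr.eventually (by simp))] with s h1 h2 u v
    exact hess_eq_hessRep cov h1 (h2.of_le (by norm_num)) u v
  have hcv : ∀ᶠ s in 𝓝 t, ∀ v : E, newtonCovector cov f F γ s (frame (γ t) (γ s) v) =
      fderiv ℝ (rep f (γ t)) (φ (γ s)) v + (1 - s) * H (φ (γ s)) (velRep γ (γ t) s) v := by
    filter_upwards [hHess, eventually_mem_source hγ.1 hx,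
      eventually_rep_curve hγ.1 hx (hfr.eventually (by simp))] with s h1 h2 h3 v
    rw [newtonCovector, h1, diff_eq_fderiv_rep h2 (h3.differentiableAt (by simp)),
      coframe_frame h2, velRep]
  have hw : ∀ᶠ s in 𝓝 t, H (φ (γ s)) (coframe (γ t) (γ s) (newtonVector cov f F γ s)) =
      fderiv ℝ (rep f (γ t)) (φ (γ s)) + (1 - s) • H (φ (γ s)) (velRep γ (γ t) s) := by
    filter_upwards [hHess, hcv, eventually_mem_source hγ.1 hx,
      hγ.1.continuous.continuousAt.eventually_mem (hF.isOpen.mem_nhds ht)] with s h1 h2 h3 h4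
    ext v
    have h5 := hess_newtonVector (f := f) (hF.isInner htor h4) (frame (γ t) (γ s) v)
    rw [h1, h2, coframe_frame h3] at h5
    exact h5
  have hsymm : ∀ u v, H (φ (γ t)) u v = H (φ (γ t)) v u := by
    intro u v
    have h1 := hG.symm (frame (γ t) (γ t) u) (frame (γ t) (γ t) v)
    rwa [hHess.self_of_nhds, hHess.self_of_nhds, coframe_frame hx, coframe_frame hx] at h1
  have hinj : ∀ s, γ s ∈ C → γ s ∈ (chartAt E (γ t)).source →
      (∀ u v : TangentSpace 𝓘(ℝ, E) (γ s), hess cov F (γ s) u v =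
      H (φ (γ s)) (coframe (γ t) (γ s) u) (coframe (γ t) (γ s) v)) →
      ∀ u, H (φ (γ s)) u = 0 → u = 0 := by
    intro s hs hs' h1 u hu
    by_contra hne
    have h2 : frame (γ t) (γ s) u ≠ 0 := by
      intro h0
      apply hne
      rw [← coframe_frame hs' u, h0, map_zero]
    have h3 := (hF.isInner htor hs).pos _ h2
    rw [h1, coframe_frame hs', hu] at h3
    exact h3.false
  have hmain := hasDerivAt_apply_inverse hHc hη hsymm (hinj t ht hx hHess.self_of_nhds)
    hw.self_of_nhds
  have hev : (fun s ↦ hess cov F (γ s) (newtonVector cov f F γ s) (newtonVector cov f F γ s))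
      =ᶠ[𝓝 t] fun s ↦ (fderiv ℝ (rep f (γ t)) (φ (γ s)) +
        (1 - s) • H (φ (γ s)) (velRep γ (γ t) s)) (ContinuousLinearMap.inverse (H (φ (γ s)))
        (fderiv ℝ (rep f (γ t)) (φ (γ s)) + (1 - s) • H (φ (γ s)) (velRep γ (γ t) s))) := by
    filter_upwards [hHess, hw, eventually_mem_source hγ.1 hx,
      hγ.1.continuous.continuousAt.eventually_mem (hF.isOpen.mem_nhds ht)] with s h1 h2 h3 h4
    rw [← h2, h1]
    congr 1
    have hin : Function.Injective (H (φ (γ s)) : E →ₗ[ℝ] E →L[ℝ] ℝ) :=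
      (injective_iff_map_eq_zero _).2 (hinj s h4 h3 h1)
    have hrank : Module.finrank ℝ E = Module.finrank ℝ (E →L[ℝ] ℝ) := by
      rw [← (LinearMap.toContinuousLinearMap (𝕜 := ℝ) (E := E) (F' := ℝ)).finrank_eq]
      exact (Subspace.dual_finrank_eq (K := ℝ) (V := E)).symm
    let e : E ≃L[ℝ] (E →L[ℝ] ℝ) := (LinearEquiv.ofInjectiveOfFinrankEq
      (H (φ (γ s)) : E →ₗ[ℝ] E →L[ℝ] ℝ) hin hrank).toContinuousLinearEquiv
    have he : (e : E →L[ℝ] E →L[ℝ] ℝ) = H (φ (γ s)) := by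
      ext u v; rfl
    rw [← he, ContinuousLinearMap.inverse_equiv]
    exact (e.symm_apply_apply _).symm
  refine (hmain.congr_of_eventuallyEq hev).congr_deriv ?_
  rw [covHess_eq_rep hFr hΓ, covHess_eq_rep hFr hΓ]
  have hwt := hw.self_of_nhds
  set w := coframe (γ t) (γ t) (newtonVector cov f F γ t)
  set v := velRep (E := E) γ (γ t) t
  change _ = 2 * (1 - t) * (fderiv ℝ H (φ (γ t)) v v w -
    H (φ (γ t)) (christoffel cov (γ t) (φ (γ t)) v v) w -
    H (φ (γ t)) v (christoffel cov (γ t) (φ (γ t)) w v)) - (fderiv ℝ H (φ (γ t)) v w w -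
    H (φ (γ t)) (christoffel cov (γ t) (φ (γ t)) w v) w -
    H (φ (γ t)) w (christoffel cov (γ t) (φ (γ t)) w v))
  -- The equality of Hessians in coordinates; it makes the second derivative of `f` cancel the
  -- derivative of the factor `1 - s`.
  have hfF' : fderiv ℝ (fderiv ℝ (rep f (γ t))) (φ (γ t)) v w = H (φ (γ t)) v w +
      fderiv ℝ (rep f (γ t)) (φ (γ t)) (christoffel cov (γ t) (φ (γ t)) w v) := by
    have h1 := hfF _ ht (frame (γ t) (γ t) v) (frame (γ t) (γ t) w)
    rw [hHess.self_of_nhds, coframe_frame hx, coframe_frame hx,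
      hess_eq_rep cov hx (hfr.of_le (by norm_num)), coframe_frame hx, coframe_frame hx] at h1
    linarith
  have h6 := congrArg (fun L : E →L[ℝ] ℝ ↦ L (christoffel cov (γ t) (φ (γ t)) w v)) hwt
  simp only [_root_.add_apply, _root_.smul_apply, smul_eq_mul, map_neg, _root_.neg_apply, id_eq,
    hfF', ← hφ] at h6 ⊢
  rw [hsymm (christoffel cov (γ t) (φ (γ t)) w v) w]
  linear_combination (-2) * h6

end NewtonDecrement

/-! ### Integrated self-concordance and the quadratic Newton estimate. -/

section SelfConcordance


section Scalar

theorem antitoneOn_of_hasDerivAt {D : Set ℝ} (hD : Convex ℝ D) {f f' : ℝ → ℝ}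
    (hf : ∀ s ∈ D, HasDerivAt f (f' s) s) (hf' : ∀ s ∈ D, f' s ≤ 0) : AntitoneOn f D :=
  antitoneOn_of_hasDerivWithinAt_nonpos hD (fun s hs ↦ (hf s hs).continuousAt.continuousWithinAt)
    (fun s hs ↦ (hf s (interior_subset hs)).hasDerivWithinAt) fun s hs ↦ hf' s (interior_subset hs)

/-- The differential inequality says that `P^{-1/2}` decreases at rate at most one. As `P` may
vanish, it is shifted by `c > 0`, chosen so that `√(P 0 + c) = δ`. -/
theorem sqrt_le_of_deriv_le_of_lt {D : Set ℝ} (hD : Convex ℝ D) (h0 : 0 ∈ D)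
    (hD0 : ∀ s ∈ D, 0 ≤ s) {P P' : ℝ → ℝ} (hP : ∀ s ∈ D, HasDerivAt P (P' s) s)
    (hnn : ∀ s ∈ D, 0 ≤ P s) (hP' : ∀ s ∈ D, P' s ≤ 2 * √(P s) * P s) {δ : ℝ}
    (hδ : √(P 0) < δ) {s : ℝ} (hs : s ∈ D) (hsδ : s * δ < 1) : √(P s) ≤ δ / (1 - s * δ) := by
  have hδ0 : 0 < δ := (Real.sqrt_nonneg _).trans_lt hδ
  set c := δ ^ 2 - P 0 with hc
  have hc0 : 0 < c := by
    have := Real.lt_sq_of_sqrt_lt hδ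
    linarith
  have hpos : ∀ r ∈ D, 0 < P r + c := fun r hr ↦ add_pos_of_nonneg_of_pos (hnn r hr) hc0
  have hanti : AntitoneOn (fun r ↦ -(√(P r + c))⁻¹ - r) D := by
    refine antitoneOn_of_hasDerivAt (f' := fun r ↦ P' r / (2 * √(P r + c)) / √(P r + c) ^ 2 - 1) hD
      (fun r hr ↦ ?_) fun r hr ↦ ?_
    · have h1 := (((hP r hr).add_const c).sqrt (hpos r hr).ne').inv
        (Real.sqrt_pos.2 (hpos r hr)).ne'
      refine (h1.neg.sub (hasDerivAt_id r)).congr_deriv ?_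
      ring
    · have hy := Real.sqrt_pos.2 (hpos r hr)
      have hPy : √(P r) ≤ √(P r + c) := Real.sqrt_le_sqrt (by linarith)
      have hyy := Real.sq_sqrt (hpos r hr).le
      rw [sub_nonpos, div_div, div_le_one (by positivity)]
      have h2 : √(P r) * P r ≤ √(P r + c) * (√(P r + c) ^ 2) :=
        mul_le_mul hPy (by rw [hyy]; linarith) (hnn r hr) hy.le
      nlinarith [hP' r hr]
  have h1 := hanti h0 hs (hD0 s hs)
  have h2 : √(P 0 + c) = δ := by
    rw [hc, add_sub_cancel, Real.sqrt_sq hδ0.le]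
  simp only [h2, sub_zero] at h1
  have hy := Real.sqrt_pos.2 (hpos s hs)
  have hPy : √(P s) ≤ √(P s + c) := Real.sqrt_le_sqrt (by linarith)
  refine hPy.trans ?_
  have h3 : (1 - s * δ) / δ ≤ (√(P s + c))⁻¹ := by
    rw [sub_div, mul_div_cancel_right₀ _ hδ0.ne', one_div]
    linarith
  have h4 := inv_anti₀ (by apply div_pos <;> linarith) h3
  rwa [inv_inv, inv_div] at h4

theorem sqrt_le_of_deriv_le {D : Set ℝ} (hD : Convex ℝ D) (h0 : 0 ∈ D)
    (hD0 : ∀ s ∈ D, 0 ≤ s) {P P' : ℝ → ℝ} (hP : ∀ s ∈ D, HasDerivAt P (P' s) s)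
    (hnn : ∀ s ∈ D, 0 ≤ P s) (hP' : ∀ s ∈ D, P' s ≤ 2 * √(P s) * P s) {s : ℝ} (hs : s ∈ D)
    (hsδ : s * √(P 0) < 1) : √(P s) ≤ √(P 0) / (1 - s * √(P 0)) := by
  set δ := √(P 0)
  have h1 : ContinuousAt (fun d ↦ d / (1 - s * d)) δ := by
    refine continuousAt_id.div (by fun_prop) ?_
    linarith
  -- The previous bound holds for every `d > √(P 0)`; let `d` decrease to `√(P 0)`.
  refine ge_of_tendsto (h1.tendsto.mono_left (nhdsWithin_le_nhds (s := Set.Ioi δ))) ?_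
  have h2 : ∀ᶠ d in 𝓝 δ, s * d < 1 :=
    (continuous_const.mul continuous_id).continuousAt.eventually_lt continuousAt_const hsδ
  filter_upwards [nhdsWithin_le_nhds h2, self_mem_nhdsWithin] with d hd hd'
  exact sqrt_le_of_deriv_le_of_lt hD h0 hD0 hP hnn hP' hd' hs hd

theorem inv_sqrt_le_of_le_deriv {D : Set ℝ} (hD : Convex ℝ D) (h0 : 0 ∈ D)
    (hD0 : ∀ s ∈ D, 0 ≤ s) {P P' : ℝ → ℝ} (hP : ∀ s ∈ D, HasDerivAt P (P' s) s)
    (hpos : ∀ s ∈ D, 0 < P s) (hP' : ∀ s ∈ D, -P' s ≤ 2 * √(P s) * P s) {s : ℝ}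
    (hs : s ∈ D) : (√(P s))⁻¹ ≤ (√(P 0))⁻¹ + s := by
  have hanti : AntitoneOn (fun r ↦ (√(P r))⁻¹ - r) D := by
    refine antitoneOn_of_hasDerivAt (f' := fun r ↦ -P' r / (2 * √(P r)) / √(P r) ^ 2 - 1) hD
      (fun r hr ↦ ?_) fun r hr ↦ ?_
    · have h1 := ((hP r hr).sqrt (hpos r hr).ne').inv (Real.sqrt_pos.2 (hpos r hr)).ne'
      refine (h1.sub (hasDerivAt_id r)).congr_deriv ?_
      ring
    · have hy := Real.sqrt_pos.2 (hpos r hr)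
      have hyy := Real.sq_sqrt (hpos r hr).le
      rw [sub_nonpos, div_div, div_le_one (by positivity), hyy]
      exact hP' r hr
  have h1 := hanti h0 hs (hD0 s hs)
  simp only [sub_zero] at h1
  linarith

/-- Formally `(√N)' ≤ 2 (1 - s) P + √P √N`. The integrating factor `1 - s δ` absorbs the last term,
as `(1 - s δ) √P ≤ δ`, and leaves `((1 - s δ) √N)' ≤ 2 (1 - s) δ² / (1 - δ)`, with integral `δ² / (1
- δ)` over `[0, 1]`. The `ε²` below avoids the singularity of the square root where `N = 0`. -/
theorem sqrt_le_of_newton_deriv_le {P N N' : ℝ → ℝ} {δ : ℝ} (hδ0 : 0 ≤ δ) (hδ1 : δ < 1)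
    (hP : ∀ s ∈ Set.Icc (0 : ℝ) 1, √(P s) ≤ δ / (1 - s * δ))
    (hPnn : ∀ s ∈ Set.Icc (0 : ℝ) 1, 0 ≤ P s)
    (hN : ∀ s ∈ Set.Icc (0 : ℝ) 1, HasDerivAt N (N' s) s)
    (hNnn : ∀ s ∈ Set.Icc (0 : ℝ) 1, 0 ≤ N s)
    (hN' : ∀ s ∈ Set.Icc (0 : ℝ) 1, N' s ≤ 4 * (1 - s) * P s * √(N s) + 2 * √(P s) * N s)
    (hN0 : N 0 = 0) : √(N 1) ≤ (δ / (1 - δ)) ^ 2 := by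
  have h1δ : 0 < 1 - δ := by linarith
  have key : ∀ ε > 0, (1 - δ) * √(N 1) ≤ ε + δ ^ 2 / (1 - δ) := by
    intro ε hε
    have hpos : ∀ r ∈ Set.Icc (0 : ℝ) 1, 0 < N r + ε ^ 2 := fun r hr ↦
      add_pos_of_nonneg_of_pos (hNnn r hr) (by positivity)
    have hanti : AntitoneOn (fun r ↦ (1 - r * δ) * √(N r + ε ^ 2) +
        (1 - r) ^ 2 * (δ ^ 2 / (1 - δ))) (Set.Icc (0 : ℝ) 1) := by
      refine antitoneOn_of_hasDerivAt (f' := fun r ↦ -δ * √(N r + ε ^ 2) +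
        (1 - r * δ) * (N' r / (2 * √(N r + ε ^ 2))) - 2 * (1 - r) * (δ ^ 2 / (1 - δ)))
        (convex_Icc 0 1) (fun r hr ↦ ?_) fun r hr ↦ ?_
      · have h1 := ((hN r hr).add_const (ε ^ 2)).sqrt (hpos r hr).ne'
        have h2 := (((hasDerivAt_id r).mul_const δ).const_sub 1).mul h1
        have h3 := ((((hasDerivAt_id r).const_sub 1).pow 2).mul_const (δ ^ 2 / (1 - δ)))
        refine (h2.add h3).congr_deriv ?_
        simp only [id_eq]
        push_cast
        ring
      · have hy := Real.sqrt_pos.2 (hpos r hr)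
        have hyy := Real.sq_sqrt (hpos r hr).le
        have hNy : √(N r) ≤ √(N r + ε ^ 2) := Real.sqrt_le_sqrt (by nlinarith)
        set y := √(N r + ε ^ 2)
        have hr1 : 0 < 1 - r * δ := by nlinarith [hr.1, hr.2]
        have hb := hP r hr
        have hh := Real.sqrt_nonneg (P r)
        have hhh := Real.sq_sqrt (hPnn r hr)
        set h := √(P r)
        have h4 : N' r / (2 * y) ≤ 2 * (1 - r) * P r + h * y := by
          rw [div_le_iff₀ (by positivity)]
          refine (hN' r hr).trans ?_
          have h5 : (1 - r) * P r * √(N r) ≤ (1 - r) * P r * y :=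
            mul_le_mul_of_nonneg_left hNy (mul_nonneg (by linarith [hr.2]) (hPnn r hr))
          have h6 : h * N r ≤ h * y ^ 2 :=
            mul_le_mul_of_nonneg_left (by rw [hyy]; nlinarith) hh
          nlinarith
        have h7 : (1 - r * δ) * h ≤ δ := by
          rw [le_div_iff₀ hr1] at hb
          linarith
        have h8 : (1 - r * δ) * P r ≤ δ ^ 2 / (1 - δ) := by
          rw [le_div_iff₀ h1δ, ← hhh]
          have h9 : (1 - r * δ) * h ^ 2 * (1 - δ) ≤ ((1 - r * δ) * h) ^ 2 := by
            have h10 : 1 - δ ≤ 1 - r * δ := by nlinarith [hr.2]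
            calc (1 - r * δ) * h ^ 2 * (1 - δ) ≤ (1 - r * δ) * h ^ 2 * (1 - r * δ) :=
                  mul_le_mul_of_nonneg_left h10 (by positivity)
              _ = _ := by ring
          exact h9.trans (pow_le_pow_left₀ (by positivity) h7 2)
        have h11 := mul_le_mul_of_nonneg_left h4 hr1.le
        have h12 := mul_le_mul_of_nonneg_right h7 hy.le
        have h13 := mul_le_mul_of_nonneg_left h8 (by linarith [hr.2] : 0 ≤ 2 * (1 - r))
        nlinarith
    have h1 := hanti (Set.left_mem_Icc.2 zero_le_one) (Set.right_mem_Icc.2 zero_le_one) zero_le_one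
    simp only [hN0, zero_add, Real.sqrt_sq hε.le, one_mul, sub_self, zero_mul, sub_zero, one_pow,
      ne_eq, OfNat.ofNat_ne_zero, not_false_eq_true, zero_pow, add_zero] at h1
    refine le_trans ?_ h1
    exact mul_le_mul_of_nonneg_left (Real.sqrt_le_sqrt (by nlinarith)) h1δ.le
  have h1 : (1 - δ) * √(N 1) ≤ δ ^ 2 / (1 - δ) :=
    le_of_forall_pos_le_add fun ε hε ↦ by linarith [key ε hε]
  rw [div_pow, le_div_iff₀ (by positivity)]
  rw [le_div_iff₀ h1δ] at h1
  linarith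

theorem le_of_deriv_deriv_le {S K : ℝ} (hK : 0 ≤ K) {φ φ' φ'' : ℝ → ℝ}
    (hφ : ∀ s ∈ Set.Ico 0 S, HasDerivAt φ (φ' s) s)
    (hφ' : ∀ s ∈ Set.Ico 0 S, HasDerivAt φ' (φ'' s) s) (hφ'' : ∀ s ∈ Set.Ico 0 S, φ'' s ≤ K)
    {s : ℝ} (hs : s ∈ Set.Ico 0 S) : φ s ≤ φ 0 + (|φ' 0| + K * S) * S := by
  have h0 : (0 : ℝ) ∈ Set.Ico 0 S := ⟨le_rfl, hs.1.trans_lt hs.2⟩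
  have h1 : AntitoneOn (fun r ↦ φ' r - r * K) (Set.Ico 0 S) :=
    antitoneOn_of_hasDerivAt (f' := fun r ↦ φ'' r - 1 * K) (convex_Ico 0 S)
      (fun r hr ↦ (hφ' r hr).sub ((hasDerivAt_id r).mul_const K)) fun r hr ↦ by
      linarith [hφ'' r hr]
  have h2 : AntitoneOn (fun r ↦ φ r - r * (|φ' 0| + K * S)) (Set.Ico 0 S) :=
    antitoneOn_of_hasDerivAt (f' := fun r ↦ φ' r - 1 * (|φ' 0| + K * S)) (convex_Ico 0 S)
      (fun r hr ↦ (hφ r hr).sub ((hasDerivAt_id r).mul_const _)) fun r hr ↦ by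
      have h3 := h1 h0 hr hr.1
      have h4 : r * K ≤ K * S := by nlinarith [hr.2]
      simp only [zero_mul, sub_zero] at h3
      linarith [le_abs_self (φ' 0)]
  have h3 := h2 h0 hs hs.1
  simp only [zero_mul, sub_zero] at h3
  have h4 : s * (|φ' 0| + K * S) ≤ (|φ' 0| + K * S) * S := by
    have h5 : 0 ≤ |φ' 0| + K * S :=
      add_nonneg (abs_nonneg _) (mul_nonneg hK (hs.1.trans hs.2.le))
    nlinarith [hs.2]
  linarith

end Scalar

section Closed

/-- A curve along which a function with closed epigraph stays bounded on bounded intervals does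
not leave the open domain of the function. -/
theorem forall_mem_of_closed_epigraph {M : Type*} [TopologicalSpace M] {C : Set M} {F : M → ℝ}
    (hC : IsOpen C) (hF : IsClosed {p : M × ℝ | p.1 ∈ C ∧ F p.1 ≤ p.2}) {γ : ℝ → M}
    (hγ : Continuous γ) (h0 : γ 0 ∈ C) {T : ℝ}
    (hb : ∀ S, 0 < S → S ≤ T → (∀ s ∈ Set.Ico 0 S, γ s ∈ C) →
      ∃ B, ∀ s ∈ Set.Ico 0 S, F (γ s) ≤ B) :
    ∀ s ∈ Set.Icc 0 T, γ s ∈ C := by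
  by_contra! hcon
  obtain ⟨s₀, hs₀, hs₀C⟩ := hcon
  have hcomp : IsCompact (Set.Icc 0 T ∩ γ ⁻¹' Cᶜ) :=
    isCompact_Icc.inter_right (hC.isClosed_compl.preimage hγ)
  -- `S` is the first exit time. Before it the points `(γ s, B)` lie in the epigraph, hence so does
  -- their limit `(γ S, B)`.
  obtain ⟨S, ⟨hS, hSC⟩, hmin⟩ := hcomp.exists_isLeast ⟨s₀, hs₀, hs₀C⟩
  have hS0 : 0 < S := lt_of_le_of_ne hS.1 fun h ↦ hSC (h ▸ h0)
  have hin : ∀ s ∈ Set.Ico 0 S, γ s ∈ C := by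
    intro s hs
    by_contra h
    exact (hmin ⟨⟨hs.1, hs.2.le.trans hS.2⟩, h⟩).not_gt hs.2
  obtain ⟨B, hB⟩ := hb S hS0 hS.2 hin
  refine hSC ?_
  have h1 : Filter.Tendsto (fun s ↦ (γ s, B)) (𝓝[<] S) (𝓝 (γ S, B)) :=
    ((hγ.continuousAt.tendsto.mono_left nhdsWithin_le_nhds).prodMk_nhds tendsto_const_nhds)
  have h2 := hF.mem_of_tendsto h1 (by
    filter_upwards [Ico_mem_nhdsLT hS0] with s hs
    exact ⟨hin s hs, hB s hs⟩)
  exact h2.1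

end Closed

variable {E : Type*} [NormedAddCommGroup E] [NormedSpace ℝ E]
  {M : Type*} [TopologicalSpace M] [ChartedSpace E M] [IsManifold 𝓘(ℝ, E) ∞ M]

variable [FiniteDimensional ℝ E] [CompleteSpace E] {cov : Connection E M}

section Curves

variable {C : Set M} {F : M → ℝ} {γ : ℝ → M}

omit [FiniteDimensional ℝ E] [CompleteSpace E] in
theorem IsSelfConcordant.hasDerivAt_comp {σ : ℝ} (hF : IsSelfConcordant cov σ C F)
    (hγ : IsGeodesic cov γ) {s : ℝ} (hs : γ s ∈ C) :
    HasDerivAt (fun s ↦ F (γ s)) (diff F (γ s) (velocity (E := E) γ s)) s :=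
  hasDerivAt_comp_curve hγ.1
    (ContMDiffAt.mdifferentiableAt (hF.contMDiffAt hs (n := 1) (WithTop.coe_le_coe.2 le_top))
      one_ne_zero)

omit [CompleteSpace E] in
theorem IsSelfConcordant.hasDerivAt_diff {σ : ℝ} (hF : IsSelfConcordant cov σ C F)
    (hγ : IsGeodesic cov γ) {s : ℝ} (hs : γ s ∈ C) :
    HasDerivAt (fun s ↦ diff F (γ s) (velocity (E := E) γ s))
      (hess cov F (γ s) (velocity γ s) (velocity γ s)) s :=
  hγ.hasDerivAt_diff (hF.contMDiffAt hs (WithTop.coe_le_coe.2 le_top))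

omit [CompleteSpace E] in
theorem IsSelfConcordant.hasDerivAt_hess [T2Space M] (hcov : cov.ContMDiffCovariantDerivative ∞)
    {σ : ℝ} (hF : IsSelfConcordant cov σ C F) (hγ : IsGeodesic cov γ) {s : ℝ} (hs : γ s ∈ C) :
    HasDerivAt (fun s ↦ hess (E := E) cov F (γ s) (velocity γ s) (velocity γ s))
      (covHess cov F (γ s) (velocity γ s) (velocity γ s) (velocity γ s)) s :=
  hγ.hasDerivAt_hess hcov (hF.contMDiffAt hs (WithTop.coe_le_coe.2 le_top))

theorem IsSelfConcordant.sqrt_hess_le [T2Space M] (hcov : cov.ContMDiffCovariantDerivative ∞)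
    (htor : cov.torsion = 0) (hF : IsSelfConcordant cov 1 C F) (hγ : IsGeodesic cov γ)
    {D : Set ℝ} (hD : Convex ℝ D) (h0 : 0 ∈ D) (hD0 : ∀ s ∈ D, 0 ≤ s) (hDC : ∀ s ∈ D, γ s ∈ C)
    {s : ℝ} (hs : s ∈ D)
    (hs1 : s * √(hess (E := E) cov F (γ 0) (velocity γ 0) (velocity γ 0)) < 1) :
    √(hess (E := E) cov F (γ s) (velocity γ s) (velocity γ s)) ≤
      √(hess (E := E) cov F (γ 0) (velocity γ 0) (velocity γ 0)) /
        (1 - s * √(hess (E := E) cov F (γ 0) (velocity γ 0) (velocity γ 0))) :=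
  sqrt_le_of_deriv_le (P := fun s ↦ hess (E := E) cov F (γ s) (velocity γ s) (velocity γ s))
    hD h0 hD0 (fun r hr ↦ hF.hasDerivAt_hess hcov hγ (hDC r hr))
    (fun r hr ↦ (hF.isInner htor (hDC r hr)).nonneg _)
    (fun r hr ↦ (le_abs_self _).trans (by
      simpa using hF.bound _ (hDC r hr) (velocity γ r) (velocity γ r))) hs hs1

/-- The open unit ball of the local norm is mapped into the domain by the exponential map. -/
theorem IsSelfConcordant.mem_of_sqrt_hess_lt_one [T2Space M]
    (hcov : cov.ContMDiffCovariantDerivative ∞) (htor : cov.torsion = 0)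
    (hF : IsSelfConcordant cov 1 C F) (hγ : IsGeodesic cov γ) (h0 : γ 0 ∈ C)
    (h1 : √(hess (E := E) cov F (γ 0) (velocity γ 0) (velocity γ 0)) < 1) :
    ∀ s ∈ Set.Icc (0 : ℝ) 1, γ s ∈ C := by
  refine forall_mem_of_closed_epigraph hF.isOpen hF.closed hγ.1.continuous h0
    fun S hS0 hS1 hSC ↦ ?_
  have hnn := Real.sqrt_nonneg (hess (E := E) cov F (γ 0) (velocity γ 0) (velocity γ 0))
  have hb := fun s (hs : s ∈ Set.Ico 0 S) ↦ hF.sqrt_hess_le hcov htor hγ (convex_Ico 0 S)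
    (Set.left_mem_Ico.2 hS0) (fun r hr ↦ hr.1) hSC hs (by nlinarith [hs.1, hs.2])
  set δ := √(hess (E := E) cov F (γ 0) (velocity γ 0) (velocity γ 0))
  -- Up to an exit time `S ≤ 1` the second derivative of `F ∘ γ` is at most `(δ / (1 - δ))²`, so `F
  -- ∘ γ` stays bounded above.
  refine ⟨_, fun s hs ↦ le_of_deriv_deriv_le (K := (δ / (1 - δ)) ^ 2) (by positivity)
    (fun r hr ↦ hF.hasDerivAt_comp hγ (hSC r hr)) (fun r hr ↦ hF.hasDerivAt_diff hγ (hSC r hr))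
    (fun r hr ↦ ?_) hs⟩
  rw [← Real.sq_sqrt ((hF.isInner htor (hSC r hr)).nonneg _)]
  refine pow_le_pow_left₀ (Real.sqrt_nonneg _) ((hb r hr).trans ?_) 2
  have h2 : 0 < 1 - δ := by linarith
  exact div_le_div_of_nonneg_left hnn h2 (by nlinarith [hr.1, hr.2])

/-- The squared dual norm `N` of `newtonCovector` vanishes at time `0` by the Newton equation `hN`,
and at time `1` it is that of `Df`. Self-concordance bounds the two terms of `N'` by `4 (1 - s) P
√N` and `2 √P N`; the first contains `∇HF(γ', γ', w)` and needs the polarized bound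
`covHess_apply_le`. -/
theorem IsSelfConcordant.diffNorm_newton_le [T2Space M]
    (hcov : cov.ContMDiffCovariantDerivative ∞) (htor : cov.torsion = 0)
    (hF : IsSelfConcordant cov 1 C F) {f : M → ℝ} (hf : ContMDiffOn 𝓘(ℝ, E) 𝓘(ℝ, ℝ) ∞ f C)
    (hfF : ∀ x ∈ C, ∀ u v : TangentSpace 𝓘(ℝ, E) x, hess cov f x u v = hess cov F x u v)
    (hγ : IsGeodesic cov γ) (h0 : γ 0 ∈ C) {δ : ℝ}
    (hδ : √(hess (E := E) cov F (γ 0) (velocity γ 0) (velocity γ 0)) ≤ δ) (hδ1 : δ < 1)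
    (hN : ∀ v : TangentSpace 𝓘(ℝ, E) (γ 0),
      diff f (γ 0) v + hess cov F (γ 0) (velocity γ 0) v = 0) :
    diffNorm cov F f (γ 1) ≤ (δ / (1 - δ)) ^ 2 := by
  have hC := hF.mem_of_sqrt_hess_lt_one hcov htor hγ h0 (hδ.trans_lt hδ1)
  have hδ0 : 0 ≤ δ := (Real.sqrt_nonneg _).trans hδ
  have h01 := Set.left_mem_Icc.2 (zero_le_one' ℝ)
  have key := sqrt_le_of_newton_deriv_le hδ0 hδ1
    (P := fun s ↦ hess (E := E) cov F (γ s) (velocity γ s) (velocity γ s))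
    (N := fun s ↦ hess cov F (γ s) (newtonVector cov f F γ s) (newtonVector cov f F γ s))
    (fun s hs ↦ ?_) (fun s hs ↦ (hF.isInner htor (hC s hs)).nonneg _)
    (fun s hs ↦ hasDerivAt_hess_newtonVector hcov htor hF hf hfF hγ (hC s hs))
    (fun s hs ↦ (hF.isInner htor (hC s hs)).nonneg _) (fun s hs ↦ ?_) ?_
  · refine le_trans (le_of_eq ?_) key
    have h1 : newtonCovector (E := E) cov f F γ 1 = diff f (γ 1) := by
      funext v
      simp [newtonCovector]
    simp only [newtonVector, h1]
    rfl
  · have h1 : s * δ < 1 := by nlinarith [hs.1, hs.2]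
    have h2 : s * √(hess (E := E) cov F (γ 0) (velocity γ 0) (velocity γ 0)) ≤ s * δ :=
      mul_le_mul_of_nonneg_left hδ hs.1
    refine (hF.sqrt_hess_le hcov htor hγ (convex_Icc 0 1) h01 (fun r hr ↦ hr.1) hC hs
      (h2.trans_lt h1)).trans ?_
    exact div_le_div₀ hδ0 hδ (by linarith) (by linarith)
  · have hx := hC s hs
    have hI := hF.isInner htor hx
    have h1 := hF.covHess_apply_le hcov htor hx (velocity γ s) (velocity γ s)
      (newtonVector cov f F γ s)
    have h2 := (abs_le.1 (hF.bound _ hx (newtonVector cov f F γ s) (velocity γ s))).1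
    have h3 := Real.mul_self_sqrt (hI.nonneg (velocity γ s))
    rw [mul_assoc 2, h3] at h1
    have h4 := mul_le_mul_of_nonneg_left h1 (by linarith [hs.2] : 0 ≤ 2 * (1 - s))
    linarith
  · have h1 := hess_newtonVector (f := f) (hF.isInner htor h0) (newtonVector cov f F γ 0)
    rw [h1, newtonCovector, sub_zero, one_mul, hN]

end Curves

end SelfConcordance

/-! ### Affine functions, the path objective and one step of the method. -/

section AffineFunctions


variable {E : Type*} [NormedAddCommGroup E] [NormedSpace ℝ E]
  {M : Type*} [TopologicalSpace M] [ChartedSpace E M] [IsManifold 𝓘(ℝ, E) ∞ M]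

variable [FiniteDimensional ℝ E] [CompleteSpace E] {cov : Connection E M}

omit [FiniteDimensional ℝ E] [CompleteSpace E] in
theorem IsGeodesicFrom.induction {P : ∀ x : M, TangentSpace 𝓘(ℝ, E) x → M → Prop} {γ : ℝ → M}
    (h : P (γ 0) (velocity γ 0) (γ 1)) {x : M} {u : TangentSpace 𝓘(ℝ, E) x}
    (hγ : IsGeodesicFrom cov x u γ) : P x u (γ 1) := by
  have h1 := hγ.2
  generalize velocity (E := E) γ 0 = w at h h1
  rw [TotalSpace.mk.injEq] at h1
  obtain ⟨rfl, h2⟩ := h1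
  rw [← eq_of_heq h2]
  exact h

/-- To prove a statement about tangent vectors and their exponentials, it suffices to prove it for
velocities of geodesics. -/
theorem IsAdmissible.expMap_induction (hcov : IsAdmissible cov)
    {P : ∀ x : M, TangentSpace 𝓘(ℝ, E) x → M → Prop}
    (h : ∀ γ : ℝ → M, IsGeodesic cov γ → P (γ 0) (velocity γ 0) (γ 1)) (x : M)
    (u : TangentSpace 𝓘(ℝ, E) x) : P x u (expMap cov x u) := by
  have h1 := hcov.complete x u
  rw [expMap, dif_pos h1]
  exact h1.choose_spec.induction (h _ h1.choose_spec.1)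

theorem IsAdmissible.exists_geodesic (hcov : IsAdmissible cov) (x y : M) :
    ∃ γ : ℝ → M, IsGeodesic cov γ ∧ γ 0 = x ∧ γ 1 = y := by
  obtain ⟨u, rfl⟩ := hcov.exp_surjective x y
  exact hcov.expMap_induction (P := fun x u y ↦ ∃ γ : ℝ → M, IsGeodesic cov γ ∧ γ 0 = x ∧ γ 1 = y)
    (fun γ hγ ↦ ⟨γ, hγ, rfl, rfl⟩) x u

section Affine

variable {Q : Set M} {ℓ : M → ℝ}

omit [FiniteDimensional ℝ E] [CompleteSpace E] in
theorem IsAffineOn.contMDiffAt (hℓ : IsAffineOn cov Q ℓ) {x : M} (hx : x ∈ interior Q) {n : ℕ∞ω}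
    (hn : n ≤ ∞) : ContMDiffAt 𝓘(ℝ, E) 𝓘(ℝ, ℝ) n ℓ x :=
  ((hℓ.smooth x hx).contMDiffAt (isOpen_interior.mem_nhds hx)).of_le hn

omit [FiniteDimensional ℝ E] [CompleteSpace E] in
theorem IsAffineOn.hasDerivAt_comp (hℓ : IsAffineOn cov Q ℓ) {γ : ℝ → M} (hγ : IsGeodesic cov γ)
    {s : ℝ} (hs : γ s ∈ interior Q) :
    HasDerivAt (fun s ↦ ℓ (γ s)) (diff ℓ (γ s) (velocity (E := E) γ s)) s :=
  hasDerivAt_comp_curve hγ.1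
    (ContMDiffAt.mdifferentiableAt (hℓ.contMDiffAt hs (n := 1) (WithTop.coe_le_coe.2 le_top))
      one_ne_zero)

/-- `Dℓ(γ')` is constant along a geodesic, and its derivative is the Hessian on the diagonal.
Symmetry and polarization give the rest. -/
theorem IsAffineOn.hess_eq_zero (hℓ : IsAffineOn cov Q ℓ) (hcov : IsAdmissible cov) {x : M}
    (hx : x ∈ interior Q) (u v : TangentSpace 𝓘(ℝ, E) x) : hess cov ℓ x u v = 0 := by
  have hH := isSymmBilin_hess hcov.torsionFree
    (hℓ.contMDiffAt hx (n := 2) (WithTop.coe_le_coe.2 le_top))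
  have hdiag : ∀ u : TangentSpace 𝓘(ℝ, E) x, hess cov ℓ x u u = 0 := by
    intro u
    refine hcov.expMap_induction
      (P := fun x u _ ↦ x ∈ interior Q → hess cov ℓ x u u = 0) (fun γ hγ h0 ↦ ?_) x u hx
    obtain ⟨r, hr, hball⟩ := Metric.nhds_basis_closedBall.mem_iff.1
      ((isOpen_interior.preimage hγ.1.continuous).mem_nhds h0)
    rw [Real.closedBall_eq_Icc, zero_sub, zero_add] at hball
    obtain ⟨c, d, hcd⟩ := hℓ.affine γ hγ (-r) r fun s hs ↦ interior_subset (hball hs)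
    have h1 : ∀ᶠ s in 𝓝 (0 : ℝ), diff ℓ (γ s) (velocity (E := E) γ s) = d := by
      filter_upwards [Ioo_mem_nhds (neg_neg_of_pos hr) hr] with s hs
      refine (hℓ.hasDerivAt_comp hγ (hball (Set.Ioo_subset_Icc_self hs))).unique ?_
      have h2 : HasDerivAt (fun s ↦ c + d * s) d s := by
        simpa using ((hasDerivAt_id s).const_mul d).const_add c
      refine h2.congr_of_eventuallyEq ?_
      filter_upwards [Ioo_mem_nhds hs.1 hs.2] with q hq
      exact hcd q (Set.Ioo_subset_Icc_self hq)
    exact (hγ.hasDerivAt_diff (hℓ.contMDiffAt h0 (WithTop.coe_le_coe.2 le_top))).unique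
      ((hasDerivAt_const 0 d).congr_of_eventuallyEq h1)
  have h1 := hdiag (u + v)
  rw [hH.add_left, hH.add_right, hH.add_right, hdiag, hdiag, hH.symm v u] at h1
  linarith

-- The end point may lie on the boundary of `Q`. The affine formula is known only on `[0, 1]`, so
-- the slope is identified through the one-sided derivative at `0`.
omit [FiniteDimensional ℝ E] [CompleteSpace E] in
theorem IsAffineOn.apply_geodesic (hℓ : IsAffineOn cov Q ℓ) (hQ : GeodConvex cov Q) {γ : ℝ → M}
    (hγ : IsGeodesic cov γ) (h0 : γ 0 ∈ interior Q) (h1 : γ 1 ∈ Q) {s : ℝ}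
    (hs : s ∈ Set.Icc (0 : ℝ) 1) :
    ℓ (γ s) = ℓ (γ 0) + diff ℓ (γ 0) (velocity (E := E) γ 0) * s := by
  obtain ⟨c, d, hcd⟩ := hℓ.affine γ hγ 0 1 (hQ γ hγ 0 1 (interior_subset h0) h1)
  have h2 : HasDerivWithinAt (fun s ↦ c + d * s) d (Set.Icc 0 1) 0 := by
    simpa using (((hasDerivAt_id 0).const_mul d).const_add c).hasDerivWithinAt
  have h3 := h2.congr hcd (hcd 0 (by simp))
  have h4 := (uniqueDiffOn_Icc zero_lt_one 0 (by simp)).eq_deriv _ h3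
    (hℓ.hasDerivAt_comp hγ h0).hasDerivWithinAt
  rw [← h4, hcd s hs, hcd 0 (by simp)]
  ring

/-- Every point of `Q` is joined to `x` by a geodesic, along which `ℓ` has slope `Dℓ_x`; if that
vanished, `ℓ` would be constant. -/
theorem IsAffineOn.exists_diff_ne_zero (hℓ : IsAffineOn cov Q ℓ) (hcov : IsAdmissible cov)
    (hQ : GeodConvex cov Q) (hne : ∃ x ∈ Q, ∃ y ∈ Q, ℓ x ≠ ℓ y) {x : M} (hx : x ∈ interior Q) :
    ∃ u : TangentSpace 𝓘(ℝ, E) x, diff ℓ x u ≠ 0 := by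
  by_contra! hcon
  have key : ∀ y ∈ Q, ℓ y = ℓ x := by
    intro y hy
    obtain ⟨γ, hγ, rfl, rfl⟩ := hcov.exists_geodesic x y
    rw [hℓ.apply_geodesic hQ hγ hx hy (s := 1) (by simp), hcon, zero_mul, add_zero]
  obtain ⟨y, hy, z, hz, h⟩ := hne
  exact h ((key y hy).trans (key z hz).symm)

end Affine

section PathObj

variable {Q : Set M} {ℓ F : M → ℝ}

omit [FiniteDimensional ℝ E] [CompleteSpace E] in
theorem contMDiffOn_pathObj {σ : ℝ} (hℓ : IsAffineOn cov Q ℓ)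
    (hF : IsSelfConcordant cov σ (interior Q) F) (t : ℝ) :
    ContMDiffOn 𝓘(ℝ, E) 𝓘(ℝ, ℝ) ∞ (pathObj ℓ F t) (interior Q) :=
  (contMDiffOn_const.mul hℓ.smooth).add hF.smooth

theorem diff_pathObj (hcov : IsAdmissible cov) {σ : ℝ} (hℓ : IsAffineOn cov Q ℓ)
    (hF : IsSelfConcordant cov σ (interior Q) F) (t : ℝ) {x : M} (hx : x ∈ interior Q)
    (u : TangentSpace 𝓘(ℝ, E) x) :
    diff (pathObj ℓ F t) x u = t * diff ℓ x u + diff F x u := by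
  refine hcov.expMap_induction (P := fun x u _ ↦ x ∈ interior Q →
    diff (pathObj ℓ F t) x u = t * diff ℓ x u + diff F x u) (fun γ hγ h0 ↦ ?_) x u hx
  have h1 : ContMDiffAt 𝓘(ℝ, E) 𝓘(ℝ, ℝ) ∞ (pathObj ℓ F t) (γ 0) :=
    (contMDiffOn_pathObj hℓ hF t _ h0).contMDiffAt (isOpen_interior.mem_nhds h0)
  exact (hasDerivAt_comp_curve hγ.1 (h1.mdifferentiableAt (by simp))).unique
    (((hℓ.hasDerivAt_comp hγ h0).const_mul t).add (hF.hasDerivAt_comp hγ h0))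

theorem hess_pathObj (hcov : IsAdmissible cov) {σ : ℝ} (hℓ : IsAffineOn cov Q ℓ)
    (hF : IsSelfConcordant cov σ (interior Q) F) (t : ℝ) {x : M} (hx : x ∈ interior Q)
    (u v : TangentSpace 𝓘(ℝ, E) x) : hess cov (pathObj ℓ F t) x u v = hess cov F x u v := by
  have hsm : ∀ y ∈ interior Q, ContMDiffAt 𝓘(ℝ, E) 𝓘(ℝ, ℝ) 2 (pathObj ℓ F t) y := fun y hy ↦
    ((contMDiffOn_pathObj hℓ hF t _ hy).contMDiffAt (isOpen_interior.mem_nhds hy)).of_le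
      (WithTop.coe_le_coe.2 le_top)
  have hdiag : ∀ u : TangentSpace 𝓘(ℝ, E) x,
      hess cov (pathObj ℓ F t) x u u = hess cov F x u u := by
    intro u
    refine hcov.expMap_induction (P := fun x u _ ↦ x ∈ interior Q →
      hess cov (pathObj ℓ F t) x u u = hess cov F x u u) (fun γ hγ h0 ↦ ?_) x u hx
    have h1 : ∀ᶠ s in 𝓝 (0 : ℝ), diff (pathObj ℓ F t) (γ s) (velocity (E := E) γ s) =
        t * diff ℓ (γ s) (velocity (E := E) γ s) + diff F (γ s) (velocity (E := E) γ s) := by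
      filter_upwards [(isOpen_interior.preimage hγ.1.continuous).mem_nhds h0] with s hs
      exact diff_pathObj hcov hℓ hF t hs _
    have h2 := (hγ.hasDerivAt_diff (hℓ.contMDiffAt h0 (WithTop.coe_le_coe.2 le_top))).const_mul t
    have h3 := (h2.add (hF.hasDerivAt_diff hγ h0)).congr_of_eventuallyEq h1
    rw [(hγ.hasDerivAt_diff (hsm _ h0)).unique h3, hℓ.hess_eq_zero hcov h0, mul_zero, zero_add]
  have hH := isSymmBilin_hess hcov.torsionFree (hsm x hx)
  have hH' := isSymmBilin_hess hcov.torsionFree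
    (hF.contMDiffAt hx (n := 2) (WithTop.coe_le_coe.2 le_top))
  have h1 := hdiag (u + v)
  rw [hH.add_left, hH.add_right, hH.add_right, hH'.add_left, hH'.add_right, hH'.add_right, hdiag,
    hdiag, hH.symm v u, hH'.symm v u] at h1
  linarith

end PathObj

section Step

variable {Q : Set M} {ℓ F : M → ℝ}

theorem diffNorm_pathObj_add_le (hcov : IsAdmissible cov) {σ : ℝ} (hℓ : IsAffineOn cov Q ℓ)
    (hF : IsSelfConcordant cov σ (interior Q) F) (t : ℝ) {a : ℝ} (ha : 0 ≤ a) {x : M}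
    (hx : x ∈ interior Q) :
    diffNorm cov F (pathObj ℓ F (t + a)) x ≤
      diffNorm cov F (pathObj ℓ F t) x + a * diffNorm cov F ℓ x := by
  have : FiniteDimensional ℝ (TangentSpace 𝓘(ℝ, E) x) := ‹FiniteDimensional ℝ E›
  have hI := hF.isInner hcov.torsionFree hx
  have h1 := hI.dualNorm_add_le (diff (E := E) (pathObj ℓ F t) x).toLinearMap
    (a • (diff (E := E) ℓ x).toLinearMap)
  have h2 := hI.dualNorm_smul ha (diff (E := E) ℓ x).toLinearMap
  have h3 : (fun v ↦ (diff (E := E) (pathObj ℓ F t) x).toLinearMap v +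
      (a • (diff (E := E) ℓ x).toLinearMap) v) = diff (E := E) (pathObj ℓ F (t + a)) x := by
    funext v
    rw [diff_pathObj hcov hℓ hF (t + a) hx]
    change diff (pathObj ℓ F t) x v + a * diff ℓ x v = _
    rw [diff_pathObj hcov hℓ hF t hx]
    ring
  rw [h3] at h1
  have h4 : dualNorm (hess cov F x) ⇑(a • (diff (E := E) ℓ x).toLinearMap) =
    a * diffNorm cov F ℓ x := h2
  rw [h4] at h1
  exact h1

theorem diffNorm_affine_pos (hcov : IsAdmissible cov) {σ : ℝ} (hℓ : IsAffineOn cov Q ℓ)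
    (hF : IsSelfConcordant cov σ (interior Q) F) (hQ : GeodConvex cov Q)
    (hne : ∃ x ∈ Q, ∃ y ∈ Q, ℓ x ≠ ℓ y) {x : M} (hx : x ∈ interior Q) :
    0 < diffNorm cov F ℓ x := by
  have : FiniteDimensional ℝ (TangentSpace 𝓘(ℝ, E) x) := ‹FiniteDimensional ℝ E›
  obtain ⟨u, hu⟩ := hℓ.exists_diff_ne_zero hcov hQ hne hx
  exact (hF.isInner hcov.torsionFree hx).dualNorm_pos (p := (diff (E := E) ℓ x).toLinearMap) hu

theorem diffNorm_expMap_newtonDir_le [T2Space M] (hcov : IsAdmissible cov)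
    (hℓ : IsAffineOn cov Q ℓ) (hF : IsSelfConcordant cov 1 (interior Q) F) (t : ℝ) {x : M}
    (hx : x ∈ interior Q) {δ : ℝ} (hδ : diffNorm cov F (pathObj ℓ F t) x ≤ δ) (hδ1 : δ < 1) :
    expMap cov x (newtonDir cov (pathObj ℓ F t) x) ∈ interior Q ∧
      diffNorm cov F (pathObj ℓ F t) (expMap cov x (newtonDir cov (pathObj ℓ F t) x)) ≤
        (δ / (1 - δ)) ^ 2 := by
  have : FiniteDimensional ℝ (TangentSpace 𝓘(ℝ, E) x) := ‹FiniteDimensional ℝ E›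
  have hI := hF.isInner hcov.torsionFree hx
  have hHess : hess cov (pathObj ℓ F t) x = hess cov F x := by
    funext u v
    exact hess_pathObj hcov hℓ hF t hx u v
  have hN : ∀ v, diff (pathObj ℓ F t) x v +
      hess cov F x (newtonDir cov (pathObj ℓ F t) x) v = 0 := by
    intro v
    rw [newtonDir, hHess, hI.neg_left]
    have h1 := hI.formInv_apply (diff (E := E) (pathObj ℓ F t) x).toLinearMap v
    have h2 : hess cov F x (formInv (hess cov F x) (diff (E := E) (pathObj ℓ F t) x)) v =
      diff (E := E) (pathObj ℓ F t) x v := h1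
    rw [h2, add_neg_cancel]
  have hle : √(hess cov F x (newtonDir cov (pathObj ℓ F t) x)
      (newtonDir cov (pathObj ℓ F t) x)) ≤ δ := by
    rw [newtonDir, hHess, hI.neg_left, hI.neg_right, neg_neg]
    exact hδ
  -- `expMap_induction` needs an arbitrary tangent vector; of the Newton direction only its equation
  -- and its length bound are kept.
  revert hx hN hle
  generalize newtonDir cov (pathObj ℓ F t) x = u
  intro hx hN hle
  refine hcov.expMap_induction (P := fun x u y ↦ x ∈ interior Q →
    (∀ v, diff (pathObj ℓ F t) x v + hess cov F x u v = 0) → √(hess cov F x u u) ≤ δ →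
    y ∈ interior Q ∧ diffNorm cov F (pathObj ℓ F t) y ≤ (δ / (1 - δ)) ^ 2)
    (fun γ hγ h0 hN hle ↦ ⟨?_, ?_⟩) x u hx hN hle
  · exact hF.mem_of_sqrt_hess_lt_one hcov.smooth hcov.torsionFree hγ h0 (hle.trans_lt hδ1) 1
      (by simp)
  · exact hF.diffNorm_newton_le hcov.smooth hcov.torsionFree (contMDiffOn_pathObj hℓ hF t)
      (fun y hy u v ↦ hess_pathObj hcov hℓ hF t hy u v) hγ h0 hle hδ1 hN

/-- The change of `t` is scaled to add at most `α` to the dual norm, so the Newton step starts with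
`δ = √β / (1 + √β)`. Then `δ / (1 - δ) = √β`, whose square is `β`. -/
theorem nextX_mem [T2Space M] {β : ℝ} (hβ₀ : 0 < β) (hβ : β < √β / (1 + √β))
    (hcov : IsAdmissible cov) (hℓ : IsAffineOn cov Q ℓ)
    (hF : IsSelfConcordant cov 1 (interior Q) F) (hQ : GeodConvex cov Q)
    (hne : ∃ x ∈ Q, ∃ y ∈ Q, ℓ x ≠ ℓ y) {x : M} (hx : x ∈ interior Q) {t : ℝ}
    (hxt : diffNorm cov F (pathObj ℓ F t) x ≤ β) :
    nextX cov β ℓ F x t ∈ interior Q ∧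
      diffNorm cov F (pathObj ℓ F (nextT cov β ℓ F x t)) (nextX cov β ℓ F x t) ≤ β := by
  have hpos := diffNorm_affine_pos hcov hℓ hF hQ hne hx
  have hα : 0 < stepConst β := sub_pos.2 hβ
  have h1 := diffNorm_pathObj_add_le hcov hℓ hF t (div_nonneg hα.le hpos.le) hx
  rw [div_mul_cancel₀ _ hpos.ne'] at h1
  have hs := Real.sqrt_pos.2 hβ₀
  have h2 : diffNorm cov F (pathObj ℓ F (nextT cov β ℓ F x t)) x ≤ √β / (1 + √β) := by
    refine h1.trans ?_
    rw [stepConst]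
    linarith
  have h3 : √β / (1 + √β) < 1 := by
    rw [div_lt_one (by positivity)]
    linarith
  have h4 := diffNorm_expMap_newtonDir_le hcov hℓ hF (nextT cov β ℓ F x t) hx h2 h3
  have h5 : (√β / (1 + √β) / (1 - √β / (1 + √β))) ^ 2 = β := by
    have h6 : √β / (1 + √β) / (1 - √β / (1 + √β)) = √β := by
      have : (1 : ℝ) + √β ≠ 0 := by positivity
      field_simp
      ring
    rw [h6, Real.sq_sqrt hβ₀.le]
  rw [h5] at h4
  exact h4

/-- The barrier inequality is tested on the maximizer `u = HF⁻¹ DF`, where its left side is the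
squared dual norm of `DF`. -/
theorem IsSelfConcordantBarrier.diffNorm_le {ν : ℝ} {C : Set M}
    (hF : IsSelfConcordantBarrier cov ν C F) (hcov : IsAdmissible cov) {x : M} (hx : x ∈ C) :
    diffNorm cov F F x ≤ √ν := by
  have : FiniteDimensional ℝ (TangentSpace 𝓘(ℝ, E) x) := ‹FiniteDimensional ℝ E›
  have hI := hF.selfConcordant.isInner hcov.torsionFree hx
  have h1 := hF.barrier x hx (formInv (hess cov F x) (diff F x))
  have h2 : hess cov F x (formInv (hess cov F x) (diff F x)) _ = diff F x _ :=
    hI.formInv_apply (diff (E := E) F x).toLinearMap (formInv (hess cov F x) (diff F x))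
  refine Real.sqrt_le_sqrt ?_
  linarith

theorem IsSelfConcordantBarrier.diff_le {ν : ℝ} {C : Set M}
    (hF : IsSelfConcordantBarrier cov ν C F) (hcov : IsAdmissible cov) {x : M} (hx : x ∈ C)
    (u : TangentSpace 𝓘(ℝ, E) x) : diff F x u ≤ √ν * √(hess cov F x u u) := by
  have : FiniteDimensional ℝ (TangentSpace 𝓘(ℝ, E) x) := ‹FiniteDimensional ℝ E›
  have hI := hF.selfConcordant.isInner hcov.torsionFree hx
  exact (hI.apply_le_dualNorm (diff (E := E) F x).toLinearMap u).trans
    (mul_le_mul_of_nonneg_right (hF.diffNorm_le hcov hx) (Real.sqrt_nonneg _))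

/-- `t Dℓ = Df_t - DF`, with dual norms at most `β` and `√ν` on the right. -/
theorem diffNorm_affine_le (hcov : IsAdmissible cov) {ν : ℝ} (hℓ : IsAffineOn cov Q ℓ)
    (hF : IsSelfConcordantBarrier cov ν (interior Q) F) {x : M} (hx : x ∈ interior Q) {t β : ℝ}
    (ht : 0 < t) (hxt : diffNorm cov F (pathObj ℓ F t) x ≤ β) :
    diffNorm cov F ℓ x ≤ 1 / t * (β + √ν) := by
  have : FiniteDimensional ℝ (TangentSpace 𝓘(ℝ, E) x) := ‹FiniteDimensional ℝ E›
  have hI := hF.selfConcordant.isInner hcov.torsionFree hx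
  have h1 := hI.dualNorm_add_le (diff (E := E) (pathObj ℓ F t) x).toLinearMap
    (-(diff (E := E) F x).toLinearMap)
  have h2 := hI.dualNorm_neg (diff (E := E) F x).toLinearMap
  have h3 : (fun v ↦ (diff (E := E) (pathObj ℓ F t) x).toLinearMap v +
      (-(diff (E := E) F x).toLinearMap) v) = fun v ↦ t * (diff (E := E) ℓ x).toLinearMap v := by
    funext v
    change diff (pathObj ℓ F t) x v + -diff F x v = t * diff ℓ x v
    rw [diff_pathObj hcov hℓ hF.selfConcordant t hx]
    ring
  have h4 : dualNorm (hess cov F x) ⇑(-(diff (E := E) F x).toLinearMap) = diffNorm cov F F x := h2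
  rw [h3, hI.dualNorm_smul ht.le, h4] at h1
  have h5 := hF.diffNorm_le hcov hx
  have h6 : t * diffNorm cov F ℓ x ≤ β + √ν := h1.trans (add_le_add hxt h5)
  rw [one_div, ← div_eq_inv_mul, le_div_iff₀ ht]
  linarith

theorem le_nextT (hcov : IsAdmissible cov) {ν : ℝ} (hℓ : IsAffineOn cov Q ℓ)
    (hF : IsSelfConcordantBarrier cov ν (interior Q) F) (hQ : GeodConvex cov Q)
    (hne : ∃ x ∈ Q, ∃ y ∈ Q, ℓ x ≠ ℓ y) {x : M} (hx : x ∈ interior Q) {t β : ℝ}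
    (hβ : β < √β / (1 + √β)) (ht : 0 < t) (hxt : diffNorm cov F (pathObj ℓ F t) x ≤ β) :
    (1 + stepConst β / (β + √ν)) * t ≤ nextT cov β ℓ F x t := by
  have hpos := diffNorm_affine_pos hcov hℓ hF.selfConcordant hQ hne hx
  have hα : 0 < stepConst β := sub_pos.2 hβ
  have h1 := diffNorm_affine_le hcov hℓ hF hx ht hxt
  have h2 := div_le_div_of_nonneg_left hα.le hpos h1
  rw [nextT, add_mul, one_mul]
  refine add_le_add_right (le_trans (le_of_eq ?_) h2) t
  rw [one_div, ← div_eq_inv_mul, div_div_eq_mul_div, mul_div_right_comm]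

end Step

end AffineFunctions

/-! ### Comparison of nearby geodesics in a chart. -/

section GeodesicFlow


section ODE

variable {E : Type*} [NormedAddCommGroup E] [NormedSpace ℝ E]

/-- Two solutions of a second order equation `c'' = g(c, c')` that start at the same point with
velocities `w₁`, `w₂` are `t (w₁ - w₂)` apart at time `t`, up to a small error. -/
theorem norm_sub_sub_smul_le {X : E × E → E × E} {S : Set (E × E)} {K : NNReal}
    (hX : LipschitzOnWith K X S) {z₁ z₂ : ℝ → E × E} {T : ℝ} (hKT : K * T ≤ 1 / 8)
    (h₁ : ∀ t ∈ Set.Icc 0 T, HasDerivAt z₁ (X (z₁ t)) t)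
    (h₂ : ∀ t ∈ Set.Icc 0 T, HasDerivAt z₂ (X (z₂ t)) t)
    (hS₁ : ∀ t ∈ Set.Icc 0 T, z₁ t ∈ S) (hS₂ : ∀ t ∈ Set.Icc 0 T, z₂ t ∈ S)
    (hX₁ : ∀ z, (X z).1 = z.2) (h0 : (z₁ 0).1 = (z₂ 0).1) {t : ℝ} (ht : t ∈ Set.Icc 0 T) :
    ‖(z₁ t).1 - (z₂ t).1 - t • ((z₁ 0).2 - (z₂ 0).2)‖ ≤ t / 4 * ‖(z₁ 0).2 - (z₂ 0).2‖ := by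
  have hT : 0 ≤ T := ht.1.trans ht.2
  have h00 : (0 : ℝ) ∈ Set.Icc 0 T := ⟨le_rfl, hT⟩
  set d := ‖(z₁ 0).2 - (z₂ 0).2‖ with hd
  have hd0 : 0 ≤ d := norm_nonneg _
  have hdist : dist (z₁ 0) (z₂ 0) ≤ d := by
    rw [dist_eq_norm, Prod.norm_def]
    refine max_le ?_ le_rfl
    rw [Prod.fst_sub, h0, sub_self, norm_zero]
    exact hd0
  -- Grönwall's factor is at most `exp (1/8) ≤ 2`.
  have hgron : ∀ r ∈ Set.Icc 0 T, ‖z₁ r - z₂ r‖ ≤ 2 * d := by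
    intro r hr
    have h3 := dist_le_of_trajectories_ODE_of_mem (v := fun _ ↦ X) (s := fun _ ↦ S) (K := K)
      (fun _ _ ↦ hX) (fun q hq ↦ (h₁ q hq).continuousAt.continuousWithinAt)
      (fun q hq ↦ (h₁ q (Set.Ico_subset_Icc_self hq)).hasDerivWithinAt)
      (fun q hq ↦ hS₁ q (Set.Ico_subset_Icc_self hq))
      (fun q hq ↦ (h₂ q hq).continuousAt.continuousWithinAt)
      (fun q hq ↦ (h₂ q (Set.Ico_subset_Icc_self hq)).hasDerivWithinAt)
      (fun q hq ↦ hS₂ q (Set.Ico_subset_Icc_self hq)) hdist r hr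
    rw [dist_eq_norm] at h3
    refine h3.trans ?_
    have h4 : Real.exp (K * (r - 0)) ≤ 2 := by
      have h5 : (K : ℝ) * (r - 0) ≤ 1 / 8 := by
        rw [sub_zero]
        exact (mul_le_mul_of_nonneg_left hr.2 K.2).trans hKT
      refine (Real.exp_le_exp.2 h5).trans ?_
      have h6 := Real.exp_bound' (x := 1 / 8) (by norm_num) (by norm_num) (n := 1) (by norm_num)
      norm_num at h6
      linarith
    nlinarith
  have hLip : ∀ r ∈ Set.Icc 0 T, ‖X (z₁ r) - X (z₂ r)‖ ≤ K * (2 * d) := fun r hr ↦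
    ((hX.norm_sub_le (hS₁ r hr) (hS₂ r hr))).trans
      (mul_le_mul_of_nonneg_left (hgron r hr) K.2)
  have hfst : ∀ {z : ℝ → E × E}, (∀ q ∈ Set.Icc 0 T, HasDerivAt z (X (z q)) q) →
      ∀ q ∈ Set.Icc 0 T, HasDerivAt (fun q ↦ (z q).1) (X (z q)).1 q := fun h q hq ↦
    (ContinuousLinearMap.fst ℝ E E).hasFDerivAt.comp_hasDerivAt q (h q hq)
  have hsnd : ∀ {z : ℝ → E × E}, (∀ q ∈ Set.Icc 0 T, HasDerivAt z (X (z q)) q) →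
      ∀ q ∈ Set.Icc 0 T, HasDerivAt (fun q ↦ (z q).2) (X (z q)).2 q := fun h q hq ↦
    (ContinuousLinearMap.snd ℝ E E).hasFDerivAt.comp_hasDerivAt q (h q hq)
  -- The velocity difference changes by at most `K * (2 * d) * r ≤ d / 4`; integrating once more
  -- gives the claim.
  have hv : ∀ r ∈ Set.Icc 0 T, ‖(z₁ r).2 - (z₂ r).2 - ((z₁ 0).2 - (z₂ 0).2)‖ ≤ 1 / 4 * d := by
    intro r hr
    have h3 := (convex_Icc 0 T).norm_image_sub_le_of_norm_hasDerivWithin_le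
      (f := fun q ↦ (z₁ q).2 - (z₂ q).2) (f' := fun q ↦ (X (z₁ q)).2 - (X (z₂ q)).2)
      (fun q hq ↦ ((hsnd h₁ q hq).sub (hsnd h₂ q hq)).hasDerivWithinAt)
      (fun q hq ↦ (norm_snd_le (X (z₁ q) - X (z₂ q))).trans (hLip q hq)) h00 hr
    refine h3.trans ?_
    rw [sub_zero, Real.norm_of_nonneg hr.1]
    have h4 : (K : ℝ) * r ≤ 1 / 8 := (mul_le_mul_of_nonneg_left hr.2 K.2).trans hKT
    nlinarith
  have h3 := (convex_Icc 0 t).norm_image_sub_le_of_norm_hasDerivWithin_le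
    (f := fun q ↦ (z₁ q).1 - (z₂ q).1 - q • ((z₁ 0).2 - (z₂ 0).2))
    (f' := fun q ↦ (X (z₁ q)).1 - (X (z₂ q)).1 - (1 : ℝ) • ((z₁ 0).2 - (z₂ 0).2)) (C := 1 / 4 * d)
    (fun q hq ↦ by
      have hq' : q ∈ Set.Icc 0 T := ⟨hq.1, hq.2.trans ht.2⟩
      exact (((hfst h₁ q hq').sub (hfst h₂ q hq')).sub
        ((hasDerivAt_id q).smul_const _)).hasDerivWithinAt)
    (fun q hq ↦ by
      rw [hX₁, hX₁, one_smul]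
      exact hv q ⟨hq.1, hq.2.trans ht.2⟩) (Set.left_mem_Icc.2 ht.1) (Set.right_mem_Icc.2 ht.1)
  simp only [h0, sub_self, zero_smul, sub_zero, Real.norm_of_nonneg ht.1] at h3
  linarith

/-- If `f` is `τ • id` up to a small Lipschitz error, then it maps balls onto neighbourhoods. -/
theorem image_ball_mem_nhds_of_approx_smul [CompleteSpace E] {f : E → E} {w₀ : E} {ρ τ : ℝ}
    (hρ : 0 < ρ) (hτ : 0 < τ)
    (hf : ∀ w ∈ Metric.ball w₀ ρ, ∀ w' ∈ Metric.ball w₀ ρ,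
      ‖f w - f w' - τ • (w - w')‖ ≤ τ / 4 * ‖w - w'‖) :
    f '' Metric.ball w₀ ρ ∈ 𝓝 (f w₀) := by
  -- After division by `τ` the map is a `1/4`-Lipschitz perturbation of the identity, so the inverse
  -- function theorem in its Lipschitz form applies.
  have happ : ApproximatesLinearOn (fun w ↦ τ⁻¹ • f w)
      (ContinuousLinearEquiv.refl ℝ E : E →L[ℝ] E) (Metric.ball w₀ ρ) (1 / 4) := by
    intro w hw w' hw'
    have h1 : τ⁻¹ • f w - τ⁻¹ • f w' - (ContinuousLinearEquiv.refl ℝ E : E →L[ℝ] E) (w - w') =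
        τ⁻¹ • (f w - f w' - τ • (w - w')) := by
      rw [smul_sub, smul_sub τ⁻¹ (f w), smul_smul, inv_mul_cancel₀ hτ.ne', one_smul]
      rfl
    rw [h1, norm_smul, norm_inv, Real.norm_of_nonneg hτ.le, ← div_eq_inv_mul, div_le_iff₀ hτ]
    refine (hf w hw w' hw').trans (le_of_eq ?_)
    push_cast
    ring
  have h2 := happ.image_mem_nhds (ContinuousLinearEquiv.refl ℝ E).toNonlinearRightInverse
    (Metric.ball_mem_nhds w₀ hρ) (by
      rcases subsingleton_or_nontrivial E with h | h
      · exact Or.inl h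
      · right
        have h3 : (ContinuousLinearEquiv.refl ℝ E).toNonlinearRightInverse.nnnorm = 1 := by
          change ‖(ContinuousLinearMap.id ℝ E)‖₊ = 1
          ext
          exact ContinuousLinearMap.norm_id
        rw [h3, inv_one, one_div]
        exact inv_lt_one_of_one_lt₀ (by norm_num))
  have h4 : (fun p ↦ τ⁻¹ • p) ⁻¹' ((fun w ↦ τ⁻¹ • f w) '' Metric.ball w₀ ρ) ∈ 𝓝 (f w₀) :=
    (continuous_const_smul τ⁻¹).continuousAt.preimage_mem_nhds h2
  refine Filter.mem_of_superset h4 ?_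
  rintro p ⟨w, hw, hwp⟩
  exact ⟨w, hw, smul_right_injective E (inv_ne_zero hτ.ne') hwp⟩

end ODE

variable {E : Type*} [NormedAddCommGroup E] [NormedSpace ℝ E]
  {M : Type*} [TopologicalSpace M] [ChartedSpace E M] [IsManifold 𝓘(ℝ, E) ∞ M]

section Flow

variable [FiniteDimensional ℝ E] {cov : Connection E M}

/-- The definition gives the geodesic equation at time `t` only in the chart at `γ t`. To pass to
the chart at `q` without the transformation law of Christoffel symbols, test with `f = l ∘ φ` for
linear `l`: the derivative of `Df(γ')` is the Hessian of `f`, which in the chart at `q` is `-l(Γ)`.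
-/
theorem IsGeodesic.hasDerivAt_velRep {γ : ℝ → M}
    (hγ : IsGeodesic cov γ) {q : M} {t : ℝ} (ht : γ t ∈ (chartAt E q).source) :
    HasDerivAt (velRep γ q) (-christoffel cov q (extChartAt 𝓘(ℝ, E) q (γ t)) (velRep γ q t)
      (velRep γ q t)) t := by
  have hd := ((contDiffAt_velRep hγ.1 ht).differentiableAt (by simp)).hasDerivAt
  refine hd.congr_deriv ?_
  refine (SeparatingDual.eq_iff_forall_dual_eq (R := ℝ)).2 fun l ↦ ?_
  have h1 : HasDerivAt (fun s ↦ l (velRep γ q s)) (l (deriv (velRep γ q) t)) t :=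
    l.hasFDerivAt.comp_hasDerivAt t hd
  set f : M → ℝ := fun y ↦ l (extChartAt 𝓘(ℝ, E) q y) with hf
  have hev : ∀ z ∈ (chartAt E q).source,
      rep f q =ᶠ[𝓝 (extChartAt 𝓘(ℝ, E) q z)] l := by
    intro z hz
    filter_upwards [(isOpen_extChartAt_target q).mem_nhds
      ((extChartAt 𝓘(ℝ, E) q).map_source (by simpa using hz))] with p hp
    rw [rep, hf]
    simp only [(extChartAt 𝓘(ℝ, E) q).right_inv hp]
  have hfs : ∀ z ∈ (chartAt E q).source, ContMDiffAt 𝓘(ℝ, E) 𝓘(ℝ, ℝ) 2 f z := fun z hz ↦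
    ContMDiffAt.comp (I' := 𝓘(ℝ, E)) z (g := l) l.contDiff.contDiffAt.contMDiffAt
      ((contMDiffAt_extChartAt' (I := 𝓘(ℝ, E)) (n := ∞) hz).of_le (WithTop.coe_le_coe.2 le_top))
  have hl : ∀ z ∈ (chartAt E q).source,
      fderiv ℝ (rep f q) (extChartAt 𝓘(ℝ, E) q z) = l := fun z hz ↦ by
    rw [(hev z hz).fderiv_eq, l.fderiv]
  have h2 := hγ.hasDerivAt_diff (hfs _ ht)
  have h3 : (fun s ↦ l (velRep γ q s)) =ᶠ[𝓝 t]
      fun s ↦ diff f (γ s) (velocity (E := E) γ s) := by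
    filter_upwards [eventually_mem_source hγ.1 ht] with s hs
    rw [diff_eq_fderiv_rep hs ((hev _ hs).differentiableAt_iff.2 l.differentiableAt), hl _ hs,
      velRep]
  rw [h1.unique (h2.congr_of_eventuallyEq h3),
    hess_eq_rep cov ht ((contDiffAt_rep ht (WithTop.coe_le_coe.2 le_top) (hfs _ ht))), hl _ ht,
    ((hev _ ht).fderiv).fderiv_eq]
  have h4 : fderiv ℝ (fderiv ℝ l) (extChartAt 𝓘(ℝ, E) q (γ t)) = 0 := by
    have : fderiv ℝ (l : E → ℝ) = fun _ ↦ l := funext fun p ↦ l.fderiv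
    rw [this, fderiv_fun_const]
    rfl
  rw [h4, map_neg, velRep]
  simp

/-- The vector field of the geodesic equation in the coordinates of the chart at `q`. -/
def geodField (cov : Connection E M) (q : M) (z : E × E) : E × E :=
  (z.2, -christoffel cov q z.1 z.2 z.2)

/-- Position and velocity of a curve in the coordinates of the chart at `q`. -/
def phaseRep (γ : ℝ → M) (q : M) (s : ℝ) : E × E := (extChartAt 𝓘(ℝ, E) q (γ s), velRep γ q s)

theorem IsGeodesic.hasDerivAt_phaseRep {γ : ℝ → M}
    (hγ : IsGeodesic cov γ) {q : M} {t : ℝ} (ht : γ t ∈ (chartAt E q).source) :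
    HasDerivAt (phaseRep γ q) (geodField cov q (phaseRep γ q t)) t :=
  (hasDerivAt_extChartAt_comp hγ.1 ht).prodMk (hγ.hasDerivAt_velRep ht)

theorem contDiffAt_geodField [T2Space M] (hcov : cov.ContMDiffCovariantDerivative ∞) (q : M)
    (v : E) : ContDiffAt ℝ 1 (geodField cov q) (extChartAt 𝓘(ℝ, E) q q, v) := by
  refine contDiffAt_snd.prodMk (ContDiffAt.neg ?_)
  have h1 : ContDiffAt ℝ 1 (fun z : E × E ↦ christoffel cov q z.1)
      (extChartAt 𝓘(ℝ, E) q q, v) :=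
    ContDiffAt.comp (g := christoffel cov q) _ (contDiffAt_christoffel hcov q) contDiffAt_fst
  exact (h1.clm_apply contDiffAt_snd).clm_apply contDiffAt_snd

/-- A geodesic that starts near the origin of a chart stays in the chart for some time. -/
theorem IsGeodesic.phaseRep_mem_ball [T2Space M] {η : ℝ → M} (hη : IsGeodesic cov η) {q : M}
    {v : E} {r L T : ℝ}
    (hr : Metric.closedBall (extChartAt 𝓘(ℝ, E) q q) r ⊆ (extChartAt 𝓘(ℝ, E) q).target)
    (hL : ∀ z ∈ Metric.ball (extChartAt 𝓘(ℝ, E) q q, v) r, ‖geodField cov q z‖ ≤ L)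
    (hr0 : 0 < r) (hLT : L * T ≤ r / 4) (h0 : η 0 ∈ (chartAt E q).source)
    (hη0 : phaseRep η q 0 ∈ Metric.ball (extChartAt 𝓘(ℝ, E) q q, v) (r / 2)) {t : ℝ}
    (ht : t ∈ Set.Icc 0 T) :
    η t ∈ (chartAt E q).source ∧
      phaseRep η q t ∈ Metric.ball (extChartAt 𝓘(ℝ, E) q q, v) r := by
  have : ProperSpace E := FiniteDimensional.proper ℝ E
  set z₀ : E × E := (extChartAt 𝓘(ℝ, E) q q, v) with hz₀
  let G : Set ℝ := {s | η s ∈ (chartAt E q).source ∧ phaseRep η q s ∈ Metric.ball z₀ r}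
  have hcont : ∀ s, η s ∈ (chartAt E q).source → ContinuousAt (phaseRep η q) s := fun s hs ↦
    (hη.hasDerivAt_phaseRep hs).continuousAt
  have hG : IsOpen G := by
    rw [isOpen_iff_mem_nhds]
    rintro s ⟨h1, h2⟩
    filter_upwards [eventually_mem_source hη.1 h1,
      (hcont s h1).eventually_mem (Metric.isOpen_ball.mem_nhds h2)] with p hp hp'
    exact ⟨hp, hp'⟩
  have h0G : (0 : ℝ) ∈ G := ⟨h0, Metric.ball_subset_ball (by linarith) hη0⟩
  by_contra hcon
  have hcomp : IsCompact (Set.Icc 0 T ∩ Gᶜ) := isCompact_Icc.inter_right hG.isClosed_compl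
  obtain ⟨S, ⟨hS, hSG⟩, hmin⟩ := hcomp.exists_isLeast ⟨t, ht, hcon⟩
  have hS0 : 0 < S := lt_of_le_of_ne hS.1 fun h ↦ hSG (h ▸ h0G)
  have hin : ∀ s ∈ Set.Ico 0 S, s ∈ G := by
    intro s hs
    by_contra h
    exact (hmin ⟨⟨hs.1, hs.2.le.trans hS.2⟩, h⟩).not_gt hs.2
  have hL0 : 0 ≤ L := (norm_nonneg _).trans (hL z₀ (Metric.mem_ball_self hr0))
  have hclose : ∀ s ∈ Set.Ico 0 S, phaseRep η q s ∈ Metric.closedBall z₀ (3 * r / 4) := by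
    intro s hs
    have h1 := (convex_Ico 0 S).norm_image_sub_le_of_norm_hasDerivWithin_le
      (f := phaseRep η q) (fun p hp ↦ (hη.hasDerivAt_phaseRep (hin p hp).1).hasDerivWithinAt)
      (fun p hp ↦ hL _ (hin p hp).2) (Set.left_mem_Ico.2 hS0) hs
    rw [sub_zero, Real.norm_of_nonneg hs.1, ← dist_eq_norm] at h1
    have h2 : L * s ≤ r / 4 :=
      (mul_le_mul_of_nonneg_left (hs.2.le.trans hS.2) hL0).trans hLT
    rw [Metric.mem_closedBall]
    rw [Metric.mem_ball] at hη0
    linarith [dist_triangle (phaseRep η q s) (phaseRep η q 0) z₀]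
  have hA : IsCompact ((extChartAt 𝓘(ℝ, E) q).symm ''
      Metric.closedBall (extChartAt 𝓘(ℝ, E) q q) (3 * r / 4)) := by
    refine (isCompact_closedBall _ _).image_of_continuousOn
      ((continuousOn_extChartAt_symm q).mono ?_)
    exact (Metric.closedBall_subset_closedBall (by linarith)).trans hr
  have hmem := hA.isClosed.mem_of_tendsto
    (hη.1.continuous.continuousAt.tendsto.mono_left (nhdsWithin_le_nhds (s := Set.Iio S))) (by
      filter_upwards [Ico_mem_nhdsLT hS0] with s hs
      refine ⟨extChartAt 𝓘(ℝ, E) q (η s), ?_, ?_⟩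
      · have h2 := hclose s hs
        rw [hz₀, ← closedBall_prod_same] at h2
        exact h2.1
      · exact (extChartAt 𝓘(ℝ, E) q).left_inv (by simpa using (hin s hs).1))
  obtain ⟨p, hp, hpS⟩ := hmem
  have hSsource : η S ∈ (chartAt E q).source := by
    have h1 := (extChartAt 𝓘(ℝ, E) q).map_target
      (hr (Metric.closedBall_subset_closedBall (by linarith) hp))
    rw [hpS] at h1
    simpa using h1
  refine hSG ⟨hSsource, ?_⟩
  have h1 := Metric.isClosed_closedBall.mem_of_tendsto
    ((hcont S hSsource).tendsto.mono_left (nhdsWithin_le_nhds (s := Set.Iio S))) (by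
      filter_upwards [Ico_mem_nhdsLT hS0] with s hs
      exact hclose s hs)
  exact Metric.closedBall_subset_ball (by linarith) h1

end Flow

end GeodesicFlow

/-! ### A convex set with interior lies in the closure of that interior. -/

section ConvexSets


variable {E : Type*} [NormedAddCommGroup E] [NormedSpace ℝ E]
  {M : Type*} [TopologicalSpace M] [ChartedSpace E M] [IsManifold 𝓘(ℝ, E) ∞ M]
  [FiniteDimensional ℝ E] [CompleteSpace E] {cov : Connection E M}

omit [FiniteDimensional ℝ E] [CompleteSpace E] in
theorem phaseRep_comp_const_add (γ : ℝ → M) (q : M) (a : ℝ)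
    {X : E × E → E × E} {t : ℝ}
    (h : HasDerivAt (phaseRep γ q) (X (phaseRep γ q (a + t))) (a + t)) :
    HasDerivAt (fun s ↦ phaseRep γ q (a + s)) (X (phaseRep γ q (a + t))) t := by
  simpa using h.comp_const_add a t

/-- A point on a geodesic in a convex set `Q` is an interior point of `Q` if the geodesic enters
the interior of `Q` immediately after it. -/
theorem IsGeodesic.mem_interior [T2Space M] (hcov : IsAdmissible cov) {Q : Set M}
    (hQ : GeodConvex cov Q) {γ : ℝ → M} (hγ : IsGeodesic cov γ) {s₀ : ℝ} (hs₀ : 0 < s₀)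
    (hγQ : ∀ s ∈ Set.Icc 0 s₀, γ s ∈ Q) (hint : ∀ᶠ s in 𝓝[>] s₀, γ s ∈ interior Q) :
    γ s₀ ∈ interior Q := by
  set q := γ s₀ with hq
  have hqs := mem_chart_source E q
  set φ := extChartAt 𝓘(ℝ, E) q with hφ
  set z₀ := phaseRep (E := E) γ q s₀ with hz₀
  have hz₀' : z₀ = (φ q, velRep γ q s₀) := rfl
  have hX := contDiffAt_geodField hcov.smooth q (velRep (E := E) γ q s₀)
  rw [← hφ, ← hz₀'] at hX
  obtain ⟨K, S, hS, hK⟩ := hX.exists_lipschitzOnWith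
  set L := ‖geodField cov q z₀‖ + 1 with hL
  have hb : ∀ᶠ z in 𝓝 z₀, ‖geodField cov q z‖ < L :=
    hX.continuousAt.norm.eventually_lt continuousAt_const (lt_add_one _)
  have htar : ∀ᶠ z in 𝓝 z₀, z.1 ∈ φ.target :=
    continuousAt_fst.eventually_mem ((isOpen_extChartAt_target q).mem_nhds (mem_extChartAt_target q))
  obtain ⟨r, hr0, hr⟩ := Metric.nhds_basis_closedBall.mem_iff.1
    (Filter.inter_mem hS (Filter.inter_mem hb htar))
  have hrS : Metric.ball z₀ r ⊆ S := fun z hz ↦ (hr (Metric.ball_subset_closedBall hz)).1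
  have hrL : ∀ z ∈ Metric.ball z₀ r, ‖geodField cov q z‖ ≤ L := fun z hz ↦
    le_of_lt (hr (Metric.ball_subset_closedBall hz)).2.1
  have hrtar : Metric.closedBall (φ q) r ⊆ φ.target := fun p hp ↦
    (hr (show (p, velRep γ q s₀) ∈ Metric.closedBall z₀ r by
      rw [hz₀', ← closedBall_prod_same]
      exact ⟨hp, Metric.mem_closedBall_self hr0.le⟩)).2.2
  have hL0 : 0 < L := by positivity
  -- choose a small time
  have hγev : ∀ᶠ s in 𝓝 s₀, γ s ∈ (chartAt E q).source ∧ phaseRep γ q s ∈ Metric.ball z₀ (r / 2) :=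
    (eventually_mem_source hγ.1 hqs).and ((hγ.hasDerivAt_phaseRep hqs).continuousAt.eventually_mem
      (Metric.ball_mem_nhds _ (by positivity)))
  obtain ⟨a, ha0, ha⟩ := Metric.nhds_basis_closedBall.mem_iff.1 hγev
  obtain ⟨b, hb0, hbint⟩ := (nhdsGT_basis s₀).mem_iff.1 hint
  obtain ⟨τ, hτ0, hτa, hτb, hτs, hτL, hτK⟩ : ∃ τ > 0, τ ≤ a ∧ s₀ + τ < b ∧ τ ≤ s₀ ∧
      L * (2 * τ) ≤ r / 4 ∧ K * (2 * τ) ≤ 1 / 8 := by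
    have h1 : ∀ᶠ τ in 𝓝[>] (0 : ℝ), τ < a ∧ s₀ + τ < b ∧ τ < s₀ ∧
        L * (2 * τ) < r / 4 ∧ K * (2 * τ) < 1 / 8 := by
      refine nhdsWithin_le_nhds (((continuous_id.tendsto (0 : ℝ)).eventually_lt_const ha0).and
        ((ContinuousAt.eventually_lt (by fun_prop) continuousAt_const (by simpa using hb0)).and
        (((continuous_id.tendsto (0 : ℝ)).eventually_lt_const hs₀).and
        ((ContinuousAt.eventually_lt (by fun_prop) continuousAt_const (by simpa using hr0)).and
        (ContinuousAt.eventually_lt (by fun_prop) continuousAt_const (by norm_num))))))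
    obtain ⟨τ, ⟨h1, h2, h3, h4, h5⟩, h6⟩ := (h1.and self_mem_nhdsWithin).exists
    exact ⟨τ, h6, h1.le, h2, h3.le, h4.le, h5.le⟩
  have hγball : ∀ t ∈ Set.Icc (0 : ℝ) (2 * τ), γ (s₀ - τ + t) ∈ (chartAt E q).source ∧
      phaseRep γ q (s₀ - τ + t) ∈ Metric.ball z₀ (r / 2) := by
    intro t ht
    apply ha
    rw [Metric.mem_closedBall, Real.dist_eq, abs_le]
    constructor <;> linarith [ht.1, ht.2]
  -- The geodesics issuing from `y ∈ Q` with velocity near that of `γ` end, at time `2τ`, near an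
  -- interior point of `Q`, hence in `Q`. Convexity puts their positions at time `τ` in `Q`, and
  -- these positions fill a neighbourhood of `q`.
  set y := γ (s₀ - τ) with hy
  have h00 : (0 : ℝ) ∈ Set.Icc 0 (2 * τ) := ⟨le_rfl, by positivity⟩
  have hτ2 : τ ∈ Set.Icc 0 (2 * τ) := ⟨hτ0.le, by linarith⟩
  have h2τ : 2 * τ ∈ Set.Icc 0 (2 * τ) := ⟨by positivity, le_rfl⟩
  have hys : y ∈ (chartAt E q).source := by simpa using (hγball 0 h00).1
  set w₀ := velRep (E := E) γ q (s₀ - τ) with hw₀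
  have hyw : (φ y, w₀) ∈ Metric.ball z₀ (r / 2) := by
    have h1 := (hγball 0 h00).2
    rw [add_zero] at h1
    exact h1
  -- the geodesics that start at `y`
  have hex : ∀ w : E, ∃ η : ℝ → M, IsGeodesic cov η ∧ η 0 = y ∧ velRep η q 0 = w := by
    intro w
    have h1 := hcov.expMap_induction (P := fun x u _ ↦ x ∈ (chartAt E q).source →
      ∃ η : ℝ → M, IsGeodesic cov η ∧ η 0 = x ∧ velRep η q 0 = coframe q x u)
      (fun η hη _ ↦ ⟨η, hη, rfl, rfl⟩) y (frame q y w) hys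
    rwa [coframe_frame hys] at h1
  choose η hη hη0 hηw using hex
  have hηp : ∀ w, phaseRep (η w) q 0 = (φ y, w) := fun w ↦ by
    rw [phaseRep, hη0, hηw]
  have hev : ∀ᶠ w in 𝓝 w₀, (φ y, w) ∈ Metric.ball z₀ (r / 2) :=
    (ContinuousAt.eventually_mem (f := fun w : E ↦ (φ y, w)) (by fun_prop)
      (Metric.isOpen_ball.mem_nhds hyw))
  obtain ⟨ρ, hρ0, hρ⟩ := Metric.nhds_basis_ball.mem_iff.1 hev
  have htrap : ∀ w ∈ Metric.ball w₀ ρ, ∀ t ∈ Set.Icc 0 (2 * τ),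
      η w t ∈ (chartAt E q).source ∧ phaseRep (η w) q t ∈ Metric.ball z₀ r := by
    intro w hw t ht
    refine (hη w).phaseRep_mem_ball hrtar hrL hr0 hτL (by rwa [hη0]) ?_ ht
    rw [hηp]
    exact hρ hw
  -- the end point of the geodesics is an interior point of `Q`
  have hγend : γ (s₀ - τ + 2 * τ) ∈ interior Q := by
    apply hbint
    constructor <;> linarith
  have hcomp : ∀ w ∈ Metric.ball w₀ ρ, ∀ t ∈ Set.Icc 0 (2 * τ),
      ‖φ (η w t) - φ (γ (s₀ - τ + t)) - t • (w - w₀)‖ ≤ t / 4 * ‖w - w₀‖ := by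
    intro w hw t ht
    have h1 := norm_sub_sub_smul_le (z₁ := phaseRep (η w) q)
      (z₂ := fun t ↦ phaseRep γ q (s₀ - τ + t)) hK hτK
      (fun t ht ↦ (hη w).hasDerivAt_phaseRep (htrap w hw t ht).1)
      (fun t ht ↦ phaseRep_comp_const_add γ q _ (hγ.hasDerivAt_phaseRep (hγball t ht).1))
      (fun t ht ↦ hrS (htrap w hw t ht).2)
      (fun t ht ↦ hrS (Metric.ball_subset_ball (by linarith) (hγball t ht).2)) (fun _ ↦ rfl)
      (by rw [hηp, add_zero]; rfl) ht
    rw [hηp, add_zero] at h1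
    exact h1
  have hopen : ∀ᶠ p in 𝓝 (φ (γ (s₀ - τ + 2 * τ))), φ.symm p ∈ interior Q := by
    have h1 : γ (s₀ - τ + 2 * τ) ∈ φ.source := by
      rw [hφ, extChartAt_source]; exact (hγball _ h2τ).1
    refine (continuousAt_extChartAt_symm'' (φ.map_source h1)).eventually_mem ?_
    rw [φ.left_inv h1]
    exact isOpen_interior.mem_nhds hγend
  obtain ⟨ε, hε0, hε⟩ := Metric.nhds_basis_ball.mem_iff.1 hopen
  -- At time `2τ` the displacement is at most `2τ (1 + 1/4) ‖w - w₀‖`, which is then below `5ε/8`.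
  set ρ' := min ρ (ε / (4 * τ)) with hρ'
  have hρ'0 : 0 < ρ' := lt_min hρ0 (by positivity)
  have hend : ∀ w ∈ Metric.ball w₀ ρ', η w (2 * τ) ∈ Q := by
    intro w hw
    have hw1 := Metric.ball_subset_ball (min_le_left _ _) hw
    have h1 := hcomp w hw1 (2 * τ) h2τ
    have h2 : ‖w - w₀‖ < ε / (4 * τ) := by
      rw [← dist_eq_norm]
      exact (Metric.mem_ball.1 hw).trans_le (min_le_right _ _)
    rw [lt_div_iff₀ (by positivity)] at h2
    have h3 : φ (η w (2 * τ)) ∈ Metric.ball (φ (γ (s₀ - τ + 2 * τ))) ε := by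
      rw [Metric.mem_ball, dist_eq_norm]
      have h4 := norm_le_norm_sub_add (φ (η w (2 * τ)) - φ (γ (s₀ - τ + 2 * τ)))
        ((2 * τ) • (w - w₀))
      rw [norm_smul, Real.norm_of_nonneg h2τ.1] at h4
      nlinarith [norm_nonneg (w - w₀)]
    have h4 := hε h3
    have h5 : η w (2 * τ) ∈ φ.source := by
      rw [hφ, extChartAt_source]; exact (htrap w hw1 _ h2τ).1
    have h6 : φ.symm (φ (η w (2 * τ))) ∈ interior Q := h4
    rw [φ.left_inv h5] at h6
    exact interior_subset h6
  have hmid : ∀ w ∈ Metric.ball w₀ ρ', η w τ ∈ Q := fun w hw ↦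
    hQ (η w) (hη w) 0 (2 * τ) (by rw [hη0]; exact hγQ _ ⟨by linarith, by linarith⟩) (hend w hw) τ hτ2
  -- the midpoints cover a neighbourhood
  have himg := image_ball_mem_nhds_of_approx_smul (f := fun w ↦ φ (η w τ)) (w₀ := w₀) hρ'0 hτ0
    (fun w hw w' hw' ↦ by
      have hw1 := Metric.ball_subset_ball (min_le_left _ _) hw
      have hw1' := Metric.ball_subset_ball (min_le_left _ _) hw'
      have h1 := norm_sub_sub_smul_le (z₁ := phaseRep (η w) q) (z₂ := phaseRep (η w') q) hK hτK
        (fun t ht ↦ (hη w).hasDerivAt_phaseRep (htrap w hw1 t ht).1)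
        (fun t ht ↦ (hη w').hasDerivAt_phaseRep (htrap w' hw1' t ht).1)
        (fun t ht ↦ hrS (htrap w hw1 t ht).2) (fun t ht ↦ hrS (htrap w' hw1' t ht).2)
        (fun _ ↦ rfl) (by rw [hηp, hηp]) hτ2
      rw [hηp, hηp] at h1
      exact h1)
  -- For `w = w₀` the comparison has zero right side, so `η w₀` follows `γ` and is at `q` at time
  -- `τ`.
  have hw₀q : φ (η w₀ τ) = φ q := by
    have h1 := hcomp w₀ (Metric.mem_ball_self hρ0) τ hτ2
    rw [sub_self, smul_zero, norm_zero, mul_zero, sub_zero, sub_add_cancel] at h1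
    exact sub_eq_zero.1 (norm_le_zero_iff.1 h1)
  simp only [hw₀q] at himg
  rw [mem_interior_iff_mem_nhds]
  filter_upwards [(continuousAt_extChartAt (I := 𝓘(ℝ, E)) q).preimage_mem_nhds himg,
    (chartAt E q).open_source.mem_nhds hqs] with x hx hxs
  obtain ⟨w, hw, hwx⟩ := hx
  have h1 := (htrap w (Metric.ball_subset_ball (min_le_left _ _) hw) τ hτ2).1
  have h2 : η w τ = x := φ.injOn (by rw [hφ, extChartAt_source]; exact h1)
    (by rw [hφ, extChartAt_source]; exact hxs) hwx
  rw [← h2]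
  exact hmid w hw

/-- A convex set with nonempty interior is contained in the closure of its interior. -/
theorem GeodConvex.subset_closure_interior [T2Space M] (hcov : IsAdmissible cov) {Q : Set M}
    (hQ : GeodConvex cov Q) (hne : (interior Q).Nonempty) : Q ⊆ closure (interior Q) := by
  intro y hy
  obtain ⟨x, hx⟩ := hne
  obtain ⟨γ, hγ, rfl, rfl⟩ := hcov.exists_geodesic y x
  have hγQ := hQ γ hγ 0 1 hy (interior_subset hx)
  have key : ∀ s ∈ Set.Ioc (0 : ℝ) 1, γ s ∈ interior Q := by
    by_contra! hcon
    obtain ⟨s, hs, hsQ⟩ := hcon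
    have hcomp : IsCompact (Set.Icc s 1 ∩ γ ⁻¹' (interior Q)ᶜ) :=
      isCompact_Icc.inter_right (isOpen_interior.isClosed_compl.preimage hγ.1.continuous)
    -- The last parameter at which `γ` is not interior: `γ` enters the interior right after it,
    -- contradicting `IsGeodesic.mem_interior`.
    obtain ⟨s₀, ⟨hs₀, hs₀Q⟩, hmax⟩ := hcomp.exists_isGreatest ⟨s, ⟨le_rfl, hs.2⟩, hsQ⟩
    have hs₀1 : s₀ < 1 := lt_of_le_of_ne hs₀.2 fun h ↦ hs₀Q (by rwa [h])
    refine hs₀Q (hγ.mem_interior hcov hQ (hs.1.trans_le hs₀.1)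
      (fun r hr ↦ hγQ r ⟨hr.1, hr.2.trans hs₀.2⟩) ?_)
    filter_upwards [Ioo_mem_nhdsGT hs₀1] with r hr
    by_contra h
    exact (hmax ⟨⟨hs₀.1.trans hr.1.le, hr.2.le⟩, h⟩).not_gt hr.1
  refine mem_closure_of_tendsto
    (hγ.1.continuous.continuousAt.tendsto.mono_left (nhdsWithin_le_nhds (s := Set.Ioi (0 : ℝ)))) ?_
  filter_upwards [Ioc_mem_nhdsGT zero_lt_one] with s hs
  exact key s hs

end ConvexSets

/-! ### Consequences of the barrier inequality: the optimality gap and `ν ≥ 1`. -/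

section Barriers


section Scalar

/-- Self-concordance gives `P(s) ≥ (h / (1 + h s))²` with `h = √(P 0)`, which raises `ψ` to at least
`c` by a time `r`. From then on `ψ² ≤ ν ψ'` makes `1/ψ + s/ν` decreasing, so `c (1 - r) ≤ ν`. The
remainder `c r` is controlled by `c ≤ (β + √ν) h`. -/
theorem le_of_barrier_deriv {ψ P P' : ℝ → ℝ} {ν β c : ℝ} (hν : 0 < ν) (hβ₀ : 0 < β) (hβ₁ : β < 1)
    (hψ : ∀ s ∈ Set.Icc (0 : ℝ) 1, HasDerivAt ψ (P s) s)
    (hP : ∀ s ∈ Set.Icc (0 : ℝ) 1, HasDerivAt P (P' s) s)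
    (hpos : ∀ s ∈ Set.Icc (0 : ℝ) 1, 0 < P s)
    (hP' : ∀ s ∈ Set.Icc (0 : ℝ) 1, -P' s ≤ 2 * √(P s) * P s)
    (hbar : ∀ s ∈ Set.Icc (0 : ℝ) 1, ψ s ≤ √ν * √(P s)) (hc0 : 0 < c)
    (hc : c ≤ ψ 0 + β * √(P 0)) : c ≤ ν + (β + √ν) * β / (1 - β) := by
  have h01 : (0 : ℝ) ∈ Set.Icc (0 : ℝ) 1 := by simp
  have hh := Real.sqrt_pos.2 (hpos 0 h01)
  have hinv : ∀ s ∈ Set.Icc (0 : ℝ) 1, (√(P s))⁻¹ ≤ (√(P 0))⁻¹ + s := fun s hs ↦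
    inv_sqrt_le_of_le_deriv (convex_Icc 0 1) h01 (fun r hr ↦ hr.1) hP hpos hP' hs
  have hbar0 := hbar 0 h01
  set h := √(P 0)
  have h1β : 0 < 1 - β := by linarith
  have hsν := Real.sqrt_nonneg ν
  -- Chosen so that the integral `h - h / (1 + h r)` of the lower bound for `P` equals `β h`.
  set r := β / ((1 - β) * h) with hr
  have hr0 : 0 < r := by positivity
  have hrh : h * r = β / (1 - β) := by
    rw [hr]; field_simp
  have hcr : c * r ≤ (β + √ν) * β / (1 - β) := by
    have h1 : c ≤ (β + √ν) * h := by linarith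
    calc c * r ≤ (β + √ν) * h * r := mul_le_mul_of_nonneg_right h1 hr0.le
      _ = _ := by rw [mul_assoc, hrh, mul_div_assoc]
  -- If `r ≥ 1`, then already `c ≤ c r`.
  rcases le_or_gt 1 r with h1r | hr1
  · nlinarith
  have hrm : r ∈ Set.Icc (0 : ℝ) 1 := ⟨hr0.le, hr1.le⟩
  have hgrow : c ≤ ψ r := by
    have hanti : AntitoneOn (fun s ↦ -h * (1 + h * s)⁻¹ - ψ s) (Set.Icc (0 : ℝ) 1) := by
      refine antitoneOn_of_hasDerivAt (f' := fun s ↦ -h * (-(h * 1) / (1 + h * s) ^ 2) - P s)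
        (convex_Icc 0 1) (fun s hs ↦ ?_) fun s hs ↦ ?_
      · have h2 : (1 + h * s) ≠ 0 := by nlinarith [hs.1]
        exact ((((((hasDerivAt_id s).const_mul h).const_add 1).inv h2).const_mul (-h)).sub (hψ s hs))
      · have h2 : 0 < 1 + h * s := by nlinarith [hs.1]
        have h3 := hinv s hs
        have h4 := Real.sqrt_pos.2 (hpos s hs)
        have h5 : h / (1 + h * s) ≤ √(P s) := by
          rw [div_le_iff₀ h2]
          have h6 := mul_le_mul_of_nonneg_left h3 (mul_pos hh h4).le
          have h7 : h * √(P s) * (√(P s))⁻¹ = h := by field_simp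
          have h8 : h * √(P s) * (h⁻¹ + s) = √(P s) * (1 + h * s) := by field_simp
          rwa [h7, h8] at h6
        have h6 := pow_le_pow_left₀ (by positivity) h5 2
        rw [Real.sq_sqrt (hpos s hs).le] at h6
        have h7 : -h * (-(h * 1) / (1 + h * s) ^ 2) = (h / (1 + h * s)) ^ 2 := by
          field_simp
        rw [h7]
        linarith
    have h2 := hanti h01 hrm hr0.le
    have h3 : (1 + h * r)⁻¹ = 1 - β := by
      rw [hrh]; field_simp; ring
    simp only [h3, mul_zero, add_zero, inv_one] at h2
    linarith
  have hmono : ∀ s ∈ Set.Icc r 1, ψ r ≤ ψ s := by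
    intro s hs
    have hanti : AntitoneOn (fun s ↦ -ψ s) (Set.Icc (0 : ℝ) 1) :=
      antitoneOn_of_hasDerivAt (convex_Icc 0 1) (fun s hs ↦ (hψ s hs).neg) fun s hs ↦ by
        linarith [hpos s hs]
    have := hanti hrm ⟨hr0.le.trans hs.1, hs.2⟩ hs.1
    simp only at this
    linarith
  have hψpos : ∀ s ∈ Set.Icc r 1, 0 < ψ s := fun s hs ↦ (hc0.trans_le hgrow).trans_le (hmono s hs)
  have hanti : AntitoneOn (fun s ↦ (ψ s)⁻¹ + s * ν⁻¹) (Set.Icc r 1) := by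
    refine antitoneOn_of_hasDerivAt (f' := fun s ↦ -P s / ψ s ^ 2 + 1 * ν⁻¹) (convex_Icc r 1)
      (fun s hs ↦ ((hψ s ⟨hr0.le.trans hs.1, hs.2⟩).inv (hψpos s hs).ne').add
        ((hasDerivAt_id s).mul_const _)) fun s hs ↦ ?_
    have hs' : s ∈ Set.Icc (0 : ℝ) 1 := ⟨hr0.le.trans hs.1, hs.2⟩
    have h2 := pow_le_pow_left₀ (hψpos s hs).le (hbar s hs') 2
    rw [mul_pow, Real.sq_sqrt hν.le, Real.sq_sqrt (hpos s hs').le] at h2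
    have h3 : ν⁻¹ ≤ P s / ψ s ^ 2 := by
      rw [inv_eq_one_div, div_le_div_iff₀ hν (pow_pos (hψpos s hs) 2)]
      linarith
    rw [neg_div]
    linarith
  have h2 := hanti (Set.left_mem_Icc.2 hr1.le) (Set.right_mem_Icc.2 hr1.le) hr1.le
  have h3 := inv_pos.2 (hψpos 1 (Set.right_mem_Icc.2 hr1.le))
  have h4 : (1 - r) * ν⁻¹ ≤ (ψ r)⁻¹ := by simp only at h2; linarith
  have hψr := hψpos r (Set.left_mem_Icc.2 hr1.le)
  have h5 : ψ r * (1 - r) ≤ ν := by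
    rw [← div_eq_mul_inv, inv_eq_one_div, div_le_div_iff₀ hν hψr] at h4
    linarith
  have h6 : c * (1 - r) ≤ ψ r * (1 - r) := mul_le_mul_of_nonneg_right hgrow (by linarith)
  nlinarith

/-- For `ν < 1` the quotient `ψ / √P ≤ √ν` has derivative at least `√P - ψ ≥ ((√ν)⁻¹ - 1) ψ`, so the
total increase of `φ` is bounded. But `φ` also grows at least linearly; this rules out an endless
geodesic. -/
theorem le_of_barrier_deriv_of_lt_one {φ ψ P P' : ℝ → ℝ} {ν : ℝ} (hν : 0 < ν) (hν1 : ν < 1)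
    {D : Set ℝ} (hD : Convex ℝ D) (h0 : 0 ∈ D) (hD0 : ∀ s ∈ D, 0 ≤ s)
    (hφ : ∀ s ∈ D, HasDerivAt φ (ψ s) s) (hψ : ∀ s ∈ D, HasDerivAt ψ (P s) s)
    (hP : ∀ s ∈ D, HasDerivAt P (P' s) s) (hnn : ∀ s ∈ D, 0 ≤ P s)
    (hP' : ∀ s ∈ D, P' s ≤ 2 * √(P s) * P s) (hbar : ∀ s ∈ D, ψ s ≤ √ν * √(P s))
    (hψ0 : 0 < ψ 0) {s : ℝ} (hs : s ∈ D) :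
    φ 0 + ψ 0 * s ≤ φ s ∧ φ s ≤ φ 0 + √ν / ((√ν)⁻¹ - 1) := by
  have hψmono : ∀ s ∈ D, ψ 0 ≤ ψ s := by
    intro s hs
    have hanti : AntitoneOn (fun s ↦ -ψ s) D :=
      antitoneOn_of_hasDerivAt hD (fun s hs ↦ (hψ s hs).neg) fun s hs ↦ by
        linarith [hnn s hs]
    have := hanti h0 hs (hD0 s hs)
    simp only at this
    linarith
  have hsν : 0 < √ν := Real.sqrt_pos.2 hν
  have hsν1 : √ν < 1 := by
    rw [Real.sqrt_lt' one_pos]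
    simpa using hν1
  have hψpos : ∀ s ∈ D, 0 < ψ s := fun s hs ↦ hψ0.trans_le (hψmono s hs)
  have hsP : ∀ s ∈ D, 0 < √(P s) := fun s hs ↦ by
    by_contra! h
    have := hbar s hs
    nlinarith [hψpos s hs]
  have hpos : ∀ s ∈ D, 0 < P s := fun s hs ↦ Real.sqrt_pos.1 (hsP s hs)
  constructor
  · have hanti : AntitoneOn (fun s ↦ s * ψ 0 - φ s) D :=
      antitoneOn_of_hasDerivAt hD (fun s hs ↦ ((hasDerivAt_id s).mul_const _).sub (hφ s hs))
        fun s hs ↦ by linarith [hψmono s hs]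
    have := hanti h0 hs (hD0 s hs)
    simp only [zero_mul] at this
    linarith
  · have hk : 0 < (√ν)⁻¹ - 1 := sub_pos.2 ((one_lt_inv₀ hsν).2 hsν1)
    set k := (√ν)⁻¹ - 1
    have hanti : AntitoneOn (fun s ↦ k * φ s - ψ s / √(P s)) D := by
      refine antitoneOn_of_hasDerivAt (f' := fun s ↦ k * ψ s -
        (P s * √(P s) - ψ s * (P' s / (2 * √(P s)))) / √(P s) ^ 2) hD
        (fun s hs ↦ ((hφ s hs).const_mul k).sub
          ((hψ s hs).div ((hP s hs).sqrt (hpos s hs).ne') (hsP s hs).ne')) fun s hs ↦ ?_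
      have h1 := hsP s hs
      have h2 := Real.sq_sqrt (hpos s hs).le
      have h3 := hbar s hs
      have h4 := hP' s hs
      set p := √(P s)
      rw [← h2] at h4 ⊢
      have h5 : P' s / (2 * p) ≤ p ^ 2 := by
        rw [div_le_iff₀ (by positivity)]
        linarith
      have h6 : (√ν)⁻¹ * ψ s ≤ p := by
        rw [inv_mul_le_iff₀ hsν]
        exact h3
      have h7 : p - ψ s ≤ (p ^ 2 * p - ψ s * (P' s / (2 * p))) / p ^ 2 := by
        rw [le_div_iff₀ (by positivity)]
        nlinarith [mul_le_mul_of_nonneg_left h5 (hψpos s hs).le]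
      have h8 : k * ψ s = (√ν)⁻¹ * ψ s - ψ s := by ring
      linarith
    have h1 := hanti h0 hs (hD0 s hs)
    have h2 : ψ s / √(P s) ≤ √ν := by
      rw [div_le_iff₀ (hsP s hs)]
      exact hbar s hs
    have h3 : 0 < ψ 0 / √(P 0) := div_pos hψ0 (hsP 0 h0)
    have h4 : (φ s - φ 0) * k ≤ √ν := by simp only at h1; linarith
    rw [← le_div_iff₀ hk] at h4
    linarith

end Scalar

variable {E : Type*} [NormedAddCommGroup E] [NormedSpace ℝ E]
  {M : Type*} [TopologicalSpace M] [ChartedSpace E M] [IsManifold 𝓘(ℝ, E) ∞ M]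
  [FiniteDimensional ℝ E] [CompleteSpace E] {cov : Connection E M}
  {Q : Set M} {ℓ F : M → ℝ}

theorem sub_le_of_diffNorm_le [T2Space M] (hcov : IsAdmissible cov) {ν : ℝ}
    (hℓ : IsAffineOn cov Q ℓ) (hF : IsSelfConcordantBarrier cov ν (interior Q) F)
    (hQ : GeodConvex cov Q) {x y : M} (hx : x ∈ interior Q) (hy : y ∈ interior Q) {t β : ℝ}
    (ht : 0 < t) (hβ₀ : 0 < β) (hβ₁ : β < 1)
    (hxt : diffNorm cov F (pathObj ℓ F t) x ≤ β) :
    ℓ x - ℓ y ≤ 1 / t * (ν + (β + √ν) * β / (1 - β)) := by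
  have hFs := hF.selfConcordant
  have hν := hF.pos
  have hB : 0 ≤ ν + (β + √ν) * β / (1 - β) := by
    have : 0 < 1 - β := by linarith
    positivity
  rw [one_div, ← div_eq_inv_mul, le_div_iff₀ ht]
  rcases le_or_gt (ℓ x - ℓ y) 0 with hd | hd
  · nlinarith
  obtain ⟨γ, hγ, rfl, rfl⟩ := hcov.exists_geodesic x y
  have : FiniteDimensional ℝ (TangentSpace 𝓘(ℝ, E) (γ 0)) := ‹FiniteDimensional ℝ E›
  have hC := hFs.convex γ hγ 0 1 hx hy
  have haff : ∀ s ∈ Set.Icc (0 : ℝ) 1, ℓ (γ s) = ℓ (γ 0) + (ℓ (γ 1) - ℓ (γ 0)) * s := by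
    have h1 := hℓ.apply_geodesic hQ hγ hx (interior_subset hy) (s := 1) (by simp)
    intro s hs
    rw [hℓ.apply_geodesic hQ hγ hx (interior_subset hy) hs, h1]
    ring
  have hdiff : ∀ s ∈ Set.Icc (0 : ℝ) 1,
      diff ℓ (γ s) (velocity (E := E) γ s) = ℓ (γ 1) - ℓ (γ 0) := by
    intro s hs
    have h2 : HasDerivWithinAt (fun s ↦ ℓ (γ 0) + (ℓ (γ 1) - ℓ (γ 0)) * s) (ℓ (γ 1) - ℓ (γ 0))
        (Set.Icc 0 1) s := by
      simpa using (((hasDerivAt_id s).const_mul (ℓ (γ 1) - ℓ (γ 0))).const_add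
        (ℓ (γ 0))).hasDerivWithinAt (s := Set.Icc 0 1)
    exact (uniqueDiffOn_Icc zero_lt_one s hs).eq_deriv _
      (hℓ.hasDerivAt_comp hγ (hC s hs)).hasDerivWithinAt (h2.congr haff (haff s hs))
  -- `ℓ` strictly decreases along `γ`; a nonzero velocity is what makes `P` positive.
  have hvel : ∀ s ∈ Set.Icc (0 : ℝ) 1, velocity (E := E) γ s ≠ 0 := by
    intro s hs h0
    have := hdiff s hs
    rw [h0, map_zero] at this
    linarith
  have hI := hFs.isInner hcov.torsionFree hx
  -- Since `-t Dℓ = DF - Df_t`, the scaled gap is `DF(γ')` plus a term bounded by the dual norm of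
  -- `Df_t`.
  have hc : (ℓ (γ 0) - ℓ (γ 1)) * t ≤ diff F (γ 0) (velocity (E := E) γ 0) +
      β * √(hess (E := E) cov F (γ 0) (velocity γ 0) (velocity γ 0)) := by
    have h1 := hI.apply_le_dualNorm (diff (E := E) (pathObj ℓ F t) (γ 0)).toLinearMap
      (-velocity (E := E) γ 0)
    have h2 : (diff (E := E) (pathObj ℓ F t) (γ 0)).toLinearMap (-velocity (E := E) γ 0) =
        -(t * diff ℓ (γ 0) (velocity (E := E) γ 0) + diff F (γ 0) (velocity (E := E) γ 0)) := by
      rw [map_neg]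
      exact congrArg _ (diff_pathObj hcov hℓ hFs t hx _)
    rw [h2, hdiff 0 (by simp), hI.neg_left, hI.neg_right, neg_neg] at h1
    have h3 := mul_le_mul_of_nonneg_right hxt
      (Real.sqrt_nonneg (hess (E := E) cov F (γ 0) (velocity γ 0) (velocity γ 0)))
    have h4 := h1.trans h3
    linarith
  refine le_of_barrier_deriv hν hβ₀ hβ₁ (fun s hs ↦ hFs.hasDerivAt_diff hγ (hC s hs))
    (fun s hs ↦ hFs.hasDerivAt_hess hcov.smooth hγ (hC s hs))
    (fun s hs ↦ hFs.nondegenerate _ (hC s hs) _ (hvel s hs)) (fun s hs ↦ ?_)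
    (fun s hs ↦ hF.diff_le hcov (hC s hs) _) (by positivity) hc
  have h1 := (abs_le.1 (hFs.bound _ (hC s hs) (velocity γ s) (velocity γ s))).1
  linarith

/-- The geodesic argument needs `F` at both ends; boundary points of `Q` are reached as limits of
interior points, by continuity of `ℓ`. -/
theorem sub_sInf_le_of_diffNorm_le [T2Space M] (hcov : IsAdmissible cov) {ν : ℝ}
    (hℓ : IsAffineOn cov Q ℓ) (hF : IsSelfConcordantBarrier cov ν (interior Q) F)
    (hQ : GeodConvex cov Q) {x : M} (hx : x ∈ interior Q) {t β : ℝ}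
    (ht : 0 < t) (hβ₀ : 0 < β) (hβ₁ : β < 1)
    (hxt : diffNorm cov F (pathObj ℓ F t) x ≤ β) :
    ℓ x - sInf (ℓ '' Q) ≤ 1 / t * (ν + (β + √ν) * β / (1 - β)) := by
  have key : ℓ x - 1 / t * (ν + (β + √ν) * β / (1 - β)) ≤ sInf (ℓ '' Q) := by
    refine le_csInf ⟨_, x, interior_subset hx, rfl⟩ ?_
    rintro _ ⟨y, hy, rfl⟩
    have hcl := hQ.subset_closure_interior hcov ⟨x, hx⟩ hy
    have : (𝓝[interior Q] y).NeBot := mem_closure_iff_nhdsWithin_neBot.1 hcl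
    have h1 : Filter.Tendsto ℓ (𝓝[interior Q] y) (𝓝 (ℓ y)) :=
      (hℓ.continuousOn y hy).mono_left (nhdsWithin_mono y interior_subset)
    refine ge_of_tendsto h1 ?_
    filter_upwards [self_mem_nhdsWithin] with z hz
    linarith [sub_le_of_diffNorm_le hcov hℓ hF hQ hx hz ht hβ₀ hβ₁ hxt]
  linarith

/-- The parameter of a self-concordant barrier is at least `1`. -/
theorem IsSelfConcordantBarrier.one_le [T2Space M] {ν : ℝ} {C : Set M}
    (hF : IsSelfConcordantBarrier cov ν C F) (hcov : IsAdmissible cov) {x : M} (hx : x ∈ C)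
    {u : TangentSpace 𝓘(ℝ, E) x} (hu : u ≠ 0) : 1 ≤ ν := by
  have hFs := hF.selfConcordant
  by_contra! hν1
  -- Otherwise `DF` vanishes on `C`, and with it the Hessian, against nondegeneracy.
  obtain ⟨y, hy, v, hv⟩ : ∃ y ∈ C, ∃ v : TangentSpace 𝓘(ℝ, E) y, 0 < diff F y v := by
    by_contra! hcon
    have hz : ∀ y ∈ C, ∀ v : TangentSpace 𝓘(ℝ, E) y, diff F y v = 0 := by
      intro y hy v
      have h1 := hcon y hy (-v)
      rw [map_neg] at h1
      linarith [hcon y hy v]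
    refine hcov.expMap_induction (P := fun x u _ ↦ x ∈ C → u ≠ 0 → False)
      (fun γ hγ h0 hne ↦ ?_) x u hx hu
    have h1 : (fun s ↦ diff F (γ s) (velocity (E := E) γ s)) =ᶠ[𝓝 0] fun _ ↦ (0 : ℝ) := by
      filter_upwards [hγ.1.continuous.continuousAt.eventually_mem (hFs.isOpen.mem_nhds h0)]
        with s hs
      exact hz _ hs _
    have h2 := (hFs.hasDerivAt_diff hγ h0).unique
      ((hasDerivAt_const 0 (0 : ℝ)).congr_of_eventuallyEq h1)
    exact (hFs.nondegenerate _ h0 _ hne).ne' h2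
  refine hcov.expMap_induction (P := fun x u _ ↦ x ∈ C → 0 < diff F x u → False)
    (fun γ hγ h0 hpos ↦ ?_) y v hy hv
  have hmain : ∀ S, (∀ s ∈ Set.Ico 0 S, γ s ∈ C) → ∀ s ∈ Set.Ico 0 S,
      F (γ 0) + diff F (γ 0) (velocity (E := E) γ 0) * s ≤ F (γ s) ∧
        F (γ s) ≤ F (γ 0) + √ν / ((√ν)⁻¹ - 1) := fun S hS s hs ↦
    le_of_barrier_deriv_of_lt_one hF.pos hν1 (convex_Ico 0 S)
      (Set.left_mem_Ico.2 (hs.1.trans_lt hs.2)) (fun r hr ↦ hr.1)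
      (fun r hr ↦ hFs.hasDerivAt_comp hγ (hS r hr)) (fun r hr ↦ hFs.hasDerivAt_diff hγ (hS r hr))
      (fun r hr ↦ hFs.hasDerivAt_hess hcov.smooth hγ (hS r hr))
      (fun r hr ↦ (hFs.isInner hcov.torsionFree (hS r hr)).nonneg _)
      (fun r hr ↦ (le_abs_self _).trans (by
        simpa using hFs.bound _ (hS r hr) (velocity γ r) (velocity γ r)))
      (fun r hr ↦ hF.diff_le hcov (hS r hr) _) hpos hs
  -- The upper bound on `F ∘ γ` keeps the geodesic in `C` for all positive time, where the linear
  -- lower bound eventually exceeds it.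
  have hall : ∀ T, ∀ s ∈ Set.Icc 0 T, γ s ∈ C := fun T ↦
    forall_mem_of_closed_epigraph hFs.isOpen hFs.closed hγ.1.continuous h0
      fun S _ _ hS ↦ ⟨_, fun s hs ↦ (hmain S hS s hs).2⟩
  set d := diff F (γ 0) (velocity (E := E) γ 0)
  set B := √ν / ((√ν)⁻¹ - 1)
  have h1 := hmain ((|B| + 1) / d + 1) (fun s hs ↦ hall _ s (Set.Ico_subset_Icc_self hs))
    ((|B| + 1) / d) ⟨by positivity, by linarith⟩
  have h2 := h1.1.trans h1.2
  rw [mul_div_cancel₀ _ hpos.ne'] at h2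
  linarith [le_abs_self B]

end Barriers

/-! ### Counting iterations. -/

section Complexity


section Complexity

/-- The number of steps needed by a sequence of parameters that grows geometrically at rate
`1 + α / (β + √ν)`. -/
theorem exists_iteration_bound {α β : ℝ} (hα : 0 < α) (hβ₀ : 0 < β) (hβ₁ : β < 1) :
    ∃ K : ℝ, 0 < K ∧ ∀ ν D ε : ℝ, 1 ≤ ν → 0 < D → 0 < ε → ∃ N : ℕ, 1 ≤ N ∧
      (N : ℝ) ≤ K * √ν * max 1 (Real.log (ν * D / ε)) ∧
      ∀ k : ℕ, N ≤ k → ∀ t : ℝ, (1 + α / (β + √ν)) ^ (k - 1) * (α / D) ≤ t →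
        1 / t * (ν + (β + √ν) * β / (1 - β)) ≤ ε := by
  -- For `ν ≥ 1` the numerator of the gap bound is at most `C * ν`, and `log (1 + ρ) ≥ ρ / (1 + ρ) ≥
  -- c / √ν` for the growth rate `ρ = α / (β + √ν)`.
  set C := 1 + (β + 1) * β / (1 - β) with hC
  set c := α / (α + β + 1) with hc
  have h1β : 0 < 1 - β := by linarith
  have hC0 : 0 < C := by positivity
  have hc0 : 0 < c := by positivity
  set A := |Real.log (C / α)| with hA
  have hA0 : 0 ≤ A := abs_nonneg _
  refine ⟨(A + 1) / c + 2, by positivity, fun ν D ε hν hD hε ↦ ?_⟩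
  have hν0 : 0 < ν := by linarith
  have hsν : 1 ≤ √ν := Real.one_le_sqrt.2 hν
  have hsνν : √ν ≤ ν := by
    have := Real.sq_sqrt hν0.le
    nlinarith
  set m := max 1 (Real.log (ν * D / ε)) with hm
  have hm1 : 1 ≤ m := le_max_left _ _
  set a := √ν / c * (A + m) with ha
  have ha0 : 0 ≤ a := by positivity
  -- The extra step accounts for `t₀ = 0`, as growth starts from `t₁`. It and the rounding cost at
  -- most `2 ≤ 2 * (√ν * m)`, the summand `2` in `K`.
  refine ⟨⌈a⌉₊ + 1, by omega, ?_, fun k hk t ht ↦ ?_⟩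
  · have h1 : (⌈a⌉₊ : ℝ) ≤ a + 1 := (Nat.ceil_lt_add_one ha0).le
    push_cast
    have h2 : A + m ≤ (A + 1) * m := by nlinarith
    have h3 : a ≤ √ν / c * ((A + 1) * m) := mul_le_mul_of_nonneg_left h2 (by positivity)
    have h4 : 1 ≤ √ν * m := one_le_mul_of_one_le_of_one_le hsν hm1
    calc (⌈a⌉₊ : ℝ) + 1 ≤ √ν / c * ((A + 1) * m) + 2 * (√ν * m) := by linarith
      _ = _ := by ring
  · set ρ := α / (β + √ν) with hρ
    have hρ0 : 0 < ρ := by positivity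
    have hn : a ≤ ((k - 1 : ℕ) : ℝ) :=
      (Nat.le_ceil a).trans (by exact_mod_cast Nat.le_sub_of_add_le hk)
    set n := k - 1
    have hlog : c / √ν ≤ Real.log (1 + ρ) := by
      refine le_trans ?_ (Real.one_sub_inv_le_log_of_pos (by positivity))
      have h1 : 1 - (1 + ρ)⁻¹ = α / (α + β + √ν) := by
        have h2 : β + √ν ≠ 0 := by positivity
        have h3 : α + β + √ν ≠ 0 := by positivity
        have h4 : 1 + ρ = (α + β + √ν) / (β + √ν) := by
          rw [hρ]; field_simp; ring
        rw [h4, inv_div]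
        field_simp
        ring
      rw [h1, hc, div_div]
      refine div_le_div_of_nonneg_left hα.le (by positivity) ?_
      nlinarith
    have hpow : C * ν * D / (α * ε) ≤ (1 + ρ) ^ n := by
      rw [← Real.log_le_log_iff (by positivity) (by positivity), Real.log_pow]
      have h1 : C * ν * D / (α * ε) = C / α * (ν * D / ε) := by field_simp
      rw [h1, Real.log_mul (by positivity) (by positivity)]
      have h2 : Real.log (C / α) + Real.log (ν * D / ε) ≤ A + m :=
        add_le_add (le_abs_self _) (le_max_right _ _)
      have h3 : A + m = a * (c / √ν) := by
        rw [ha]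
        have : √ν ≠ 0 := by positivity
        field_simp
      rw [h3] at h2
      exact h2.trans (mul_le_mul hn hlog (by positivity) (by positivity))
    have ht0 : C * ν / ε ≤ t := by
      refine le_trans ?_ ht
      refine le_trans (le_of_eq ?_) (mul_le_mul_of_nonneg_right hpow (by positivity))
      field_simp
    have ht1 : 0 < t := lt_of_lt_of_le (by positivity) ht0
    have h1 : ν + (β + √ν) * β / (1 - β) ≤ C * ν := by
      have h2 : (β + √ν) * β / (1 - β) ≤ ((β + 1) * ν) * β / (1 - β) := by
        refine div_le_div_of_nonneg_right (mul_le_mul_of_nonneg_right ?_ hβ₀.le) h1β.le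
        nlinarith
      have h3 : C * ν = ν + (β + 1) * ν * β / (1 - β) := by rw [hC]; ring
      linarith
    rw [one_div, ← div_eq_inv_mul, div_le_iff₀ ht1]
    rw [div_le_iff₀ hε] at ht0
    linarith

end Complexity

variable {E : Type*} [NormedAddCommGroup E] [NormedSpace ℝ E]
  {M : Type*} [TopologicalSpace M] [ChartedSpace E M] [IsManifold 𝓘(ℝ, E) ∞ M]
  [FiniteDimensional ℝ E] [CompleteSpace E] {cov : Connection E M}
  {Q : Set M} {ℓ F : M → ℝ}

omit [IsManifold 𝓘(ℝ, E) ∞ M] [FiniteDimensional ℝ E] [CompleteSpace E] [ChartedSpace E M]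
  [TopologicalSpace M] in
theorem pathObj_zero (ℓ F : M → ℝ) : pathObj ℓ F 0 = F := by
  funext x
  simp [pathObj]

theorem iterates_mem [T2Space M] {β : ℝ} (hβ₀ : 0 < β) (hβ : β < √β / (1 + √β))
    (hcov : IsAdmissible cov) (hℓ : IsAffineOn cov Q ℓ)
    (hF : IsSelfConcordant cov 1 (interior Q) F) (hQ : GeodConvex cov Q)
    (hne : ∃ x ∈ Q, ∃ y ∈ Q, ℓ x ≠ ℓ y) {x₀ : M} (hx₀ : x₀ ∈ interior Q)
    (h₀ : diffNorm cov F F x₀ ≤ β) (k : ℕ) :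
    (iterates cov β ℓ F x₀ k).1 ∈ interior Q ∧
      diffNorm cov F (pathObj ℓ F (iterates cov β ℓ F x₀ k).2) (iterates cov β ℓ F x₀ k).1 ≤ β := by
  induction k with
  | zero =>
    refine ⟨hx₀, ?_⟩
    simp only [iterates, pathObj_zero]
    exact h₀
  | succ k ih => exact nextX_mem hβ₀ hβ hcov hℓ hF hQ hne ih.1 ih.2

/-- The geometric factor applies only for `t > 0`, so the induction starts at `t₁ = α / ‖Dℓ‖*`,
taken at `x₀`. -/
theorem le_iterates_succ [T2Space M] {β ν : ℝ} (hβ₀ : 0 < β) (hβ : β < √β / (1 + √β))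
    (hcov : IsAdmissible cov) (hℓ : IsAffineOn cov Q ℓ)
    (hF : IsSelfConcordantBarrier cov ν (interior Q) F) (hQ : GeodConvex cov Q)
    (hne : ∃ x ∈ Q, ∃ y ∈ Q, ℓ x ≠ ℓ y) {x₀ : M} (hx₀ : x₀ ∈ interior Q)
    (h₀ : diffNorm cov F F x₀ ≤ β) (k : ℕ) :
    (1 + stepConst β / (β + √ν)) ^ k * (stepConst β / diffNorm cov F ℓ x₀) ≤
      (iterates cov β ℓ F x₀ (k + 1)).2 := by
  have hα : 0 < stepConst β := sub_pos.2 hβ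
  have hpos := diffNorm_affine_pos hcov hℓ hF.selfConcordant hQ hne hx₀
  induction k with
  | zero =>
    simp [iterates, nextT]
  | succ k ih =>
    have hk := iterates_mem hβ₀ hβ hcov hℓ hF.selfConcordant hQ hne hx₀ h₀ (k + 1)
    have ht : 0 < (iterates cov β ℓ F x₀ (k + 1)).2 := lt_of_lt_of_le (by positivity) ih
    refine le_trans ?_ (le_nextT hcov hℓ hF hQ hne hk.1 hβ ht hk.2)
    rw [pow_succ', mul_assoc]
    exact mul_le_mul_of_nonneg_left ih (by positivity)

end Complexity

end PathFollowing

end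

theorem mainTheorem5 (β : ℝ) (hβ₀ : 0 < β) (hβ : β < Real.sqrt β / (1 + Real.sqrt β)) :
    ∃ K : ℝ, 0 < K ∧
      ∀ (E : Type*) [NormedAddCommGroup E] [NormedSpace ℝ E] [FiniteDimensional ℝ E]
        [CompleteSpace E]
        (M : Type*) [TopologicalSpace M] [T2Space M] [ChartedSpace E M] [IsManifold 𝓘(ℝ, E) ∞ M]
        (cov : PathFollowing.Connection E M) (_ : PathFollowing.IsAdmissible cov)
        (Q : Set M) (_ : IsCompact Q) (_ : PathFollowing.GeodConvex cov Q)
        (_ : (interior Q).Nonempty)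
        (ℓ : M → ℝ) (_ : PathFollowing.IsAffineOn cov Q ℓ) (_ : ∃ x ∈ Q, ∃ y ∈ Q, ℓ x ≠ ℓ y)
        (ν : ℝ) (F : M → ℝ) (_ : PathFollowing.IsSelfConcordantBarrier cov ν (interior Q) F),
        -- one step from a point `(x, t)` that satisfies the invariant
        (∀ x ∈ interior Q, ∀ t : ℝ, 0 ≤ t →
          PathFollowing.diffNorm cov F (PathFollowing.pathObj ℓ F t) x ≤ β →
          (PathFollowing.nextX cov β ℓ F x t ∈ interior Q ∧
            PathFollowing.diffNorm cov F
              (PathFollowing.pathObj ℓ F (PathFollowing.nextT cov β ℓ F x t))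
              (PathFollowing.nextX cov β ℓ F x t) ≤ β) ∧
          (0 < t →
            PathFollowing.diffNorm cov F ℓ x ≤ 1 / t * (β + Real.sqrt ν) ∧
            (1 + PathFollowing.stepConst β / (β + Real.sqrt ν)) * t
              ≤ PathFollowing.nextT cov β ℓ F x t ∧
            ℓ x - sInf (ℓ '' Q) ≤ 1 / t * (ν + (β + Real.sqrt ν) * β / (1 - β)))) ∧
        -- iteration complexity
        (∀ x₀ ∈ interior Q, PathFollowing.diffNorm cov F F x₀ ≤ β → ∀ ε : ℝ, 0 < ε →
          ∃ N : ℕ,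
            (N : ℝ) ≤ K * Real.sqrt ν *
              max 1 (Real.log (ν * PathFollowing.diffNorm cov F ℓ x₀ / ε)) ∧
            ∀ k : ℕ, N ≤ k →
              (PathFollowing.iterates cov β ℓ F x₀ k).1 ∈ interior Q ∧
              ℓ (PathFollowing.iterates cov β ℓ F x₀ k).1 - sInf (ℓ '' Q) ≤ ε) := by
  open PathFollowing in
  have hα : 0 < stepConst β := sub_pos.2 hβ
  have hβ₁ : β < 1 := by
    refine hβ.trans ?_
    rw [div_lt_one (by positivity)]
    linarith
  obtain ⟨K, hK, hbound⟩ := PathFollowing.exists_iteration_bound hα hβ₀ hβ₁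
  refine ⟨K, hK, ?_⟩
  intro E _ _ _ _ M _ _ _ _ cov hcov Q _ hQ _ ℓ hℓ hne ν F hF
  refine ⟨fun x hx t _ hxt ↦ ⟨PathFollowing.nextX_mem hβ₀ hβ hcov hℓ hF.selfConcordant hQ hne hx hxt,
    fun ht ↦ ⟨PathFollowing.diffNorm_affine_le hcov hℓ hF hx ht hxt,
      PathFollowing.le_nextT hcov hℓ hF hQ hne hx hβ ht hxt,
      PathFollowing.sub_sInf_le_of_diffNorm_le hcov hℓ hF hQ hx ht hβ₀ hβ₁ hxt⟩⟩, ?_⟩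
  intro x₀ hx₀ h₀ ε hε
  have hD := PathFollowing.diffNorm_affine_pos hcov hℓ hF.selfConcordant hQ hne hx₀
  -- `1 ≤ ν` can fail in dimension zero; nonconstancy of `ℓ` supplies the nonzero tangent vector.
  obtain ⟨u, hu⟩ := hℓ.exists_diff_ne_zero hcov hQ hne hx₀
  have hν : 1 ≤ ν := hF.one_le hcov hx₀ (u := u) fun h ↦ hu (by rw [h, map_zero])
  obtain ⟨N, hN1, hN, hNk⟩ := hbound ν _ ε hν hD hε
  refine ⟨N, hN, fun k hk ↦ ?_⟩
  have hmem := PathFollowing.iterates_mem hβ₀ hβ hcov hℓ hF.selfConcordant hQ hne hx₀ h₀ k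
  refine ⟨hmem.1, ?_⟩
  obtain ⟨n, rfl⟩ : ∃ n, k = n + 1 := ⟨k - 1, by omega⟩
  have ht := PathFollowing.le_iterates_succ hβ₀ hβ hcov hℓ hF hQ hne hx₀ h₀ n
  have ht0 : 0 < (PathFollowing.iterates cov β ℓ F x₀ (n + 1)).2 :=
    lt_of_lt_of_le (by positivity) ht
  exact (PathFollowing.sub_sInf_le_of_diffNorm_le hcov hℓ hF hQ hmem.1 ht0 hβ₀ hβ₁ hmem.2).trans
    (hNk _ hk _ ht)
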